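/- \textbf{Setting.} Let $\mathcal C,\mathcal A,\mathcal Z$ be countable discrete sets. On a probability space let $C\in\mathcal C$, $A\in\mathcal A$, $Z\in\mathcal Z$, $Y\in\mathbb R$ be the observed covariates, treatment, mediator and outcome, and let $Z(b)$, $Y(b)$, $Y(b,z)$ ($b\in\mathcal A,z\in\mathcal Z$) be the potential mediators and outcomes, with $Y$ and all $Y(b)$ integrable. Assume throughout: almost surely $Y=Y(b)$ and $Z=Z(b)$ if $A=b$, $Y=Y(b,z)$ if $A=b,Z=z$, and $Y(b)=Y(b,Z(b))$; $P(C=c,A=b,Z=z)>0$ for all $c,b,z$; and, for all $b,b'\in\mathcal A$, $z\in\mathcal Z$, \begin{itemize} \item (BD) $(Y(b),Y(b'))\perp A\mid C$ and $Y(b,z)\perp A\mid C$; \item (FD) $Y(b,z)=Y(b',z)$ a.s., $Z(b)\perp A$, and $Y(b,z)\perp Z(b')\mid A$; \item (TD) $Y(b,z)=Y(b',z)$ a.s., $Z(b)\perp A\mid C$, and $Y(b,z)\perp Z(b')\mid A,C$; \item $Z(b)\perp C\mid A$. \end{itemize} Fix $a^*,a\in\mathcal A$ and let $\theta=EY(a^*)-EY(a)$.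 Let $X=(C,A,Z,Y)$, with law $\mathbb P$, and write $\|f\|^2=\mathbb P f^2$ (for a random $f$, the expectation is over a new observation only). For $\eta=(E(Y|z,c),\,p(z|b),\,p(b|c),\,p(c))$ put $p(b)=\sum_c p(c)p(b|c)$, \begin{align*} m(X,\eta)&=\frac{(Y-E(Y|Z,C))(p(Z|a^*)-p(Z|a))}{\sum_{b}p(b|C)p(Z|b)}\\ &\quad+\sum_c\Big(E(Y|Z,c)-\sum_zE(Y|z,c)p(z|A)\Big)\frac{(I(A=a^*)-I(A=a))\,p(c)}{p(A)}+\sum_zE(Y|z,C)(p(z|a^*)-p(z|a)), \end{align*} and $\varphi_{bd,fd,td}(X,\eta,\theta)=m(X,\eta)-\theta$. Let $\eta_0$ be the true nuisance. For each $n$ the data are i.i.d. copies of $X$: an evaluation sample $X_1,\dots,X_n$ and an auxiliary sample of size $N_n\ge0$. The nuisance estimator $\hat\eta=\hat\eta_n$ is an arbitrary measurable function of all these data (so it may use the same sample, or, as in sample splitting, only the auxiliary one), and $\hat\theta=\hat\theta_n$ solves $\frac1n\sum_{i=1}^n\varphi_{bd,fd,td}(X_i,\hat\eta,\hat\theta)=0$.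 \textbf{Theorem. (1) Consistency.} Let the nuisance be $\eta=\eta(\beta)$, where $\beta$ is a vector of finitely many components $\beta_j$ (real numbers, e.g. the values of the nuisance functions, or elements of normed spaces), let $\hat\eta=\eta(\hat\beta)$ with $\hat\beta_j\to_p\bar\beta_j$ for every $j$, and let $\bar\eta=\eta(\bar\beta)=(\bar E(Y|Z,C),\bar p(Z|A),\bar p(A|C),\bar p(C))$. Suppose that $E\,m(X,\bar\eta)$ is well defined, i.e. $m(X,\bar\eta)$ is integrable and $\sum_{z,c}|\bar E(Y|z,c)\,q(z)\,r(c)|<\infty$ for $q\in\{p(\cdot|b),\bar p(\cdot|b)\}$, $b\in\{a^*,a\}$, and $r\in\{p,\bar p\}$ (this is automatic for finite $\mathcal C,\mathcal A,\mathcal Z$). Suppose further that there are a neighbourhood $U$ of $\bar\beta$ and an integrable $M(X)$ such that, for almost every $x$, $\beta\mapsto m(x,\eta(\beta))$ is differentiable at every $\beta\in U$ with $\|\partial m(x,\eta(\beta))/\partial\beta_j\|\le M(x)$ for all $j$. Then $\hat\theta\to_p\theta$ if at least one of the following holds: \begin{itemize} \item $\bar E(Y|Z,C)=E(Y|Z,C)$,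 $\bar p(A|C)=p(A|C)$ and $\bar p(C)=p(C)$; \item $\bar E(Y|Z,C)=E(Y|Z,C)$ and $\bar p(Z|A)=p(Z|A)$; \item $\bar p(Z|A)=p(Z|A)$ and $\bar p(A|C)=p(A|C)$. \end{itemize} \textbf{(2) Asymptotic linearity and regularity.} Suppose $EY^2<\infty$, $N_n=O(n)$, $\|m(\cdot,\hat\eta)-m(\cdot,\eta_0)\|^2=o_p(1)$, and the following boundedness conditions, in which the constants $\varepsilon$ do not depend on $n$ and inequalities hold $\mathbb P$-a.s. in a new $(Z,A,C)$, those involving estimates with probability (over the data) tending to one: \begin{itemize} \item for some $\varepsilon$: $|\hat E(Y|Z,C)|<\varepsilon$; $|\hat p(Z|\breve a)|<\varepsilon$ for $\breve a\in\{a^*,a\}$; $|\hat p(A|C)|<\varepsilon$; $|\hat p(C)|<\varepsilon$; \item for some $\varepsilon>0$: $p(Z|A)$, $p(A|C)$, $p(C)$, and, for every $b\in\mathcal A$, $p(Z|b)$, $p(b|C)$, $\hat p(Z|b)$, $\hat p(b|C)$ exceed $\varepsilon$; and $\hat p(\breve a)=\sum_c\hat p(c)\hat p(\breve a|c)>\varepsilon$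 for $\breve a\in\{a^*,a\}$. \end{itemize} Suppose also that, for $\breve a\in\{a^*,a\}$, each of the following products is $o_p(n^{-1/2})$: \begin{itemize} \item $\|\hat E(Y|Z,C)-E(Y|Z,C)\|\cdot\|\hat p(A|C)-p(A|C)\|$; \item $\|\hat E(Y|Z,C)-E(Y|Z,C)\|\cdot\|\hat p(Z|A)-p(Z|A)\|$; \item $\|\hat E(Y|Z,C)-E(Y|Z,C)\|\cdot\|\hat p(Z|\breve a)-p(Z|\breve a)\|$; \item $\|\hat p(Z|\breve a)-p(Z|\breve a)\|\cdot|\hat p(\breve a)-p(\breve a)|$; \item $\|\hat p(Z|\breve a)-p(Z|\breve a)\|\cdot\|\hat p(C)-p(C)\|$. \end{itemize} Then $\hat\theta$ is a regular asymptotically linear estimator of $\theta$ with influence function $\varphi_{bd,fd,td}$: the function $\varphi_{bd,fd,td}(X,\eta_0,\theta)$ has mean zero and finite variance, and $$\sqrt n(\hat\theta-\theta)=\frac1{\sqrt n}\sum_{i=1}^n\varphi_{bd,fd,td}(X_i,\eta_0,\theta)+o_p(1);$$ and there is one probability law $L$ on $\mathbb R$ such that for every regular parametric submodel $(P_\beta)_\beta$,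 $\beta\in\mathbb R^k$ near $0$, of the causal model above with $P_0=\mathbb P$ (observed-data laws with densities with respect to a common $\sigma$-finite measure, differentiable in quadratic mean at $0$, with $E_\beta Y^2$ bounded near $0$), and every sequence $\beta_n$ with $\sqrt n\,\|\beta_n\|$ bounded, $\sqrt n(\hat\theta-\theta(\beta_n))$ converges in distribution to $L$ when the data of stage $n$ are i.i.d. from $P_{\beta_n}$, where $\theta(\beta)$ is the average causal effect in the member $\beta$ of the submodel. -/

import Mathlib

open MeasureTheory ProbabilityTheory Filter Topology Asymptotics
open scoped BoundedContinuousFunction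

universe u

noncomputable section

namespace TripleDoor

/-! ### Observations, samples, convergence in probability -/

/-- An observation `(C, A, Z, Y)`. -/
abbrev Obs (𝒞 𝒜 𝒵 : Type u) : Type u := 𝒞 × 𝒜 × 𝒵 × ℝ

/-- The data used at stage `n`: the evaluation sample `X₁, …, Xₙ`, over which the estimating
equation is averaged, and an auxiliary sample of size `N` (possibly `0`). -/
abbrev Data (𝒞 𝒜 𝒵 : Type u) (n N : ℕ) : Type u :=
  (Fin n → Obs 𝒞 𝒜 𝒵) × (Fin N → Obs 𝒞 𝒜 𝒵)

/-- The joint law of the data when all observations are i.i.d. with law `P`. -/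
def sampleLaw {𝒞 𝒜 𝒵 : Type u} [MeasurableSpace 𝒞] [MeasurableSpace 𝒜] [MeasurableSpace 𝒵]
    (P : Measure (Obs 𝒞 𝒜 𝒵)) (n N : ℕ) : Measure (Data 𝒞 𝒜 𝒵 n N) :=
  (Measure.pi fun _ : Fin n => P).prod (Measure.pi fun _ : Fin N => P)

/-- `fₙ = o_p(1)`, where `fₙ` is a real statistic of the data of stage `n`, whose law is `μ n`. -/
def IsLittleOpOne {Ω : ℕ → Type*} [∀ n, MeasurableSpace (Ω n)] (μ : ∀ n, Measure (Ω n))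
    (f : ∀ n, Ω n → ℝ) : Prop :=
  ∀ ε : ℝ, 0 < ε → Tendsto (fun n => μ n {ω | ε ≤ |f n ω|}) atTop (𝓝 0)

/-- The event `E n` has probability tending to one. -/
def WithProbTendingToOne {Ω : ℕ → Type*} [∀ n, MeasurableSpace (Ω n)] (μ : ∀ n, Measure (Ω n))
    (E : ∀ n, Set (Ω n)) : Prop :=
  Tendsto (fun n => μ n (E n)) atTop (𝓝 1)

/-- `‖f‖ = (ℙ f²)^{1/2}`. -/
def l2norm {α : Type*} [MeasurableSpace α] (P : Measure α) (f : α → ℝ) : ℝ :=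
  √(∫ x, f x ^ 2 ∂P)

/-! ### Nuisance functions, the estimating function -/

/-- A value of the nuisance `η`: `e z c` stands for `E(Y | z, c)`, `pZ a z` for `p(z | a)`,
`pA c a` for `p(a | c)` and `pC c` for `p(c)`. -/
structure Nuisance (𝒞 𝒜 𝒵 : Type u) where
  e : 𝒵 → 𝒞 → ℝ
  pZ : 𝒜 → 𝒵 → ℝ
  pA : 𝒞 → 𝒜 → ℝ
  pC : 𝒞 → ℝ

section Nuisance

variable {𝒞 𝒜 𝒵 : Type u}

/-- The marginal `p(a) = ∑_c p(c) p(a | c)` implied by a value of the nuisance. -/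
def Nuisance.margA (η : Nuisance 𝒞 𝒜 𝒵) (a : 𝒜) : ℝ := ∑' c, η.pC c * η.pA c a

/-- `I(A = a)` at `A = b`. -/
def ind (a b : 𝒜) : ℝ := Set.indicator {a} (fun _ => (1 : ℝ)) b

/-- The function `m = φ_{bd,fd,td} + θ`. -/
def mFun (astar a : 𝒜) (η : Nuisance 𝒞 𝒜 𝒵) : Obs 𝒞 𝒜 𝒵 → ℝ := fun (C, A, Z, Y) =>
  (Y - η.e Z C) * (η.pZ astar Z - η.pZ a Z) / (∑' b, η.pA C b * η.pZ b Z)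
  + (∑' c, (η.e Z c - ∑' z, η.e z c * η.pZ A z)
      * ((ind astar A - ind a A) * η.pC c / η.margA A))
  + ∑' z, η.e z C * (η.pZ astar z - η.pZ a z)

/-- The influence function `φ_{bd,fd,td}(x, η, θ)`. -/
def phi (astar a : 𝒜) (η : Nuisance 𝒞 𝒜 𝒵) (θ : ℝ) (x : Obs 𝒞 𝒜 𝒵) : ℝ :=
  mFun astar a η x - θ

variable [MeasurableSpace 𝒞] [MeasurableSpace 𝒜] [MeasurableSpace 𝒵]

/-- The nuisance functions of the observed-data law `P`. -/
def trueNuisance (P : Measure (Obs 𝒞 𝒜 𝒵)) : Nuisance 𝒞 𝒜 𝒵 where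
  e z c := (∫ x in {x | x.2.2.1 = z ∧ x.1 = c}, x.2.2.2 ∂P) / P.real {x | x.2.2.1 = z ∧ x.1 = c}
  pZ a z := P.real {x | x.2.2.1 = z ∧ x.2.1 = a} / P.real {x | x.2.1 = a}
  pA c a := P.real {x | x.2.1 = a ∧ x.1 = c} / P.real {x | x.1 = c}
  pC c := P.real {x | x.1 = c}

/-- The marginal probability `p(a)` under `P`. -/
def probA (P : Measure (Obs 𝒞 𝒜 𝒵)) (a : 𝒜) : ℝ := P.real {x | x.2.1 = a}

/-- Every value of the estimated nuisance functions is a measurable function of the data. -/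
structure MeasurableNuisance {Ω : Type*} [MeasurableSpace Ω] (η : Ω → Nuisance 𝒞 𝒜 𝒵) : Prop where
  e : ∀ z c, Measurable fun ω => (η ω).e z c
  pZ : ∀ a z, Measurable fun ω => (η ω).pZ a z
  pA : ∀ c a, Measurable fun ω => (η ω).pA c a
  pC : ∀ c, Measurable fun ω => (η ω).pC c

end Nuisance

/-! ### The causal model -/

/-- Observed variables `C, A, Z, Y` and potential variables `Z(a)`, `Y(a)`, `Y(a, z)` on a
probability space. -/
structure CausalSystem (𝒞 𝒜 𝒵 : Type u)
    [MeasurableSpace 𝒞] [MeasurableSpace 𝒜] [MeasurableSpace 𝒵] where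
  Ω : Type u
  [mΩ : MeasurableSpace Ω]
  μ : Measure Ω
  [prob : IsProbabilityMeasure μ]
  cov : Ω → 𝒞
  treat : Ω → 𝒜
  med : Ω → 𝒵
  out : Ω → ℝ
  /-- `Z(a)` -/
  medOf : 𝒜 → Ω → 𝒵
  /-- `Y(a)` -/
  outOf : 𝒜 → Ω → ℝ
  /-- `Y(a, z)` -/
  outOf₂ : 𝒜 → 𝒵 → Ω → ℝ
  measurable_cov : Measurable cov
  measurable_treat : Measurable treat
  measurable_med : Measurable med
  measurable_out : Measurable out
  measurable_medOf : ∀ a, Measurable (medOf a)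
  measurable_outOf : ∀ a, Measurable (outOf a)
  measurable_outOf₂ : ∀ a z, Measurable (outOf₂ a z)

attribute [instance] CausalSystem.mΩ CausalSystem.prob

namespace CausalSystem

variable {𝒞 𝒜 𝒵 : Type u} [MeasurableSpace 𝒞] [MeasurableSpace 𝒜] [MeasurableSpace 𝒵]

/-- The law of the observation `(C, A, Z, Y)`. -/
def law (S : CausalSystem 𝒞 𝒜 𝒵) : Measure (Obs 𝒞 𝒜 𝒵) :=
  S.μ.map fun ω => (S.cov ω, S.treat ω, S.med ω, S.out ω)

/-- The average causal effect `θ = E Y(a*) - E Y(a)`. -/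
def ace (S : CausalSystem 𝒞 𝒜 𝒵) (astar a : 𝒜) : ℝ :=
  (∫ ω, S.outOf astar ω ∂S.μ) - ∫ ω, S.outOf a ω ∂S.μ

/-- The standing assumptions: consistency, composition, positivity, finite expectations. -/
structure Standing (S : CausalSystem 𝒞 𝒜 𝒵) : Prop where
  consistency_out : ∀ a, ∀ᵐ ω ∂S.μ, S.treat ω = a → S.out ω = S.outOf a ω
  consistency_med : ∀ a, ∀ᵐ ω ∂S.μ, S.treat ω = a → S.med ω = S.medOf a ω
  consistency_out₂ : ∀ a z, ∀ᵐ ω ∂S.μ,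
    S.treat ω = a → S.med ω = z → S.out ω = S.outOf₂ a z ω
  /-- `Y(a) = Y(a, Z(a))` -/
  composition : ∀ a, ∀ᵐ ω ∂S.μ, S.outOf a ω = S.outOf₂ a (S.medOf a ω) ω
  positivity : ∀ c a z, 0 < S.μ {ω | S.cov ω = c ∧ S.treat ω = a ∧ S.med ω = z}
  integrable_out : Integrable S.out S.μ
  integrable_outOf : ∀ a, Integrable (S.outOf a) S.μ

/-- The back-door assumption: `Y(a), Y(a') ⫫ A | C`, and `Y(a, z) ⫫ A | C`. -/
structure BackDoor (S : CausalSystem 𝒞 𝒜 𝒵) : Prop where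
  pair : ∀ a a' c, IndepFun (fun ω => (S.outOf a ω, S.outOf a' ω)) S.treat
    (cond S.μ (S.cov ⁻¹' {c}))
  joint : ∀ a z c, IndepFun (S.outOf₂ a z) S.treat (cond S.μ (S.cov ⁻¹' {c}))

/-- The front-door assumption. -/
structure FrontDoor (S : CausalSystem 𝒞 𝒜 𝒵) : Prop where
  fd1 : ∀ a a' z, ∀ᵐ ω ∂S.μ, S.outOf₂ a z ω = S.outOf₂ a' z ω
  fd2 : ∀ a, IndepFun (S.medOf a) S.treat S.μ
  fd3 : ∀ a a' z b, IndepFun (S.outOf₂ a z) (S.medOf a') (cond S.μ (S.treat ⁻¹' {b}))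

/-- The two-door assumption. -/
structure TwoDoor (S : CausalSystem 𝒞 𝒜 𝒵) : Prop where
  td1 : ∀ a a' z, ∀ᵐ ω ∂S.μ, S.outOf₂ a z ω = S.outOf₂ a' z ω
  td2 : ∀ a c, IndepFun (S.medOf a) S.treat (cond S.μ (S.cov ⁻¹' {c}))
  td3 : ∀ a a' z b c, IndepFun (S.outOf₂ a z) (S.medOf a')
    (cond S.μ (S.treat ⁻¹' {b} ∩ S.cov ⁻¹' {c}))

/-- The model: standing, back-, front- and two-door assumptions, and `Z(a) ⫫ C | A`. -/
structure InModel (S : CausalSystem 𝒞 𝒜 𝒵) : Prop where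
  standing : S.Standing
  backDoor : S.BackDoor
  frontDoor : S.FrontDoor
  twoDoor : S.TwoDoor
  medOf_indep_cov : ∀ a b, IndepFun (S.medOf a) S.cov (cond S.μ (S.treat ⁻¹' {b}))

end CausalSystem

section Estimation

variable {𝒞 𝒜 𝒵 : Type u} [MeasurableSpace 𝒞] [MeasurableSpace 𝒜] [MeasurableSpace 𝒵]

/-! ### Regular asymptotically linear estimators -/

/-- A regular parametric submodel of the causal model through the observed-data law of `S`:
a family of causal systems of the model indexed by `β ∈ ℝᵏ` near `0`, whose observed-data laws have
densities with respect to a common `σ`-finite measure that are differentiable in quadratic mean at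
`0`, and with locally bounded second moments of the outcome. -/
structure RegularSubmodel (S : CausalSystem 𝒞 𝒜 𝒵) where
  k : ℕ
  sys : (Fin k → ℝ) → CausalSystem 𝒞 𝒜 𝒵
  ν : Measure (Obs 𝒞 𝒜 𝒵)
  sigmaFinite : SigmaFinite ν
  dens : (Fin k → ℝ) → Obs 𝒞 𝒜 𝒵 → ℝ
  score : Fin k → Obs 𝒞 𝒜 𝒵 → ℝ
  measurable_dens : ∀ β, Measurable (dens β)
  dens_nonneg : ∀ β x, 0 ≤ dens β x
  measurable_score : ∀ j, Measurable (score j)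
  inModel : ∀ᶠ β in 𝓝 0, (sys β).InModel
  law_zero : (sys 0).law = S.law
  law_eq : ∀ᶠ β in 𝓝 0, (sys β).law = ν.withDensity fun x => ENNReal.ofReal (dens β x)
  memLp_score : ∀ j, MemLp (score j) 2 S.law
  qmd : (fun β => ∫ x, (√(dens β x) - √(dens 0 x)
      - (1 / 2) * (∑ j, β j * score j x) * √(dens 0 x)) ^ 2 ∂ν) =o[𝓝 0] fun β => ‖β‖ ^ 2
  second_moment : ∃ K : ℝ, ∀ᶠ β in 𝓝 0,
    MemLp (fun x : Obs 𝒞 𝒜 𝒵 => x.2.2.2) 2 (sys β).law ∧ ∫ x, x.2.2.2 ^ 2 ∂(sys β).law ≤ K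

/-- `T` is asymptotically linear for the parameter value `θ`, with influence function `ψ`, when the
observations have law `P`. -/
structure AsympLinear (P : Measure (Obs 𝒞 𝒜 𝒵)) (θ : ℝ) (N : ℕ → ℕ)
    (T : ∀ n, Data 𝒞 𝒜 𝒵 n (N n) → ℝ) (ψ : Obs 𝒞 𝒜 𝒵 → ℝ) : Prop where
  memLp : MemLp ψ 2 P
  mean_zero : ∫ x, ψ x ∂P = 0
  expansion : IsLittleOpOne (fun n => sampleLaw P n (N n))
    fun n D => √(n : ℝ) * (T n D - θ) - (√(n : ℝ))⁻¹ * ∑ i, ψ (D.1 i)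

/-- `T` is a regular estimator of the average causal effect at `S`: along every regular parametric
submodel and every sequence `βₙ` of local parameters with `√n βₙ` bounded, when the data of stage
`n` are i.i.d. from the `βₙ`-th member of the submodel, `√n (Tₙ - θ(βₙ))` converges in
distribution to a limit that does not depend on the submodel and the sequence. -/
def IsRegularEstimator (S : CausalSystem 𝒞 𝒜 𝒵) (astar a : 𝒜) (N : ℕ → ℕ)
    (T : ∀ n, Data 𝒞 𝒜 𝒵 n (N n) → ℝ) : Prop :=
  ∃ L : Measure ℝ, IsProbabilityMeasure L ∧
    ∀ (R : RegularSubmodel S) (β : ℕ → Fin R.k → ℝ),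
      (∃ B : ℝ, ∀ n : ℕ, √(n : ℝ) * ‖β n‖ ≤ B) →
      ∀ g : ℝ →ᵇ ℝ,
        Tendsto
          (fun n => ∫ D, g (√(n : ℝ) * (T n D - (R.sys (β n)).ace astar a))
            ∂(sampleLaw (R.sys (β n)).law n (N n)))
          atTop (𝓝 (∫ t, g t ∂L))

/-- `T` solves the estimating equation `(1/n) ∑ᵢ φ_{bd,fd,td}(Xᵢ, η̂, T) = 0` at every stage. -/
def SolvesEstimatingEquation (astar a : 𝒜) (N : ℕ → ℕ)
    (ηhat : ∀ n, Data 𝒞 𝒜 𝒵 n (N n) → Nuisance 𝒞 𝒜 𝒵)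
    (T : ∀ n, Data 𝒞 𝒜 𝒵 n (N n) → ℝ) : Prop :=
  ∀ n (D : Data 𝒞 𝒜 𝒵 n (N n)),
    (n : ℝ)⁻¹ * ∑ i, phi astar a (ηhat n D) (T n D) (D.1 i) = 0

/-! ### Conditions for consistency -/

/-- The sums in `E m(X, η̄)` converge absolutely and the expectation exists. (This is automatic when
`𝒞`, `𝒜`, `𝒵` are finite.) -/
structure WellDefinedMean (P : Measure (Obs 𝒞 𝒜 𝒵)) (astar a : 𝒜)
    (ηbar : Nuisance 𝒞 𝒜 𝒵) : Prop where
  integrable : Integrable (mFun astar a ηbar) P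
  summable : ∀ b ∈ ({astar, a} : Set 𝒜), ∀ q ∈ ({(trueNuisance P).pZ b, ηbar.pZ b} : Set (𝒵 → ℝ)),
    ∀ r ∈ ({(trueNuisance P).pC, ηbar.pC} : Set (𝒞 → ℝ)),
      Summable fun zc : 𝒵 × 𝒞 => ηbar.e zc.1 zc.2 * q zc.1 * r zc.2

/-- Regularity for consistency. The nuisance is a function `η` of a vector `β` with finitely many
components `βⱼ`, each a real number or, more generally, an element of a normed space. Near `β̄`,
`m(x, η(β))` is differentiable in `β` and its partial derivatives are dominated by an integrable
function `M` of `x`. -/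
def ConsistencyRegularity (P : Measure (Obs 𝒞 𝒜 𝒵)) (astar a : 𝒜)
    {ι : Type*} [Fintype ι] [DecidableEq ι] {E : ι → Type*} [∀ j, NormedAddCommGroup (E j)]
    [∀ j, NormedSpace ℝ (E j)] (η : (∀ j, E j) → Nuisance 𝒞 𝒜 𝒵) (βbar : ∀ j, E j) : Prop :=
  ∃ M : Obs 𝒞 𝒜 𝒵 → ℝ, Integrable M P ∧ ∃ U ∈ 𝓝 βbar, ∀ᵐ x ∂P, ∀ β ∈ U,
    DifferentiableAt ℝ (fun β' => mFun astar a (η β') x) β ∧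
    ∀ j, ‖fderiv ℝ (fun v => mFun astar a (η (Function.update β j v)) x) (β j)‖ ≤ M x

/-- At least one of the three sets of nuisance models is correctly specified. -/
def CorrectlySpecified (P : Measure (Obs 𝒞 𝒜 𝒵)) (ηbar : Nuisance 𝒞 𝒜 𝒵) : Prop :=
  (ηbar.e = (trueNuisance P).e ∧ ηbar.pA = (trueNuisance P).pA ∧ ηbar.pC = (trueNuisance P).pC) ∨
  (ηbar.e = (trueNuisance P).e ∧ ηbar.pZ = (trueNuisance P).pZ) ∨
  (ηbar.pZ = (trueNuisance P).pZ ∧ ηbar.pA = (trueNuisance P).pA)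

/-! ### Conditions for asymptotic linearity and regularity -/

/-- Boundedness conditions; `P`-almost sure statements concern a new observation `x`. -/
structure Boundedness (P : Measure (Obs 𝒞 𝒜 𝒵)) (astar a : 𝒜) (N : ℕ → ℕ)
    (ηhat : ∀ n, Data 𝒞 𝒜 𝒵 n (N n) → Nuisance 𝒞 𝒜 𝒵) : Prop where
  e_hat_lt : ∃ ε : ℝ, WithProbTendingToOne (fun n => sampleLaw P n (N n))
    fun n => {D | ∀ᵐ x ∂P, |(ηhat n D).e x.2.2.1 x.1| < ε}
  pZ_obs : ∃ ε > (0 : ℝ), ∀ᵐ x ∂P, ε < (trueNuisance P).pZ x.2.1 x.2.2.1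
  pZ_all : ∃ ε > (0 : ℝ), ∀ b, ∀ᵐ x ∂P, ε < (trueNuisance P).pZ b x.2.2.1
  pZ_hat_lt : ∃ ε : ℝ, ∀ b ∈ ({astar, a} : Set 𝒜),
    WithProbTendingToOne (fun n => sampleLaw P n (N n))
      fun n => {D | ∀ᵐ x ∂P, |(ηhat n D).pZ b x.2.2.1| < ε}
  pZ_hat_gt : ∃ ε > (0 : ℝ), ∀ b, WithProbTendingToOne (fun n => sampleLaw P n (N n))
      fun n => {D | ∀ᵐ x ∂P, ε < (ηhat n D).pZ b x.2.2.1}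
  pA_obs : ∃ ε > (0 : ℝ), ∀ᵐ x ∂P, ε < (trueNuisance P).pA x.1 x.2.1
  pA_all : ∃ ε > (0 : ℝ), ∀ b, ∀ᵐ x ∂P, ε < (trueNuisance P).pA x.1 b
  pA_hat_lt : ∃ ε : ℝ, WithProbTendingToOne (fun n => sampleLaw P n (N n))
    fun n => {D | ∀ᵐ x ∂P, |(ηhat n D).pA x.1 x.2.1| < ε}
  pA_hat_gt : ∃ ε > (0 : ℝ), ∀ b, WithProbTendingToOne (fun n => sampleLaw P n (N n))
      fun n => {D | ∀ᵐ x ∂P, ε < (ηhat n D).pA x.1 b}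
  margA_hat_gt : ∃ ε > (0 : ℝ), ∀ b ∈ ({astar, a} : Set 𝒜),
    WithProbTendingToOne (fun n => sampleLaw P n (N n)) fun n => {D | ε < (ηhat n D).margA b}
  pC_gt : ∃ ε > (0 : ℝ), ∀ᵐ x ∂P, ε < (trueNuisance P).pC x.1
  pC_hat_lt : ∃ ε : ℝ, WithProbTendingToOne (fun n => sampleLaw P n (N n))
    fun n => {D | ∀ᵐ x ∂P, |(ηhat n D).pC x.1| < ε}

/-- Product-rate conditions: each product of two estimation errors is `o_p(n^{-1/2})`. -/
structure ProductRates (P : Measure (Obs 𝒞 𝒜 𝒵)) (astar a : 𝒜) (N : ℕ → ℕ)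
    (ηhat : ∀ n, Data 𝒞 𝒜 𝒵 n (N n) → Nuisance 𝒞 𝒜 𝒵) : Prop where
  e_pA : IsLittleOpOne (fun n => sampleLaw P n (N n)) fun n D => √(n : ℝ) *
    (l2norm P (fun x => (ηhat n D).e x.2.2.1 x.1 - (trueNuisance P).e x.2.2.1 x.1) *
     l2norm P (fun x => (ηhat n D).pA x.1 x.2.1 - (trueNuisance P).pA x.1 x.2.1))
  e_pZ : IsLittleOpOne (fun n => sampleLaw P n (N n)) fun n D => √(n : ℝ) *
    (l2norm P (fun x => (ηhat n D).e x.2.2.1 x.1 - (trueNuisance P).e x.2.2.1 x.1) *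
     l2norm P (fun x => (ηhat n D).pZ x.2.1 x.2.2.1 - (trueNuisance P).pZ x.2.1 x.2.2.1))
  e_pZ_at : ∀ b ∈ ({astar, a} : Set 𝒜),
    IsLittleOpOne (fun n => sampleLaw P n (N n)) fun n D => √(n : ℝ) *
      (l2norm P (fun x => (ηhat n D).e x.2.2.1 x.1 - (trueNuisance P).e x.2.2.1 x.1) *
       l2norm P (fun x => (ηhat n D).pZ b x.2.2.1 - (trueNuisance P).pZ b x.2.2.1))
  pZ_margA : ∀ b ∈ ({astar, a} : Set 𝒜),
    IsLittleOpOne (fun n => sampleLaw P n (N n)) fun n D => √(n : ℝ) *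
      (l2norm P (fun x => (ηhat n D).pZ b x.2.2.1 - (trueNuisance P).pZ b x.2.2.1) *
       |(ηhat n D).margA b - probA P b|)
  pZ_pC : ∀ b ∈ ({astar, a} : Set 𝒜),
    IsLittleOpOne (fun n => sampleLaw P n (N n)) fun n D => √(n : ℝ) *
      (l2norm P (fun x => (ηhat n D).pZ b x.2.2.1 - (trueNuisance P).pZ b x.2.2.1) *
       l2norm P (fun x => (ηhat n D).pC x.1 - (trueNuisance P).pC x.1))

end Estimation

end TripleDoor

end

open TripleDoor

set_option linter.unusedSectionVars false

/-! The causal assumptions are used only through three facts about the observed law, collected in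
`ObsModel`. Every atom of `(C, A, Z)` has positive mass. The atom masses factor as `p(c) p(b|c)
p(z|b)`. The mean of `Y(b)` is `∑_{z,c} E(Y|z,c) p(z|b) p(c)`. The last one is the back-door
formula, refined by `Z`, combined with the fact that the mean outcome on an atom does not depend on
`A` and that `Z ⫫ C | A`.

From these, `E m(X, η)` is computed at an arbitrary nuisance value by integrating the three summands
of `m` separately (`hasSum_integral_mFun`). The result equals `θ` under each of the three
specifications. Consistency then follows from the law of large numbers at `η(β̄)` together with a
Lipschitz bound in `β`. When the index sets are finite, `E m(X, η) - θ` is a sum of products of two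
nuisance errors (`integral_mFun_sub`).

For asymptotic linearity, `√n(θ̂ - θ)` is split into the empirical process of `m(·, η₀)`, the
empirical process of `m(·, η̂) - m(·, η₀)`, and `√n` times the bias of `m(·, η̂)`. The lower bounds
on probabilities force `𝒞`, `𝒜`, `𝒵` to be finite. A function affine in `Y` on each of finitely many
atoms lies in a finite-dimensional space, so its empirical process is controlled by its `L²`-norm
however it depends on the data (`isLittleOpOne_empProc_of_l2norm`). Neither sample splitting nor an
entropy condition is needed. The bias is negligible by the product rates.

For regularity, differentiability in quadratic mean turns local parameters into a `LocalPath`, with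
squared Hellinger distance `O(1/n)` and no mass of order `1/n` on vanishing sets. Along such a path
the data laws are contiguous (`LocalPath.contiguous`), which carries the linear expansion over to
`Qₙ`. The second-order bias formula, now with law `Qₙ` and nuisance frozen at that of `P`, shows
that the `Qₙ`-mean of the influence function absorbs the shift of the target up to `O(1/n)`
(`tendsto_sqrt_mul_bias`). A direct characteristic function computation under `Qₙ`
(`tendsto_integral_exp_pow`) gives the centred normal limit whose variance is that of the influence
function under `P`, the same for all submodels and sequences. -/

namespace TripleDoor

/-! ### Stochastic order symbols. -/

section OrderInProbability

variable {Ω : ℕ → Type*} [∀ n, MeasurableSpace (Ω n)] {μ : ∀ n, Measure (Ω n)}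
  {f g : ∀ n, Ω n → ℝ}

/-- `fₙ = O_p(1)`. -/
def IsBigOpOne (μ : ∀ n, Measure (Ω n)) (f : ∀ n, Ω n → ℝ) : Prop :=
  ∀ δ : ENNReal, 0 < δ → ∃ K : ℝ, 0 < K ∧ ∀ᶠ n in atTop, μ n {ω | K < |f n ω|} ≤ δ

/-- Domination is only required off exceptional events of vanishing probability. No measurability of
`f` or `B` is involved, since the measure acts as an outer measure. -/
theorem IsLittleOpOne.of_abs_le_of_notMem {B : ∀ n, Set (Ω n)} (hg : IsLittleOpOne μ g)
    (hB : Tendsto (fun n => μ n (B n)) atTop (𝓝 0))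
    (h : ∀ᶠ n in atTop, ∀ ω ∉ B n, |f n ω| ≤ |g n ω|) : IsLittleOpOne μ f := by
  intro ε hε
  have h1 := (hg ε hε).add hB
  rw [add_zero] at h1
  refine tendsto_of_tendsto_of_tendsto_of_le_of_le' tendsto_const_nhds h1
    (Eventually.of_forall fun _ => zero_le) ?_
  filter_upwards [h] with n hn
  refine (measure_mono fun ω hω => ?_).trans (measure_union_le _ _)
  by_cases hb : ω ∈ B n
  · exact Or.inr hb
  · exact Or.inl (le_trans hω (hn ω hb))

theorem IsLittleOpOne.of_abs_le (hg : IsLittleOpOne μ g)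
    (h : ∀ᶠ n in atTop, ∀ ω, |f n ω| ≤ |g n ω|) : IsLittleOpOne μ f :=
  hg.of_abs_le_of_notMem (B := fun _ => ∅) (by simp) (h.mono fun _ hn ω _ => hn ω)

theorem IsLittleOpOne.of_ae_eq (hg : IsLittleOpOne μ g) (h : ∀ᶠ n in atTop, f n =ᵐ[μ n] g n) :
    IsLittleOpOne μ f := by
  refine hg.of_abs_le_of_notMem (B := fun n => {ω | f n ω ≠ g n ω}) ?_ ?_
  · refine tendsto_const_nhds.congr' ?_
    filter_upwards [h] with n hn
    exact (ae_iff.1 hn).symm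
  · refine Eventually.of_forall fun n ω hω => ?_
    simp only [Set.mem_ofPred_eq, not_not] at hω
    rw [hω]

theorem IsLittleOpOne.add (hf : IsLittleOpOne μ f) (hg : IsLittleOpOne μ g) :
    IsLittleOpOne μ fun n ω => f n ω + g n ω := by
  intro ε hε
  have h1 := (hf (ε / 2) (by linarith)).add (hg (ε / 2) (by linarith))
  rw [add_zero] at h1
  refine tendsto_of_tendsto_of_tendsto_of_le_of_le tendsto_const_nhds h1 (fun _ => zero_le)
    fun n => (measure_mono fun ω hω => ?_).trans (measure_union_le _ _)
  simp only [Set.mem_ofPred_eq, Set.mem_union] at hω ⊢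
  by_contra! hc
  have := abs_add_le (f n ω) (g n ω)
  linarith

theorem IsLittleOpOne.abs (hf : IsLittleOpOne μ f) : IsLittleOpOne μ fun n ω => |f n ω| :=
  hf.of_abs_le (Eventually.of_forall fun _ _ => by rw [abs_abs])

theorem isLittleOpOne_zero : IsLittleOpOne μ fun _ _ => 0 := by
  intro ε hε
  simp [hε.not_ge]

theorem IsLittleOpOne.sum {ι : Type*} (s : Finset ι) {F : ι → ∀ n, Ω n → ℝ}
    (hF : ∀ i ∈ s, IsLittleOpOne μ (F i)) : IsLittleOpOne μ fun n ω => ∑ i ∈ s, F i n ω := by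
  classical
  induction s using Finset.induction_on with
  | empty => simpa using isLittleOpOne_zero
  | insert i s hi ih =>
    simp_rw [Finset.sum_insert hi]
    exact (hF i (Finset.mem_insert_self _ _)).add
      (ih fun j hj => hF j (Finset.mem_insert_of_mem hj))

theorem IsLittleOpOne.const_mul (hf : IsLittleOpOne μ f) (c : ℝ) :
    IsLittleOpOne μ fun n ω => c * f n ω := by
  intro ε hε
  have hc : 0 < |c| + 1 := by positivity
  refine tendsto_of_tendsto_of_tendsto_of_le_of_le tendsto_const_nhds (hf (ε / (|c| + 1))
    (by positivity)) (fun _ => zero_le) fun n => measure_mono fun ω hω => ?_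
  simp only [Set.mem_ofPred_eq] at hω ⊢
  rw [div_le_iff₀ hc]
  rw [abs_mul] at hω
  nlinarith [abs_nonneg (f n ω)]

theorem IsLittleOpOne.mul_isBigOpOne (hf : IsLittleOpOne μ f) (hg : IsBigOpOne μ g) :
    IsLittleOpOne μ fun n ω => f n ω * g n ω := by
  intro ε hε
  rw [ENNReal.tendsto_nhds_zero]
  intro δ hδ
  obtain ⟨K, hK, h⟩ := hg (δ / 2) (ENNReal.half_pos hδ.ne')
  have h2 := (ENNReal.tendsto_nhds_zero.1 (hf (ε / K) (by positivity))) (δ / 2)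
    (ENNReal.half_pos hδ.ne')
  filter_upwards [h, h2] with n hn hn2
  calc _ ≤ μ n ({ω | ε / K ≤ |f n ω|} ∪ {ω | K < |g n ω|}) := ?_
    _ ≤ _ := measure_union_le _ _
    _ ≤ δ / 2 + δ / 2 := add_le_add hn2 hn
    _ = δ := ENNReal.add_halves δ
  refine measure_mono fun ω hω => ?_
  simp only [Set.mem_ofPred_eq, Set.mem_union] at hω ⊢
  by_contra! hc
  rw [abs_mul] at hω
  have h3 : |f n ω| * |g n ω| ≤ |f n ω| * K := by
    gcongr
    exact hc.2
  have h4 := (lt_div_iff₀ hK).1 hc.1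
  linarith

theorem IsLittleOpOne.sqrt (hf : IsLittleOpOne μ f) : IsLittleOpOne μ fun n ω => √(f n ω) := by
  intro ε hε
  refine tendsto_of_tendsto_of_tendsto_of_le_of_le tendsto_const_nhds (hf (ε ^ 2)
    (by positivity)) (fun _ => zero_le) fun n => measure_mono fun ω hω => ?_
  simp only [Set.mem_ofPred_eq] at hω ⊢
  rw [abs_of_nonneg (Real.sqrt_nonneg _)] at hω
  exact ((Real.le_sqrt' hε).1 hω).trans (le_abs_self _)

theorem isLittleOpOne_of_tendsto [∀ n, IsProbabilityMeasure (μ n)] {c : ℕ → ℝ}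
    (hc : Tendsto c atTop (𝓝 0)) : IsLittleOpOne μ fun n _ => c n := by
  intro ε hε
  refine tendsto_const_nhds.congr' ?_
  filter_upwards [(tendsto_zero_iff_abs_tendsto_zero c).1 hc |>.eventually_lt_const hε] with n hn
  have : {ω : Ω n | ε ≤ |c n|} = ∅ := by
    ext ω; simpa using hn
  simp [this]

/-- Chebyshev's inequality: a sequence bounded in `L²` is `O_p(1)`. -/
theorem isBigOpOne_of_lintegral_sq_le {C : ENNReal} (hC : C ≠ ⊤)
    (hf : ∀ᶠ n in atTop, AEMeasurable (f n) (μ n))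
    (h : ∀ᶠ n in atTop, ∫⁻ ω, ENNReal.ofReal (f n ω ^ 2) ∂(μ n) ≤ C) : IsBigOpOne μ f := by
  intro δ hδ
  by_cases hδt : δ = ⊤
  · exact ⟨1, one_pos, by simp [hδt]⟩
  set c := (C / δ).toReal
  have hc : C / δ ≠ ⊤ := ENNReal.div_ne_top hC hδ.ne'
  -- The square of this threshold is at least `C / δ`, as Chebyshev requires; the added `1` keeps it
  -- positive when `C = 0`.
  refine ⟨√c + 1, by positivity, ?_⟩
  filter_upwards [hf, h] with n hn hn2
  have hK : 0 < ENNReal.ofReal ((√c + 1) ^ 2) := by simp; positivity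
  have hKt : ENNReal.ofReal ((√c + 1) ^ 2) ≠ ⊤ := ENNReal.ofReal_ne_top
  have h1 := mul_meas_ge_le_lintegral₀ (hn.pow_const 2).ennreal_ofReal
    (ENNReal.ofReal ((√c + 1) ^ 2))
  have h2 : μ n {ω | √c + 1 < |f n ω|} ≤ C / ENNReal.ofReal ((√c + 1) ^ 2) := by
    rw [ENNReal.le_div_iff_mul_le (Or.inl hK.ne') (Or.inl hKt), mul_comm]
    refine le_trans (mul_le_mul_right (measure_mono fun ω hω => ?_) _) (h1.trans hn2)
    simp only [Set.mem_ofPred_eq] at hω ⊢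
    apply ENNReal.ofReal_le_ofReal
    rw [← sq_abs (f n ω)]
    gcongr
  refine h2.trans ?_
  rw [ENNReal.div_le_iff_le_mul (Or.inl hK.ne') (Or.inl hKt)]
  calc C = C / δ * δ := (ENNReal.div_mul_cancel hδ.ne' hδt).symm
    _ ≤ ENNReal.ofReal ((√c + 1) ^ 2) * δ := by
      gcongr
      rw [← ENNReal.ofReal_toReal hc]
      apply ENNReal.ofReal_le_ofReal
      have : √c ^ 2 = c := Real.sq_sqrt ENNReal.toReal_nonneg
      nlinarith [Real.sqrt_nonneg c]
    _ = _ := mul_comm _ _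

/-- Measurability is what makes the two measures add up to one; an outer measure alone would not
permit passing to the complement. -/
theorem withProbTendingToOne_iff_compl [∀ n, IsProbabilityMeasure (μ n)] {E : ∀ n, Set (Ω n)}
    (hE : ∀ n, MeasurableSet (E n)) :
    WithProbTendingToOne μ E ↔ Tendsto (fun n => μ n (E n)ᶜ) atTop (𝓝 0) := by
  have h1 : ∀ n, μ n (E n)ᶜ = 1 - μ n (E n) := fun n => prob_compl_eq_one_sub (hE n)
  have h2 : ∀ n, μ n (E n) = 1 - μ n (E n)ᶜ := fun n => by
    rw [← prob_compl_eq_one_sub (hE n).compl, compl_compl]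
  constructor
  · intro h
    simp_rw [h1]
    simpa using ENNReal.Tendsto.sub tendsto_const_nhds h (Or.inl ENNReal.one_ne_top)
  · intro h
    unfold WithProbTendingToOne
    simp_rw [h2]
    simpa using ENNReal.Tendsto.sub tendsto_const_nhds h (Or.inl ENNReal.one_ne_top)

end OrderInProbability

/-! ### Moments of sums over the evaluation sample. -/

section Sample

variable {𝒞 𝒜 𝒵 : Type u} [MeasurableSpace 𝒞] [MeasurableSpace 𝒜] [MeasurableSpace 𝒵]
  {P : Measure (Obs 𝒞 𝒜 𝒵)} [IsProbabilityMeasure P] {n N : ℕ}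

instance : IsProbabilityMeasure (sampleLaw P n N) := by
  unfold sampleLaw; infer_instance

theorem measurePreserving_sample_fst :
    MeasurePreserving (Prod.fst : Data 𝒞 𝒜 𝒵 n N → _) (sampleLaw P n N)
      (Measure.pi fun _ => P) := measurePreserving_fst

theorem measurePreserving_sample_eval (i : Fin n) :
    MeasurePreserving (fun D : Data 𝒞 𝒜 𝒵 n N => D.1 i) (sampleLaw P n N) P :=
  (measurePreserving_eval (fun _ : Fin n => P) i).comp measurePreserving_sample_fst

theorem ae_sample_of_ae {p : Obs 𝒞 𝒜 𝒵 → Prop} (h : ∀ᵐ x ∂P, p x) :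
    ∀ᵐ D ∂(sampleLaw P n N), ∀ i, p (D.1 i) :=
  ae_all_iff.2 fun i => (measurePreserving_sample_eval i).quasiMeasurePreserving.ae h

theorem integral_sample_sum {f : Obs 𝒞 𝒜 𝒵 → ℝ} (hf : Integrable f P) :
    ∫ D, ∑ i, f (D.1 i) ∂(sampleLaw P n N) = n * ∫ x, f x ∂P := by
  have h1 : ∀ i : Fin n, Integrable (fun D : Data 𝒞 𝒜 𝒵 n N => f (D.1 i)) (sampleLaw P n N) :=
    fun i => (measurePreserving_sample_eval i).integrable_comp_of_integrable hf
  rw [integral_finsetSum _ fun i _ => h1 i]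
  have h2 : ∀ i : Fin n, ∫ D, f (D.1 i) ∂(sampleLaw P n N) = ∫ x, f x ∂P := fun i => by
    have hm := (measurePreserving_sample_eval (P := P) (N := N) i)
    have h3 := integral_map (f := f) hm.measurable.aemeasurable
      (by rw [hm.map_eq]; exact hf.aestronglyMeasurable)
    rw [hm.map_eq] at h3
    exact h3.symm
  simp [h2]

theorem memLp_sample {f : Obs 𝒞 𝒜 𝒵 → ℝ} {p : ENNReal} (hf : MemLp f p P) (i : Fin n) :
    MemLp (fun D : Data 𝒞 𝒜 𝒵 n N => f (D.1 i)) p (sampleLaw P n N) :=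
  hf.comp_measurePreserving (measurePreserving_sample_eval i)

theorem variance_sample_sum {f : Obs 𝒞 𝒜 𝒵 → ℝ} (hf : MemLp f 2 P) :
    Var[fun D : Data 𝒞 𝒜 𝒵 n N => ∑ i, f (D.1 i); sampleLaw P n N] = n * Var[f; P] := by
  have h := variance_sum_pi (μ := fun _ : Fin n => P) (X := fun _ => f) fun _ => hf
  have hm := measurePreserving_sample_fst (P := P) (n := n) (N := N)
  rw [← hm.map_eq] at h
  have h3 : AEMeasurable (∑ i : Fin n, fun ω : Fin n → Obs 𝒞 𝒜 𝒵 => f (ω i))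
      (Measure.map Prod.fst (sampleLaw P n N)) := by
    rw [hm.map_eq]
    refine Finset.aemeasurable_sum _ fun i _ => ?_
    exact hf.aestronglyMeasurable.aemeasurable.comp_quasiMeasurePreserving
      (measurePreserving_eval (fun _ : Fin n => P) i).quasiMeasurePreserving
  rw [variance_map h3 hm.measurable.aemeasurable] at h
  simp only [Finset.sum_const, Finset.card_univ, Fintype.card_fin, nsmul_eq_mul] at h
  rw [← h]
  congr 1
  ext D
  simp

end Sample

/-- The empirical process `√n (ℙₙ - P) f`. -/
noncomputable def empProc {𝒞 𝒜 𝒵 : Type u} [MeasurableSpace 𝒞] [MeasurableSpace 𝒜]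
    [MeasurableSpace 𝒵] (P : Measure (Obs 𝒞 𝒜 𝒵)) (f : Obs 𝒞 𝒜 𝒵 → ℝ) {n N : ℕ}
    (D : Data 𝒞 𝒜 𝒵 n N) : ℝ :=
  √(n : ℝ) * ((n : ℝ)⁻¹ * ∑ i, f (D.1 i) - ∫ x, f x ∂P)

/-! ### The empirical process and the law of large numbers. -/

section Empirical

variable {𝒞 𝒜 𝒵 : Type u} [MeasurableSpace 𝒞] [MeasurableSpace 𝒜] [MeasurableSpace 𝒵]
  {P : Measure (Obs 𝒞 𝒜 𝒵)} [IsProbabilityMeasure P] {f : Obs 𝒞 𝒜 𝒵 → ℝ}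

theorem aemeasurable_empProc (hf : AEMeasurable f P) {n N : ℕ} :
    AEMeasurable (fun D : Data 𝒞 𝒜 𝒵 n N => empProc P f D) (sampleLaw P n N) := by
  unfold empProc
  refine AEMeasurable.const_mul (AEMeasurable.sub (AEMeasurable.const_mul
    (Finset.aemeasurable_fun_sum _ fun i _ => ?_) _) aemeasurable_const) _
  exact hf.comp_quasiMeasurePreserving (measurePreserving_sample_eval i).quasiMeasurePreserving

/-- The `√n` scaling makes the second moment independent of `n`, which yields `O_p(1)` by Chebyshev.
-/
theorem lintegral_empProc_sq (hf : MemLp f 2 P) {n N : ℕ} (hn : n ≠ 0) :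
    ∫⁻ D : Data 𝒞 𝒜 𝒵 n N, ENNReal.ofReal (empProc P f D ^ 2) ∂(sampleLaw P n N)
      = ENNReal.ofReal (Var[f; P]) := by
  have hn' : (0 : ℝ) < n := by positivity
  have hs : MemLp (fun D : Data 𝒞 𝒜 𝒵 n N => ∑ i, f (D.1 i)) 2 (sampleLaw P n N) :=
    memLp_finsetSum _ fun i _ => memLp_sample hf i
  have hi := integral_sample_sum (n := n) (N := N) (hf.integrable one_le_two)
  have hv := variance_sample_sum (n := n) (N := N) hf
  rw [variance_eq_integral hs.aestronglyMeasurable.aemeasurable, hi] at hv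
  have h1 : ∀ D : Data 𝒞 𝒜 𝒵 n N, empProc P f D ^ 2
      = (n : ℝ)⁻¹ * (∑ i, f (D.1 i) - n * ∫ x, f x ∂P) ^ 2 := fun D => by
    unfold empProc
    rw [mul_pow, Real.sq_sqrt hn'.le]
    field_simp
  simp_rw [h1]
  rw [← ofReal_integral_eq_lintegral_ofReal, integral_const_mul, hv]
  · congr 1; field_simp
  · exact ((hs.sub (memLp_const _)).integrable_sq).const_mul _
  · exact ae_of_all _ fun D => by positivity

theorem isBigOpOne_empProc (hf : MemLp f 2 P) (N : ℕ → ℕ) :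
    IsBigOpOne (fun n => sampleLaw P n (N n)) fun _ D => empProc P f D :=
  isBigOpOne_of_lintegral_sq_le (C := ENNReal.ofReal (Var[f; P])) ENNReal.ofReal_ne_top
    (Eventually.of_forall fun _ => aemeasurable_empProc hf.aestronglyMeasurable.aemeasurable)
    ((eventually_ne_atTop 0).mono fun _ hn => (lintegral_empProc_sq hf hn).le)

theorem empProc_congr {g : Obs 𝒞 𝒜 𝒵 → ℝ} (h : f =ᵐ[P] g) {n N : ℕ} :
    ∀ᵐ D ∂(sampleLaw P n N), empProc P f D = empProc P g D := by
  filter_upwards [ae_sample_of_ae h] with D hD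
  simp only [empProc, integral_congr_ae h, hD]

omit [IsProbabilityMeasure P] in
theorem empProc_zero {n N : ℕ} (D : Data 𝒞 𝒜 𝒵 n N) : empProc P (fun _ => 0) D = 0 := by
  simp [empProc]

/-- A random multiple `sₙ g` of a fixed function, with `‖sₙ g‖ = o_p(1)`, has asymptotically
negligible empirical process. -/
theorem IsLittleOpOne.mul_empProc {N : ℕ → ℕ} {s : ∀ n, Data 𝒞 𝒜 𝒵 n (N n) → ℝ}
    (hf : MemLp f 2 P)
    (hs : IsLittleOpOne (fun n => sampleLaw P n (N n)) fun n D => |s n D| * l2norm P f) :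
    IsLittleOpOne (fun n => sampleLaw P n (N n)) fun n D => s n D * empProc P f D := by
  -- If `‖f‖ = 0` the hypothesis says nothing about `sₙ`, but then `f` vanishes almost surely and so
  -- does its empirical process. This occurs when the outcome is degenerate on an atom.
  by_cases h0 : l2norm P f = 0
  · have hf0 : f =ᵐ[P] fun _ => 0 := by
      rw [l2norm, Real.sqrt_eq_zero (integral_nonneg fun _ => sq_nonneg _),
        integral_eq_zero_iff_of_nonneg (fun _ => sq_nonneg _) hf.integrable_sq] at h0
      filter_upwards [h0] with x hx
      simpa using hx
    refine isLittleOpOne_zero.of_ae_eq (Eventually.of_forall fun n => ?_)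
    filter_upwards [empProc_congr hf0] with D hD
    rw [hD, empProc_zero, mul_zero]
  · refine IsLittleOpOne.mul_isBigOpOne ?_ (isBigOpOne_empProc hf N)
    refine (hs.const_mul (l2norm P f)⁻¹).of_abs_le (Eventually.of_forall fun n D => ?_)
    rw [mul_comm, mul_assoc, mul_inv_cancel₀ h0, mul_one, abs_abs]

/-- The weak law of large numbers. -/
theorem isLittleOpOne_average_sub_integral (hf : Integrable f P) (N : ℕ → ℕ) :
    IsLittleOpOne (fun n => sampleLaw P n (N n))
      fun n D => (n : ℝ)⁻¹ * ∑ i, f (D.1 i) - ∫ x, f x ∂P := by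
  wlog hm : Measurable f generalizing f
  · have hae := hf.aestronglyMeasurable.aemeasurable.ae_eq_mk
    refine (this (hf.congr hae) hf.aestronglyMeasurable.aemeasurable.measurable_mk).of_ae_eq
      (Eventually.of_forall fun n => ?_)
    filter_upwards [ae_sample_of_ae hae] with D hD
    rw [integral_congr_ae hae]
    simp only [hD]
  -- All stages are realised on one infinite product space, where the strong law applies. Almost
  -- sure convergence gives convergence in measure, and the first `n` coordinates have the law of
  -- the evaluation sample.
  let Q := Measure.infinitePi fun _ : ℕ => P
  have hpres : ∀ i, MeasurePreserving (fun ω : ℕ → Obs 𝒞 𝒜 𝒵 => ω i) Q P := fun i =>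
    measurePreserving_eval_infinitePi (fun _ : ℕ => P) i
  have hind : iIndepFun (fun i (ω : ℕ → Obs 𝒞 𝒜 𝒵) => f (ω i)) Q :=
    iIndepFun_infinitePi (X := fun _ => f) fun _ => hm
  have hind' : iIndepFun (fun i (ω : ℕ → Obs 𝒞 𝒜 𝒵) => ω i) Q :=
    iIndepFun_infinitePi (X := fun _ => id) fun _ => measurable_id
  have hint0 : ∫ ω, f (ω 0) ∂Q = ∫ x, f x ∂P := by
    rw [← (hpres 0).map_eq, integral_map (hpres 0).measurable.aemeasurable hm.aestronglyMeasurable]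
  have hid : ∀ i, IdentDistrib (fun ω : ℕ → Obs 𝒞 𝒜 𝒵 => f (ω i)) (fun ω => f (ω 0)) Q Q :=
    fun i => (IdentDistrib.mk (hpres i).measurable.aemeasurable
      (hpres 0).measurable.aemeasurable (by rw [(hpres i).map_eq, (hpres 0).map_eq])).comp hm
  have hlaw := strong_law_ae_real (fun i (ω : ℕ → Obs 𝒞 𝒜 𝒵) => f (ω i))
    ((hpres 0).integrable_comp_of_integrable hf) (fun i j hij => hind.indepFun hij) hid
  have hmeas : ∀ n : ℕ, Measurable fun ω : ℕ → Obs 𝒞 𝒜 𝒵 =>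
      (∑ i ∈ Finset.range n, f (ω i)) / (n : ℝ) := fun n => by fun_prop
  have htm := tendstoInMeasure_of_tendsto_ae (fun n => (hmeas n).aestronglyMeasurable) hlaw
  intro ε hε
  have h1 := htm (ENNReal.ofReal ε) (by simpa using hε)
  refine h1.congr fun n => ?_
  let F : (Fin n → Obs 𝒞 𝒜 𝒵) → ℝ := fun x => (n : ℝ)⁻¹ * ∑ i, f (x i) - ∫ x, f x ∂P
  have hF : Measurable F := by fun_prop
  have hS : MeasurableSet {x | ε ≤ |F x|} := measurableSet_le measurable_const hF.abs
  have hmap : Measure.map (fun (ω : ℕ → Obs 𝒞 𝒜 𝒵) (i : Fin n) => ω i) Q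
      = Measure.pi fun _ => P := by
    have hind2 : iIndepFun (fun (i : Fin n) (ω : ℕ → Obs 𝒞 𝒜 𝒵) => ω i) Q :=
      hind'.precomp Fin.val_injective
    rw [(iIndepFun_iff_map_fun_eq_pi_map
      fun i : Fin n => (hpres i).measurable.aemeasurable).1 hind2]
    simp only [(hpres _).map_eq]
  have e1 : sampleLaw P n (N n) {D | ε ≤ |(n : ℝ)⁻¹ * ∑ i, f (D.1 i) - ∫ x, f x ∂P|}
      = Measure.pi (fun _ => P) {x | ε ≤ |F x|} :=
    measurePreserving_sample_fst.measure_preimage hS.nullMeasurableSet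
  rw [e1, ← hmap, Measure.map_apply (by fun_prop) hS]
  congr 1
  ext ω
  simp only [Set.mem_ofPred_eq, Set.preimage_ofPred_eq, F]
  rw [edist_dist, ENNReal.ofReal_le_ofReal_iff dist_nonneg, Real.dist_eq, hint0,
    Finset.sum_range, div_eq_inv_mul]

end Empirical

end TripleDoor

namespace TripleDoor

/-! ### Integrals as sums over the values of a discrete variable. -/

section Fibers

variable {Ω I : Type*} [MeasurableSpace Ω] [MeasurableSpace I] [Countable I]
  [MeasurableSingletonClass I] {μ : Measure Ω} {X : Ω → I} {E : Set Ω}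

theorem hasSum_setIntegral_inter_fiber (hX : Measurable X) (hE : MeasurableSet E) {f : Ω → ℝ}
    (hf : IntegrableOn f E μ) :
    HasSum (fun i => ∫ ω in E ∩ X ⁻¹' {i}, f ω ∂μ) (∫ ω in E, f ω ∂μ) := by
  have hU : ⋃ i, E ∩ X ⁻¹' {i} = E := by
    ext ω; simp
  have h := hasSum_integral_iUnion (μ := μ) (f := f) (s := fun i => E ∩ X ⁻¹' {i})
    (fun i => hE.inter (hX (measurableSet_singleton i))) ?_ (by rwa [hU])
  · rwa [hU] at h
  · intro i j hij
    refine Set.disjoint_left.2 fun ω h1 h2 => hij ?_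
    exact h1.2.symm.trans h2.2

theorem hasSum_integral_fiber (hX : Measurable X) {f : Ω → ℝ} (hf : Integrable f μ) :
    HasSum (fun i => ∫ ω in X ⁻¹' {i}, f ω ∂μ) (∫ ω, f ω ∂μ) := by
  simpa using hasSum_setIntegral_inter_fiber hX MeasurableSet.univ hf.integrableOn

theorem hasSum_measureReal_inter_fiber [IsFiniteMeasure μ] (hX : Measurable X)
    (hE : MeasurableSet E) :
    HasSum (fun i => μ.real (E ∩ X ⁻¹' {i})) (μ.real E) := by
  simpa using hasSum_setIntegral_inter_fiber (μ := μ) (f := fun _ => (1 : ℝ)) hX hE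
    (integrable_const _).integrableOn

theorem hasSum_measureReal_fiber [IsFiniteMeasure μ] (hX : Measurable X) :
    HasSum (fun i => μ.real (X ⁻¹' {i})) (μ.real Set.univ) := by
  simpa using hasSum_measureReal_inter_fiber (μ := μ) hX MeasurableSet.univ

omit [MeasurableSpace I] [MeasurableSingletonClass I] in
/-- Absolute summability of the integrals over the fibers of a discrete variable. -/
theorem integrable_of_summable_fiber {f : Ω → ℝ}
    (hf : ∀ i, IntegrableOn f (X ⁻¹' {i}) μ)
    (hs : Summable fun i => ∫ ω in X ⁻¹' {i}, |f ω| ∂μ) : Integrable f μ := by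
  have hU : ⋃ i, X ⁻¹' {i} = Set.univ := by
    ext ω; simp
  rw [← integrableOn_univ, ← hU]
  exact integrableOn_iUnion_of_summable_integral_norm
    hf (by simpa using hs)

/-- A function of a discrete variable is integrable iff its weighted sum is absolutely
convergent. -/
theorem integrable_comp_of_summable [IsFiniteMeasure μ] (hX : Measurable X) {h : I → ℝ}
    (hs : Summable fun i => h i * μ.real (X ⁻¹' {i})) : Integrable (fun ω => h (X ω)) μ := by
  have key : ∀ i, Set.EqOn (fun ω => h (X ω)) (fun _ => h i) (X ⁻¹' {i}) := fun i ω hω => by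
    have : X ω = i := hω
    simp [this]
  have hm : ∀ i, MeasurableSet (X ⁻¹' {i}) := fun i => hX (measurableSet_singleton i)
  refine integrable_of_summable_fiber (X := X) (fun i => ?_) ?_
  · exact (integrableOn_congr_fun (key i) (hm i)).2 (integrable_const _).integrableOn
  · refine hs.abs.congr fun i => ?_
    rw [setIntegral_congr_fun (g := fun _ => |h i|) (hm i) fun ω hω => by
      simpa using congrArg abs (key i hω)]
    simp [abs_mul, mul_comm]

theorem hasSum_integral_comp [IsFiniteMeasure μ] (hX : Measurable X) {h : I → ℝ}
    (hi : Integrable (fun ω => h (X ω)) μ) :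
    HasSum (fun i => h i * μ.real (X ⁻¹' {i})) (∫ ω, h (X ω) ∂μ) := by
  refine (hasSum_integral_fiber hX hi).congr_fun fun i => ?_
  rw [setIntegral_congr_fun (g := fun _ => h i) (hX (measurableSet_singleton i)) fun ω hω => by
    have : X ω = i := hω
    simp [this]]
  simp [mul_comm]

end Fibers

/-! ### Conditional independence given an event, with denominators cleared. -/

section Independence

variable {Ω : Type*} [MeasurableSpace Ω] {μ : Measure Ω} [IsProbabilityMeasure μ] {E : Set Ω}

/-- Product formula for `X` and the indicator of `Y ∈ t` under the conditional law, with the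
normalisation multiplied out. No integrability of `X` is required, which matters because `Y(b, z)`
is not assumed integrable. -/
theorem setIntegral_mul_of_indepFun_cond {β : Type*} [MeasurableSpace β] {X : Ω → ℝ} {Y : Ω → β}
    (hX : Measurable X) (hY : Measurable Y) (hE0 : μ E ≠ 0)
    (h : IndepFun X Y (ProbabilityTheory.cond μ E)) {t : Set β} (ht : MeasurableSet t) :
    (∫ ω in E ∩ Y ⁻¹' t, X ω ∂μ) * μ.real E = (∫ ω in E, X ω ∂μ) * μ.real (E ∩ Y ⁻¹' t) := by
  have h1 : IndepFun X (fun ω => t.indicator (fun _ => (1 : ℝ)) (Y ω))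
      (ProbabilityTheory.cond μ E) :=
    h.comp (φ := id) (ψ := t.indicator fun _ => (1 : ℝ)) measurable_id
      (measurable_const.indicator ht)
  have h2 := h1.integral_fun_mul_eq_mul_integral hX.aestronglyMeasurable
    ((measurable_const.indicator ht).comp hY).aestronglyMeasurable
  have hEt : MeasurableSet (Y ⁻¹' t) := hY ht
  have e1 : (fun ω => X ω * t.indicator (fun _ => (1 : ℝ)) (Y ω)) = (Y ⁻¹' t).indicator X := by
    ext ω
    by_cases hω : Y ω ∈ t
    · simp [Set.indicator, hω]
    · simp [Set.indicator, hω]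
  have e2 : (fun ω => t.indicator (fun _ => (1 : ℝ)) (Y ω))
      = (Y ⁻¹' t).indicator fun _ => (1 : ℝ) := by
    rfl
  rw [e1, e2, ProbabilityTheory.cond, integral_smul_measure, integral_smul_measure,
    integral_smul_measure,
    integral_indicator hEt, integral_indicator hEt, Measure.restrict_restrict hEt,
    Set.inter_comm] at h2
  have hr : μ.real E ≠ 0 := by
    rw [measureReal_def]; exact ENNReal.toReal_ne_zero.2 ⟨hE0, measure_ne_top _ _⟩
  have hr2 : ((μ E)⁻¹).toReal = (μ.real E)⁻¹ := ENNReal.toReal_inv _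
  rw [hr2] at h2
  simp only [smul_eq_mul, integral_const, measureReal_restrict_apply_univ, mul_one] at h2
  field_simp at h2
  linarith

theorem measureReal_mul_of_indepFun_cond {α β : Type*} [MeasurableSpace α] [MeasurableSpace β]
    {X : Ω → α} {Y : Ω → β} (hX : Measurable X) (hY : Measurable Y) (hE0 : μ E ≠ 0) (h : IndepFun X Y (ProbabilityTheory.cond μ E)) {s : Set α} {t : Set β}
    (hs : MeasurableSet s) (ht : MeasurableSet t) :
    μ.real (E ∩ X ⁻¹' s ∩ Y ⁻¹' t) * μ.real E
      = μ.real (E ∩ X ⁻¹' s) * μ.real (E ∩ Y ⁻¹' t) := by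
  have h1 : IndepFun (fun ω => s.indicator (fun _ => (1 : ℝ)) (X ω)) Y
      (ProbabilityTheory.cond μ E) :=
    h.comp (φ := s.indicator fun _ => (1 : ℝ)) (ψ := id) (measurable_const.indicator hs)
      measurable_id
  have h2 := setIntegral_mul_of_indepFun_cond ((measurable_const.indicator hs).comp hX) hY hE0
    h1 ht
  have e2 : (fun ω => s.indicator (fun _ => (1 : ℝ)) (X ω))
      = (X ⁻¹' s).indicator fun _ => (1 : ℝ) := by
    rfl
  simp only [Function.comp_def] at h2
  rw [e2, integral_indicator (hX hs), integral_indicator (hX hs),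
    Measure.restrict_restrict (hX hs), Measure.restrict_restrict (hX hs)] at h2
  simp only [integral_const, measureReal_restrict_apply_univ, smul_eq_mul, mul_one] at h2
  rw [show E ∩ X ⁻¹' s ∩ Y ⁻¹' t = X ⁻¹' s ∩ (E ∩ Y ⁻¹' t) by ext ω; simp; tauto,
    Set.inter_comm E (X ⁻¹' s)]
  exact h2

end Independence

end TripleDoor

/-! ### From the causal model to the observed-data law. -/

namespace TripleDoor

variable {𝒞 𝒜 𝒵 : Type u} [MeasurableSpace 𝒞] [MeasurableSpace 𝒜] [MeasurableSpace 𝒵]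

/-- The properties of an observed-data law implied by the causal model: positivity,
`Z ⫫ C | A`, and identification of the mean potential outcomes `θ b = E Y(b)`. -/
structure ObsModel (P : Measure (Obs 𝒞 𝒜 𝒵)) (θ : 𝒜 → ℝ) : Prop where
  prob : IsProbabilityMeasure P
  integrable : Integrable (fun x : Obs 𝒞 𝒜 𝒵 => x.2.2.2) P
  pos : ∀ c b z, 0 < P.real {x | x.1 = c ∧ x.2.1 = b ∧ x.2.2.1 = z}
  factor : ∀ c b z, P.real {x | x.1 = c ∧ x.2.1 = b ∧ x.2.2.1 = z}
    = (trueNuisance P).pC c * (trueNuisance P).pA c b * (trueNuisance P).pZ b z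
  hasSum : ∀ b, HasSum (fun zc : 𝒵 × 𝒞 => (trueNuisance P).e zc.1 zc.2
    * (trueNuisance P).pZ b zc.1 * (trueNuisance P).pC zc.2) (θ b)

namespace CausalSystem

variable {S : CausalSystem 𝒞 𝒜 𝒵}

theorem measurable_obs (S : CausalSystem 𝒞 𝒜 𝒵) :
    Measurable fun ω => ((S.cov ω, S.treat ω, S.med ω, S.out ω) : Obs 𝒞 𝒜 𝒵) :=
  S.measurable_cov.prodMk (S.measurable_treat.prodMk (S.measurable_med.prodMk S.measurable_out))

instance : IsProbabilityMeasure S.law :=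
  Measure.isProbabilityMeasure_map S.measurable_obs.aemeasurable

variable [MeasurableSingletonClass 𝒞] [MeasurableSingletonClass 𝒜] [MeasurableSingletonClass 𝒵]

/-- The event `C = c`. -/
abbrev evC (S : CausalSystem 𝒞 𝒜 𝒵) (c : 𝒞) : Set S.Ω := S.cov ⁻¹' {c}
/-- The event `A = b`. -/
abbrev evA (S : CausalSystem 𝒞 𝒜 𝒵) (b : 𝒜) : Set S.Ω := S.treat ⁻¹' {b}
/-- The event `Z = z`. -/
abbrev evZ (S : CausalSystem 𝒞 𝒜 𝒵) (z : 𝒵) : Set S.Ω := S.med ⁻¹' {z}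

theorem measurableSet_evC (c : 𝒞) : MeasurableSet (S.evC c) :=
  S.measurable_cov (measurableSet_singleton c)
theorem measurableSet_evA (b : 𝒜) : MeasurableSet (S.evA b) :=
  S.measurable_treat (measurableSet_singleton b)
theorem measurableSet_evZ (z : 𝒵) : MeasurableSet (S.evZ z) :=
  S.measurable_med (measurableSet_singleton z)

theorem InModel.pos (hS : S.InModel) (c : 𝒞) (b : 𝒜) (z : 𝒵) {E : Set S.Ω}
    (h : S.evC c ∩ S.evA b ∩ S.evZ z ⊆ E) : S.μ E ≠ 0 := by
  have h1 := hS.standing.positivity c b z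
  refine (h1.trans_le (measure_mono fun ω hω => h ?_)).ne'
  exact ⟨⟨hω.1, hω.2.1⟩, hω.2.2⟩

theorem InModel.pos_real (hS : S.InModel) (c : 𝒞) (b : 𝒜) (z : 𝒵) {E : Set S.Ω}
    (h : S.evC c ∩ S.evA b ∩ S.evZ z ⊆ E) : 0 < S.μ.real E :=
  ENNReal.toReal_pos (hS.pos c b z h) (measure_ne_top _ _)

theorem nonempty (S : CausalSystem 𝒞 𝒜 𝒵) : Nonempty 𝒞 ∧ Nonempty 𝒵 := by
  have : Nonempty S.Ω := S.μ.nonempty_of_neZero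
  obtain ⟨ω⟩ := this
  exact ⟨⟨S.cov ω⟩, ⟨S.med ω⟩⟩

/-- On `A = b`, the events `Z = z` and `Z(b) = z` agree. -/
theorem InModel.ae_med (hS : S.InModel) (b : 𝒜) (z : 𝒵) (E : Set S.Ω) :
    (E ∩ S.evA b ∩ S.medOf b ⁻¹' {z} : Set S.Ω) =ᵐ[S.μ] (E ∩ S.evA b ∩ S.evZ z : Set S.Ω) := by
  filter_upwards [hS.standing.consistency_med b] with ω hω
  apply propext
  change (ω ∈ E ∩ S.evA b ∧ S.medOf b ω = z) ↔ (ω ∈ E ∩ S.evA b ∧ S.med ω = z)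
  refine and_congr_right fun h => ?_
  rw [hω h.2]

/-- `Z ⫫ C | A`. -/
theorem InModel.med_indep_cov (hS : S.InModel) (c : 𝒞) (b : 𝒜) (z : 𝒵) :
    S.μ.real (S.evC c ∩ S.evA b ∩ S.evZ z) * S.μ.real (S.evA b)
      = S.μ.real (S.evA b ∩ S.evZ z) * S.μ.real (S.evC c ∩ S.evA b) := by
  have h := measureReal_mul_of_indepFun_cond (S.measurable_medOf b) S.measurable_cov
    (hS.pos c b z fun ω h => h.1.2) (hS.medOf_indep_cov b b)
    (measurableSet_singleton z) (measurableSet_singleton c)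
  have h1 := measureReal_congr (hS.ae_med b z Set.univ)
  have h2 := measureReal_congr (hS.ae_med b z (S.evC c))
  simp only [Set.univ_inter] at h1
  rw [h1, show S.evA b ∩ S.medOf b ⁻¹' {z} ∩ S.cov ⁻¹' {c}
    = S.evC c ∩ S.evA b ∩ S.medOf b ⁻¹' {z} by ext ω; simp; tauto, h2,
    Set.inter_comm (S.evA b) (S.cov ⁻¹' {c})] at h
  exact h

/-- The outcome mean on an atom of `(C, A, Z)`, relative to the probability of the atom, does not
depend on `A`. -/
theorem InModel.integral_out_atom (hS : S.InModel) (a : 𝒜) (c : 𝒞) (b : 𝒜) (z : 𝒵) :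
    (∫ ω in S.evC c ∩ S.evA b ∩ S.evZ z, S.out ω ∂S.μ) * S.μ.real (S.evC c)
      = (∫ ω in S.evC c, S.outOf₂ a z ω ∂S.μ) * S.μ.real (S.evC c ∩ S.evA b ∩ S.evZ z) := by
  -- The restriction to the atom is removed in two stages: `A = b` is dropped given `C` (back door),
  -- and `Z(b) = z` is dropped given `(A, C)` (two door).
  have h1 := setIntegral_mul_of_indepFun_cond (S.measurable_outOf₂ b z) S.measurable_treat
    (hS.pos c b z fun ω h => h.1.1) (hS.backDoor.joint b z c)
    (measurableSet_singleton b)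
  have hEm : MeasurableSet (S.evC c ∩ S.evA b) := (measurableSet_evC c).inter (measurableSet_evA b)
  have h2 := setIntegral_mul_of_indepFun_cond (S.measurable_outOf₂ b z) (S.measurable_medOf b)
    (hS.pos c b z fun ω h => h.1)
    (by have := hS.twoDoor.td3 b b z b c; rwa [Set.inter_comm] at this)
    (measurableSet_singleton z)
  rw [setIntegral_congr_set (hS.ae_med b z (S.evC c)),
    measureReal_congr (hS.ae_med b z (S.evC c))] at h2
  have h3 : ∫ ω in S.evC c ∩ S.evA b ∩ S.evZ z, S.outOf₂ b z ω ∂S.μ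
      = ∫ ω in S.evC c ∩ S.evA b ∩ S.evZ z, S.out ω ∂S.μ := by
    refine setIntegral_congr_ae (hEm.inter (measurableSet_evZ z)) ?_
    filter_upwards [hS.standing.consistency_out₂ b z] with ω hω h
    exact (hω h.1.2 h.2).symm
  have h4 : ∫ ω in S.evC c, S.outOf₂ b z ω ∂S.μ = ∫ ω in S.evC c, S.outOf₂ a z ω ∂S.μ := by
    refine setIntegral_congr_ae (measurableSet_evC c) ?_
    filter_upwards [hS.twoDoor.td1 b a z] with ω hω _
    exact hω
  rw [h3] at h2
  rw [h4] at h1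
  have hp := hS.pos_real c b z (E := S.evC c ∩ S.evA b) fun ω h => h.1
  apply mul_right_cancel₀ hp.ne'
  calc _ = ((∫ ω in S.evC c ∩ S.evA b ∩ S.evZ z, S.out ω ∂S.μ) * S.μ.real (S.evC c ∩ S.evA b))
        * S.μ.real (S.evC c) := by ring
    _ = ((∫ ω in S.evC c ∩ S.evA b, S.outOf₂ b z ω ∂S.μ) * S.μ.real (S.evC c))
        * S.μ.real (S.evC c ∩ S.evA b ∩ S.evZ z) := by rw [h2]; ring
    _ = _ := by rw [h1]; ring

/-- The mean of `Y` given `(C, A, Z)` is the mean of `Y` given `(C, Z)`. -/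
theorem InModel.integral_out_atom_eq [Countable 𝒜] (hS : S.InModel) (c : 𝒞) (b : 𝒜) (z : 𝒵) :
    (∫ ω in S.evC c ∩ S.evA b ∩ S.evZ z, S.out ω ∂S.μ) * S.μ.real (S.evZ z ∩ S.evC c)
      = (∫ ω in S.evZ z ∩ S.evC c, S.out ω ∂S.μ) * S.μ.real (S.evC c ∩ S.evA b ∩ S.evZ z) := by
  have hm : MeasurableSet (S.evZ z ∩ S.evC c) := (measurableSet_evZ z).inter (measurableSet_evC c)
  have hs : ∀ b', S.evZ z ∩ S.evC c ∩ S.treat ⁻¹' {b'} = S.evC c ∩ S.evA b' ∩ S.evZ z := fun b' => by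
    ext ω; simp; tauto
  -- The ratio of outcome integral to mass is the same for every treatment value, so summing
  -- numerators and masses over `A` leaves it unchanged.
  have h1 := (hasSum_setIntegral_inter_fiber (μ := S.μ) S.measurable_treat hm
    hS.standing.integrable_out.integrableOn).mul_right (S.μ.real (S.evC c))
  have h2 := (hasSum_measureReal_inter_fiber (μ := S.μ) S.measurable_treat hm).mul_left
    (∫ ω in S.evC c, S.outOf₂ b z ω ∂S.μ)
  simp only [hs] at h1 h2
  simp only [hS.integral_out_atom b] at h1
  have h3 := h1.unique h2
  have hp := hS.pos_real c b z (E := S.evC c) fun ω h => h.1.1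
  apply mul_right_cancel₀ hp.ne'
  calc _ = ((∫ ω in S.evC c ∩ S.evA b ∩ S.evZ z, S.out ω ∂S.μ) * S.μ.real (S.evC c))
        * S.μ.real (S.evZ z ∩ S.evC c) := by ring
    _ = _ := by rw [hS.integral_out_atom b c b z, mul_right_comm, ← h3]; ring

/-- The back-door identity for the absolute value and for the value of `Y(b)`. -/
theorem InModel.integral_outOf (hS : S.InModel) (c : 𝒞) (b : 𝒜) (hne : Nonempty 𝒵) {f : ℝ → ℝ}
    (hf : Measurable f) :
    (∫ ω in S.evC c ∩ S.evA b, f (S.out ω) ∂S.μ) * S.μ.real (S.evC c)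
      = (∫ ω in S.evC c, f (S.outOf b ω) ∂S.μ) * S.μ.real (S.evC c ∩ S.evA b) := by
  obtain ⟨z⟩ := hne
  have hi : IndepFun (fun ω => f (S.outOf b ω)) S.treat (ProbabilityTheory.cond S.μ (S.evC c)) :=
    (hS.backDoor.pair b b c).comp (φ := fun p : ℝ × ℝ => f p.1) (ψ := id) (hf.comp measurable_fst)
      measurable_id
  have h1 := setIntegral_mul_of_indepFun_cond (hf.comp (S.measurable_outOf b)) S.measurable_treat
    (hS.pos c b z fun ω h => h.1.1) hi (measurableSet_singleton b)
  have h3 : ∫ ω in S.evC c ∩ S.evA b, f (S.outOf b ω) ∂S.μ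
      = ∫ ω in S.evC c ∩ S.evA b, f (S.out ω) ∂S.μ := by
    refine setIntegral_congr_ae ((measurableSet_evC c).inter (measurableSet_evA b)) ?_
    filter_upwards [hS.standing.consistency_out b] with ω hω h
    rw [hω h.2]
  rw [← h3]
  exact h1

/-- Back-door adjustment, with the slice `C = c, A = b` further cut by `Z`. Absolute convergence of
the double sum is the delicate point: the back-door identity applied to `|Y|` bounds the sum of
absolute values by `E|Y(b)|`. -/
theorem InModel.hasSum_outOf [Countable 𝒞] [Countable 𝒵] (hS : S.InModel) (b : 𝒜) :
    HasSum (fun zc : 𝒵 × 𝒞 => (∫ ω in S.evC zc.2 ∩ S.evA b ∩ S.evZ zc.1, S.out ω ∂S.μ)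
      * (S.μ.real (S.evC zc.2) / S.μ.real (S.evC zc.2 ∩ S.evA b))) (∫ ω, S.outOf b ω ∂S.μ) := by
  obtain ⟨-, ⟨z₀⟩⟩ := S.nonempty
  -- The inverse propensity weight `1 / P(A = b | C = c)`.
  set w : 𝒞 → ℝ := fun c => S.μ.real (S.evC c) / S.μ.real (S.evC c ∩ S.evA b)
  have hw0 : ∀ c, 0 ≤ w c := fun c => by positivity
  have hw : ∀ c {f : ℝ → ℝ}, Measurable f → (∫ ω in S.evC c ∩ S.evA b, f (S.out ω) ∂S.μ) * w c
      = ∫ ω in S.evC c, f (S.outOf b ω) ∂S.μ := fun c f hf => by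
    have h := hS.integral_outOf c b ⟨z₀⟩ hf
    have hp := hS.pos_real c b z₀ (E := S.evC c ∩ S.evA b) fun ω h => h.1
    simp only [w]
    field_simp
    linarith
  have hm : ∀ c, MeasurableSet (S.evC c ∩ S.evA b) := fun c =>
    (measurableSet_evC c).inter (measurableSet_evA b)
  have hz : ∀ c {f : S.Ω → ℝ}, Integrable f S.μ →
      HasSum (fun z => (∫ ω in S.evC c ∩ S.evA b ∩ S.evZ z, f ω ∂S.μ) * w c)
        ((∫ ω in S.evC c ∩ S.evA b, f ω ∂S.μ) * w c) := fun c f hf =>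
    (hasSum_setIntegral_inter_fiber S.measurable_med (hm c) hf.integrableOn).mul_right _
  have hY := hS.standing.integrable_out
  have hYb := hS.standing.integrable_outOf b
  have hsum : Summable fun cz : 𝒞 × 𝒵 =>
      (∫ ω in S.evC cz.1 ∩ S.evA b ∩ S.evZ cz.2, S.out ω ∂S.μ) * w cz.1 := by
    refine Summable.of_norm_bounded (g := fun cz : 𝒞 × 𝒵 =>
      (∫ ω in S.evC cz.1 ∩ S.evA b ∩ S.evZ cz.2, |S.out ω| ∂S.μ) * w cz.1) ?_ ?_
    · rw [summable_prod_of_nonneg]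
      · refine ⟨fun c => (hz c hY.abs).summable, ?_⟩
        refine (hasSum_integral_fiber S.measurable_cov hYb.abs).summable.congr fun c => ?_
        rw [(hz c hY.abs).tsum_eq]
        exact (hw c measurable_abs).symm
      · intro cz
        exact mul_nonneg (integral_nonneg fun _ => abs_nonneg _) (hw0 _)
    · intro cz
      rw [norm_mul, Real.norm_of_nonneg (hw0 _)]
      exact mul_le_mul_of_nonneg_right (norm_integral_le_integral_norm _) (hw0 _)
  obtain ⟨T, hT⟩ := hsum
  have h1 := hT.prod_fiberwise fun c => hz c hY
  have h2 := hasSum_integral_fiber S.measurable_cov hYb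
  have h3 : ∀ c, (∫ ω in S.evC c ∩ S.evA b, S.out ω ∂S.μ) * w c
      = ∫ ω in S.evC c, S.outOf b ω ∂S.μ := fun c => hw c measurable_id
  simp only [h3] at h1
  rw [h1.unique h2] at hT
  exact (Equiv.prodComm 𝒵 𝒞).hasSum_iff.2 hT

theorem law_real (S : CausalSystem 𝒞 𝒜 𝒵) {s : Set (Obs 𝒞 𝒜 𝒵)} (hs : MeasurableSet s) :
    S.law.real s = S.μ.real ((fun ω => (S.cov ω, S.treat ω, S.med ω, S.out ω)) ⁻¹' s) :=
  map_measureReal_apply S.measurable_obs hs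

end CausalSystem

section ObsSets

variable [MeasurableSingletonClass 𝒞] [MeasurableSingletonClass 𝒜] [MeasurableSingletonClass 𝒵]

theorem measurableSet_obsC (c : 𝒞) : MeasurableSet {x : Obs 𝒞 𝒜 𝒵 | x.1 = c} :=
  measurable_fst (measurableSet_singleton c)
theorem measurableSet_obsA (b : 𝒜) : MeasurableSet {x : Obs 𝒞 𝒜 𝒵 | x.2.1 = b} :=
  (measurable_fst.comp measurable_snd) (measurableSet_singleton b)
theorem measurableSet_obsZ (z : 𝒵) : MeasurableSet {x : Obs 𝒞 𝒜 𝒵 | x.2.2.1 = z} :=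
  (measurable_fst.comp (measurable_snd.comp measurable_snd)) (measurableSet_singleton z)

end ObsSets

/-- The sole passage from potential outcomes to the observed law. In the back-door sum, `E(Y|c,b,z)
= E(Y|z,c)` and `p(z|c,b) = p(z|b)` turn the summand into `E(Y|z,c) p(z|b) p(c)`. -/
theorem CausalSystem.InModel.obsModel [Countable 𝒞] [Countable 𝒜] [Countable 𝒵]
    [MeasurableSingletonClass 𝒞] [MeasurableSingletonClass 𝒜] [MeasurableSingletonClass 𝒵]
    {S : CausalSystem 𝒞 𝒜 𝒵} (hS : S.InModel) :
    ObsModel S.law fun b => ∫ ω, S.outOf b ω ∂S.μ := by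
  have eC : ∀ c, S.law.real {x | x.1 = c} = S.μ.real (S.evC c) := fun c =>
    S.law_real (measurableSet_obsC c)
  have eA : ∀ b, S.law.real {x | x.2.1 = b} = S.μ.real (S.evA b) := fun b =>
    S.law_real (measurableSet_obsA b)
  have eAC : ∀ b c, S.law.real {x | x.2.1 = b ∧ x.1 = c} = S.μ.real (S.evC c ∩ S.evA b) :=
    fun b c => by
      rw [Set.inter_comm]
      exact S.law_real ((measurableSet_obsA b).inter (measurableSet_obsC c))
  have eZA : ∀ z b, S.law.real {x | x.2.2.1 = z ∧ x.2.1 = b} = S.μ.real (S.evA b ∩ S.evZ z) :=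
    fun z b => by
      rw [Set.inter_comm]
      exact S.law_real ((measurableSet_obsZ z).inter (measurableSet_obsA b))
  have eZC : ∀ z c, S.law.real {x | x.2.2.1 = z ∧ x.1 = c} = S.μ.real (S.evZ z ∩ S.evC c) :=
    fun z c => S.law_real ((measurableSet_obsZ z).inter (measurableSet_obsC c))
  have eCAZ : ∀ c b z, S.law.real {x | x.1 = c ∧ x.2.1 = b ∧ x.2.2.1 = z}
      = S.μ.real (S.evC c ∩ S.evA b ∩ S.evZ z) := fun c b z => by
    rw [Set.inter_assoc]
    exact S.law_real ((measurableSet_obsC c).inter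
      ((measurableSet_obsA b).inter (measurableSet_obsZ z)))
  have iZC : ∀ z c, ∫ x in {x | x.2.2.1 = z ∧ x.1 = c}, x.2.2.2 ∂S.law
      = ∫ ω in S.evZ z ∩ S.evC c, S.out ω ∂S.μ := fun z c => by
    have hm : Measurable fun x : Obs 𝒞 𝒜 𝒵 => x.2.2.2 := by fun_prop
    exact setIntegral_map ((measurableSet_obsZ z).inter (measurableSet_obsC c))
      hm.aestronglyMeasurable S.measurable_obs.aemeasurable
  refine ⟨inferInstance, ?_, ?_, ?_, ?_⟩
  · have hm : Measurable fun x : Obs 𝒞 𝒜 𝒵 => x.2.2.2 := by fun_prop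
    exact (integrable_map_measure hm.aestronglyMeasurable S.measurable_obs.aemeasurable).2
      hS.standing.integrable_out
  · intro c b z
    rw [eCAZ]
    exact hS.pos_real c b z subset_rfl
  · intro c b z
    simp only [trueNuisance, eC, eAC, eZA, eA, eCAZ]
    have h := hS.med_indep_cov c b z
    have h1 := hS.pos_real c b z (E := S.evC c) fun ω h => h.1.1
    have h2 := hS.pos_real c b z (E := S.evA b) fun ω h => h.1.2
    field_simp
    linarith
  · intro b
    refine (hS.hasSum_outOf b).congr_fun fun zc => ?_
    obtain ⟨z, c⟩ := zc
    simp only [trueNuisance, eC, eAC, eZA, eA, eZC, iZC]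
    have h := hS.med_indep_cov c b z
    have h1 := hS.pos_real c b z (E := S.evC c) fun ω h => h.1.1
    have h2 := hS.pos_real c b z (E := S.evA b) fun ω h => h.1.2
    have h3 := hS.pos_real c b z (E := S.evZ z ∩ S.evC c) fun ω h => ⟨h.2, h.1.1⟩
    have h4 := hS.pos_real c b z (E := S.evC c ∩ S.evA b) fun ω h => h.1
    have h5 := hS.integral_out_atom_eq c b z
    have h6 := hS.pos_real c b z subset_rfl
    have q1 : (∫ ω in S.evZ z ∩ S.evC c, S.out ω ∂S.μ) / S.μ.real (S.evZ z ∩ S.evC c)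
        = (∫ ω in S.evC c ∩ S.evA b ∩ S.evZ z, S.out ω ∂S.μ)
          / S.μ.real (S.evC c ∩ S.evA b ∩ S.evZ z) := by
      rw [div_eq_div_iff h3.ne' h6.ne', h5]
    have q2 : S.μ.real (S.evA b ∩ S.evZ z) / S.μ.real (S.evA b)
        = S.μ.real (S.evC c ∩ S.evA b ∩ S.evZ z) / S.μ.real (S.evC c ∩ S.evA b) := by
      rw [div_eq_div_iff h2.ne' h4.ne', h]
    rw [q1, q2]
    field_simp

end TripleDoor

/-! ### The mean of the estimating function and triple robustness. -/

namespace TripleDoor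

variable {𝒞 𝒜 𝒵 : Type u} [MeasurableSpace 𝒞] [MeasurableSpace 𝒜] [MeasurableSpace 𝒵]

/-- The sum `∑_{z,c} e(z, c) q(z) r(c)`. -/
noncomputable def eSum (e : 𝒵 → 𝒞 → ℝ) (q : 𝒵 → ℝ) (r : 𝒞 → ℝ) : ℝ :=
  ∑' zc : 𝒵 × 𝒞, e zc.1 zc.2 * q zc.1 * r zc.2

/-- The residual term of `m`. -/
noncomputable def mResid (astar a : 𝒜) (η : Nuisance 𝒞 𝒜 𝒵) (x : Obs 𝒞 𝒜 𝒵) : ℝ :=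
  (x.2.2.2 - η.e x.2.2.1 x.1) * (η.pZ astar x.2.2.1 - η.pZ a x.2.2.1)
    / (∑' b, η.pA x.1 b * η.pZ b x.2.2.1)

/-- The treatment-mediator term of `m`. -/
noncomputable def mTreat (astar a : 𝒜) (η : Nuisance 𝒞 𝒜 𝒵) (x : Obs 𝒞 𝒜 𝒵) : ℝ :=
  ∑' c, (η.e x.2.2.1 c - ∑' z, η.e z c * η.pZ x.2.1 z)
    * ((ind astar x.2.1 - ind a x.2.1) * η.pC c / η.margA x.2.1)

/-- The covariate term of `m`. -/
noncomputable def mCov (astar a : 𝒜) (η : Nuisance 𝒞 𝒜 𝒵) (x : Obs 𝒞 𝒜 𝒵) : ℝ :=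
  ∑' z, η.e z x.1 * (η.pZ astar z - η.pZ a z)

theorem mFun_eq (astar a : 𝒜) (η : Nuisance 𝒞 𝒜 𝒵) :
    mFun astar a η = fun x => mResid astar a η x + mTreat astar a η x + mCov astar a η x := rfl

namespace ObsModel

variable {P : Measure (Obs 𝒞 𝒜 𝒵)} {θ : 𝒜 → ℝ}

theorem pos_of_subset (h : ObsModel P θ) (c : 𝒞) (b : 𝒜) (z : 𝒵) {E : Set (Obs 𝒞 𝒜 𝒵)}
    (hE : {x | x.1 = c ∧ x.2.1 = b ∧ x.2.2.1 = z} ⊆ E) : 0 < P.real E := by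
  have := h.prob
  exact (h.pos c b z).trans_le (measureReal_mono hE)

theorem nonempty (h : ObsModel P θ) : Nonempty 𝒞 ∧ Nonempty 𝒜 ∧ Nonempty 𝒵 := by
  have := h.prob
  obtain ⟨x⟩ := P.nonempty_of_neZero
  exact ⟨⟨x.1⟩, ⟨x.2.1⟩, ⟨x.2.2.1⟩⟩

theorem pC_pos (h : ObsModel P θ) (c : 𝒞) : 0 < (trueNuisance P).pC c := by
  obtain ⟨-, ⟨b⟩, ⟨z⟩⟩ := h.nonempty
  exact h.pos_of_subset c b z fun x hx => hx.1

theorem probA_pos (h : ObsModel P θ) (b : 𝒜) : 0 < probA P b := by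
  obtain ⟨⟨c⟩, -, ⟨z⟩⟩ := h.nonempty
  exact h.pos_of_subset c b z fun x hx => hx.2.1

theorem pZ_pos (h : ObsModel P θ) (b : 𝒜) (z : 𝒵) : 0 < (trueNuisance P).pZ b z := by
  obtain ⟨⟨c⟩, -, -⟩ := h.nonempty
  exact div_pos (h.pos_of_subset c b z fun x hx => ⟨hx.2.2, hx.2.1⟩) (h.probA_pos b)

theorem real_ZA (h : ObsModel P θ) (z : 𝒵) (b : 𝒜) :
    P.real {x | x.2.2.1 = z ∧ x.2.1 = b} = probA P b * (trueNuisance P).pZ b z :=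
  (mul_div_cancel₀ _ (h.probA_pos b).ne').symm

theorem real_AC (h : ObsModel P θ) (b : 𝒜) (c : 𝒞) :
    P.real {x | x.2.1 = b ∧ x.1 = c} = (trueNuisance P).pC c * (trueNuisance P).pA c b :=
  (mul_div_cancel₀ _ (h.pC_pos c).ne').symm

variable [MeasurableSingletonClass 𝒞] [MeasurableSingletonClass 𝒜] [MeasurableSingletonClass 𝒵]
  [Countable 𝒞] [Countable 𝒜] [Countable 𝒵]

theorem hasSum_real_ZC (h : ObsModel P θ) (z : 𝒵) (c : 𝒞) :
    HasSum (fun b => (trueNuisance P).pC c * ((trueNuisance P).pA c b * (trueNuisance P).pZ b z))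
      (P.real {x | x.2.2.1 = z ∧ x.1 = c}) := by
  have := h.prob
  have hX : Measurable fun x : Obs 𝒞 𝒜 𝒵 => x.2.1 := by fun_prop
  refine (hasSum_measureReal_inter_fiber (μ := P) hX
    ((measurableSet_obsZ z).inter (measurableSet_obsC c))).congr_fun fun b => ?_
  rw [← mul_assoc, ← h.factor c b z]
  congr 1
  ext x
  simp [and_comm, and_left_comm]

theorem real_ZC (h : ObsModel P θ) (z : 𝒵) (c : 𝒞) :
    P.real {x | x.2.2.1 = z ∧ x.1 = c}
      = (trueNuisance P).pC c * ∑' b, (trueNuisance P).pA c b * (trueNuisance P).pZ b z := by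
  rw [← (h.hasSum_real_ZC z c).tsum_eq, tsum_mul_left]

theorem real_ZC_pos (h : ObsModel P θ) (z : 𝒵) (c : 𝒞) :
    0 < P.real {x | x.2.2.1 = z ∧ x.1 = c} := by
  obtain ⟨-, ⟨b⟩, -⟩ := h.nonempty
  exact h.pos_of_subset c b z fun x hx => ⟨hx.2.2, hx.1⟩

theorem margA_eq (h : ObsModel P θ) (b : 𝒜) : (trueNuisance P).margA b = probA P b := by
  have := h.prob
  have hX : Measurable fun x : Obs 𝒞 𝒜 𝒵 => x.1 := by fun_prop
  have h1 := hasSum_measureReal_inter_fiber (μ := P) hX (measurableSet_obsA b)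
  exact (h1.congr_fun fun c => (h.real_AC b c).symm).tsum_eq

/-- The covariate term is a function of `C` alone, so its mean is a sum over `c` weighted by the
true `p(c)`. Summability over `z` for fixed `c` is extracted from that of the double sum because
`p(c) > 0`. -/
theorem integral_mCov (h : ObsModel P θ) {astar a : 𝒜} {η : Nuisance 𝒞 𝒜 𝒵}
    (hs : ∀ b ∈ ({astar, a} : Set 𝒜), Summable fun zc : 𝒵 × 𝒞 =>
      η.e zc.1 zc.2 * η.pZ b zc.1 * (trueNuisance P).pC zc.2) :
    Integrable (mCov astar a η) P ∧ ∫ x, mCov astar a η x ∂P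
      = eSum η.e (η.pZ astar) (trueNuisance P).pC - eSum η.e (η.pZ a) (trueNuisance P).pC := by
  have := h.prob
  set r := (trueNuisance P).pC with hr
  have hX : Measurable fun x : Obs 𝒞 𝒜 𝒵 => x.1 := by fun_prop
  have hsw : ∀ b ∈ ({astar, a} : Set 𝒜), Summable fun cz : 𝒞 × 𝒵 =>
      η.e cz.2 cz.1 * η.pZ b cz.2 * r cz.1 := fun b hb =>
    (Equiv.prodComm 𝒞 𝒵).summable_iff.2 (hs b hb)
  have hJ : ∀ b ∈ ({astar, a} : Set 𝒜), HasSum (fun c => (∑' z, η.e z c * η.pZ b z) * r c)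
      (eSum η.e (η.pZ b) r) := fun b hb => by
    have h1 := (hsw b hb).hasSum.prod_fiberwise fun c => ((hsw b hb).prod_factor c).hasSum
    have h2 : ∑' cz : 𝒞 × 𝒵, η.e cz.2 cz.1 * η.pZ b cz.2 * r cz.1 = eSum η.e (η.pZ b) r :=
      (Equiv.prodComm 𝒞 𝒵).tsum_eq fun zc : 𝒵 × 𝒞 => η.e zc.1 zc.2 * η.pZ b zc.1 * r zc.2
    rw [h2] at h1
    simpa only [tsum_mul_right] using h1
  have hf : ∀ b ∈ ({astar, a} : Set 𝒜), ∀ c, Summable fun z => η.e z c * η.pZ b z :=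
    fun b hb c => (summable_mul_right_iff (h.pC_pos c).ne').1 ((hsw b hb).prod_factor c)
  have h1 := (hJ astar (by simp)).sub (hJ a (by simp))
  have h2 : (fun c => (∑' z, η.e z c * η.pZ astar z) * r c - (∑' z, η.e z c * η.pZ a z) * r c)
      = fun c => (∑' z, η.e z c * (η.pZ astar z - η.pZ a z))
        * P.real ((fun x : Obs 𝒞 𝒜 𝒵 => x.1) ⁻¹' {c}) := by
    ext c
    simp_rw [mul_sub]
    rw [(hf astar (by simp) c).tsum_sub (hf a (by simp) c), sub_mul]
    rfl
  rw [h2] at h1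
  have hi := integrable_comp_of_summable (μ := P) hX h1.summable
  exact ⟨hi, (hasSum_integral_comp hX hi).unique h1⟩

theorem integral_ind_mul (h : ObsModel P θ) {b : 𝒜} {g : 𝒵 → ℝ}
    (hs : Summable fun z => (trueNuisance P).pZ b z * g z) :
    Integrable (fun x : Obs 𝒞 𝒜 𝒵 => ind b x.2.1 * g x.2.2.1) P ∧
      ∫ x : Obs 𝒞 𝒜 𝒵, ind b x.2.1 * g x.2.2.1 ∂P
        = probA P b * ∑' z, (trueNuisance P).pZ b z * g z := by
  have := h.prob
  have hX : Measurable fun x : Obs 𝒞 𝒜 𝒵 => x.2.2.1 := by fun_prop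
  have hA := measurableSet_obsA (𝒞 := 𝒞) (𝒵 := 𝒵) b
  have e1 : (fun x : Obs 𝒞 𝒜 𝒵 => ind b x.2.1 * g x.2.2.1)
      = {x : Obs 𝒞 𝒜 𝒵 | x.2.1 = b}.indicator fun x => g x.2.2.1 := by
    ext x
    by_cases hx : x.2.1 = b <;> simp [ind, Set.indicator, hx]
  have e2 : ∀ z, (P.restrict {x : Obs 𝒞 𝒜 𝒵 | x.2.1 = b}).real
      ((fun x : Obs 𝒞 𝒜 𝒵 => x.2.2.1) ⁻¹' {z}) = probA P b * (trueNuisance P).pZ b z :=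
    fun z => by
      rw [measureReal_restrict_apply (hX (measurableSet_singleton z)), ← h.real_ZA z b]
      rfl
  have hs' : Summable fun z => g z * (P.restrict {x : Obs 𝒞 𝒜 𝒵 | x.2.1 = b}).real
      ((fun x : Obs 𝒞 𝒜 𝒵 => x.2.2.1) ⁻¹' {z}) := by
    simp_rw [e2]
    refine (hs.mul_left (probA P b)).congr fun z => by ring
  have hi := integrable_comp_of_summable hX hs'
  rw [e1, integrable_indicator_iff hA, integral_indicator hA]
  refine ⟨hi, ?_⟩
  rw [← (hasSum_integral_comp hX hi).tsum_eq, ← tsum_mul_left]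
  congr 1
  ext z
  rw [e2]
  ring

/-- The term is a function of `(A, Z)` supported on `A ∈ {a*, a}`, and its inner sum separates into
a function of `Z` minus a constant. Averaging over `Z` given `A = b` uses the true `p(z|b)`, while
the weights are those of `η`; hence the factor `p(b) / η.margA b`, which is `1` only if the margin
is right. -/
theorem integral_mTreat (h : ObsModel P θ) {astar a : 𝒜} {η : Nuisance 𝒞 𝒜 𝒵}
    (hs : ∀ b ∈ ({astar, a} : Set 𝒜), Summable fun zc : 𝒵 × 𝒞 =>
      η.e zc.1 zc.2 * (trueNuisance P).pZ b zc.1 * η.pC zc.2)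
    (hs' : ∀ b ∈ ({astar, a} : Set 𝒜), Summable fun zc : 𝒵 × 𝒞 =>
      η.e zc.1 zc.2 * η.pZ b zc.1 * η.pC zc.2) :
    Integrable (mTreat astar a η) P ∧ ∫ x, mTreat astar a η x ∂P
      = probA P astar / η.margA astar * (eSum η.e ((trueNuisance P).pZ astar) η.pC
          - eSum η.e (η.pZ astar) η.pC)
        - probA P a / η.margA a * (eSum η.e ((trueNuisance P).pZ a) η.pC
          - eSum η.e (η.pZ a) η.pC) := by
  have := h.prob
  set r := η.pC with hr
  -- A slice of the double sum carries the constant factor `p(z|a*)`, which is positive and can be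
  -- divided out.
  have hE : ∀ z, Summable fun c => η.e z c * r c := fun z => by
    refine (summable_mul_left_iff (h.pZ_pos astar z).ne').1 ?_
    refine ((hs astar (by simp)).prod_factor z).congr fun c => by ring
  have hJ : ∀ b ∈ ({astar, a} : Set 𝒜), HasSum (fun c => (∑' z, η.e z c * η.pZ b z) * r c)
      (eSum η.e (η.pZ b) r) := fun b hb => by
    have hsw : Summable fun cz : 𝒞 × 𝒵 => η.e cz.2 cz.1 * η.pZ b cz.2 * r cz.1 :=
      (Equiv.prodComm 𝒞 𝒵).summable_iff.2 (hs' b hb)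
    have h1 := hsw.hasSum.prod_fiberwise fun c => (hsw.prod_factor c).hasSum
    have h2 : ∑' cz : 𝒞 × 𝒵, η.e cz.2 cz.1 * η.pZ b cz.2 * r cz.1 = eSum η.e (η.pZ b) r :=
      (Equiv.prodComm 𝒞 𝒵).tsum_eq fun zc : 𝒵 × 𝒞 => η.e zc.1 zc.2 * η.pZ b zc.1 * r zc.2
    rw [h2] at h1
    simpa only [tsum_mul_right] using h1
  have hL : ∀ b ∈ ({astar, a} : Set 𝒜), HasSum (fun z => (trueNuisance P).pZ b z
      * ∑' c, η.e z c * r c) (eSum η.e ((trueNuisance P).pZ b) r) := fun b hb => by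
    have h1 := (hs b hb).hasSum.prod_fiberwise fun z => ((hs b hb).prod_factor z).hasSum
    refine h1.congr_fun fun z => ?_
    rw [← tsum_mul_left]
    congr 1
    ext c
    ring
  have hpZ : ∀ b, HasSum (fun z => (trueNuisance P).pZ b z) 1 := fun b => by
    have hX : Measurable fun x : Obs 𝒞 𝒜 𝒵 => x.2.2.1 := by fun_prop
    have h1 := (hasSum_measureReal_inter_fiber (μ := P) hX (measurableSet_obsA b)).div_const
      (probA P b)
    rw [show P.real {x : Obs 𝒞 𝒜 𝒵 | x.2.1 = b} / probA P b = 1 from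
      div_self (h.probA_pos b).ne'] at h1
    refine h1.congr_fun fun z => ?_
    simp only [trueNuisance, probA]
    congr 2
    exact Set.inter_comm _ _
  have key : ∀ x : Obs 𝒞 𝒜 𝒵, mTreat astar a η x
      = ind astar x.2.1 * ((∑' c, η.e x.2.2.1 c * r c) - eSum η.e (η.pZ astar) r) / η.margA astar
        - ind a x.2.1 * ((∑' c, η.e x.2.2.1 c * r c) - eSum η.e (η.pZ a) r) / η.margA a := by
    rintro ⟨c₀, b, z, y⟩
    have hb : ∀ b ∈ ({astar, a} : Set 𝒜), ∀ k : ℝ, ∑' c, (η.e z c - ∑' z, η.e z c * η.pZ b z)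
        * (k * r c / η.margA b)
        = k * ((∑' c, η.e z c * r c) - eSum η.e (η.pZ b) r) / η.margA b := fun b hb k => by
      rw [← (hJ b hb).tsum_eq, ← (hE z).tsum_sub (hJ b hb).summable, ← tsum_mul_left,
        ← tsum_div_const]
      congr 1
      ext c
      ring
    simp only [mTreat]
    by_cases h1 : b = astar
    · subst h1
      rw [hb b (by simp)]
      by_cases h2 : b = a
      · subst h2; simp
      · have : ind a b = 0 := by simp [ind, h2]
        rw [this]; ring
    · have h3 : ind astar b = 0 := by simp [ind, h1]
      by_cases h2 : b = a
      · subst h2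
        rw [hb b (by simp), h3]; ring
      · have : ind a b = 0 := by simp [ind, h2]
        simp [this, h3]
  have hg : ∀ b ∈ ({astar, a} : Set 𝒜), HasSum (fun z => (trueNuisance P).pZ b z
      * ((∑' c, η.e z c * r c) - eSum η.e (η.pZ b) r))
      (eSum η.e ((trueNuisance P).pZ b) r - eSum η.e (η.pZ b) r) := fun b hb => by
    have h1 := (hL b hb).sub ((hpZ b).mul_right (eSum η.e (η.pZ b) r))
    rw [one_mul] at h1
    refine h1.congr_fun fun z => by ring
  have i1 := h.integral_ind_mul (hg astar (by simp)).summable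
  have i2 := h.integral_ind_mul (hg a (by simp)).summable
  rw [(hg astar (by simp)).tsum_eq] at i1
  rw [(hg a (by simp)).tsum_eq] at i2
  rw [show mTreat astar a η = _ from funext key]
  refine ⟨(i1.1.div_const _).sub (i2.1.div_const _), ?_⟩
  rw [integral_sub (i1.1.div_const _) (i2.1.div_const _), integral_div, integral_div, i1.2, i2.2]
  ring

/-- The term is affine in `Y` with coefficients depending on `(Z, C)`, so on each fiber only
`E(Y|z,c)` survives. Convergence of the sum comes from integrability of the term and is not a
separate assumption. -/
theorem hasSum_integral_mResid (h : ObsModel P θ) {astar a : 𝒜} {η : Nuisance 𝒞 𝒜 𝒵}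
    (hi : Integrable (mResid astar a η) P) :
    HasSum (fun zc : 𝒵 × 𝒞 => ((trueNuisance P).e zc.1 zc.2 - η.e zc.1 zc.2)
      * (η.pZ astar zc.1 - η.pZ a zc.1) / (∑' b, η.pA zc.2 b * η.pZ b zc.1)
      * ((trueNuisance P).pC zc.2 * ∑' b, (trueNuisance P).pA zc.2 b * (trueNuisance P).pZ b zc.1))
      (∫ x, mResid astar a η x ∂P) := by
  have := h.prob
  have hX : Measurable fun x : Obs 𝒞 𝒜 𝒵 => (x.2.2.1, x.1) := by fun_prop
  refine (hasSum_integral_fiber hX hi).congr_fun fun zc => ?_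
  obtain ⟨z, c⟩ := zc
  have hset : (fun x : Obs 𝒞 𝒜 𝒵 => (x.2.2.1, x.1)) ⁻¹' {(z, c)}
      = {x | x.2.2.1 = z ∧ x.1 = c} := by
    ext x; simp
  have hm : MeasurableSet {x : Obs 𝒞 𝒜 𝒵 | x.2.2.1 = z ∧ x.1 = c} :=
    (measurableSet_obsZ z).inter (measurableSet_obsC c)
  rw [hset, setIntegral_congr_fun (g := fun x => (x.2.2.2 - η.e z c) *
    ((η.pZ astar z - η.pZ a z) / (∑' b, η.pA c b * η.pZ b z))) hm fun x hx => by
      simp only [mResid, hx.1, hx.2, mul_div_assoc], integral_mul_const,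
    integral_sub h.integrable.integrableOn (integrable_const _)]
  have he : ∫ x in {x : Obs 𝒞 𝒜 𝒵 | x.2.2.1 = z ∧ x.1 = c}, x.2.2.2 ∂P
      = (trueNuisance P).e z c * P.real {x | x.2.2.1 = z ∧ x.1 = c} :=
    (div_mul_cancel₀ _ (h.real_ZC_pos z c).ne').symm
  rw [he, ← h.real_ZC z c]
  simp
  ring

/-- The mean of the estimating function at an arbitrary nuisance value. -/
theorem hasSum_integral_mFun (h : ObsModel P θ) {astar a : 𝒜} {η : Nuisance 𝒞 𝒜 𝒵}
    (hw : WellDefinedMean P astar a η) :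
    HasSum (fun zc : 𝒵 × 𝒞 => ((trueNuisance P).e zc.1 zc.2 - η.e zc.1 zc.2)
      * (η.pZ astar zc.1 - η.pZ a zc.1) / (∑' b, η.pA zc.2 b * η.pZ b zc.1)
      * ((trueNuisance P).pC zc.2 * ∑' b, (trueNuisance P).pA zc.2 b * (trueNuisance P).pZ b zc.1))
      (∫ x, mFun astar a η x ∂P
        - (probA P astar / η.margA astar * (eSum η.e ((trueNuisance P).pZ astar) η.pC
          - eSum η.e (η.pZ astar) η.pC)
        - probA P a / η.margA a * (eSum η.e ((trueNuisance P).pZ a) η.pC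
          - eSum η.e (η.pZ a) η.pC))
        - (eSum η.e (η.pZ astar) (trueNuisance P).pC - eSum η.e (η.pZ a) (trueNuisance P).pC)) := by
  have h3 := h.integral_mCov (astar := astar) (a := a) (η := η) fun b hb =>
    hw.summable b hb _ (by simp) _ (by simp)
  have h2 := h.integral_mTreat (astar := astar) (a := a) (η := η)
    (fun b hb => hw.summable b hb _ (by simp) _ (by simp))
    (fun b hb => hw.summable b hb _ (by simp) _ (by simp))
  have hi := hw.integrable
  rw [mFun_eq] at hi
  have h1 : Integrable (mResid astar a η) P := by
    refine ((hi.sub h2.1).sub h3.1).congr (ae_of_all _ fun x => ?_)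
    simp only [Pi.sub_apply]
    ring
  have e : ∫ x, mFun astar a η x ∂P = ∫ x, mResid astar a η x ∂P + ∫ x, mTreat astar a η x ∂P
      + ∫ x, mCov astar a η x ∂P := by
    rw [← integral_add h1 h2.1]
    exact integral_add (h1.add h2.1) h3.1
  rw [e, h2.2, h3.2]
  convert h.hasSum_integral_mResid h1 using 1
  ring

theorem eSum_true (h : ObsModel P θ) (b : 𝒜) :
    eSum (trueNuisance P).e ((trueNuisance P).pZ b) (trueNuisance P).pC = θ b :=
  (h.hasSum b).tsum_eq

/-- Triple robustness of the estimating function. -/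
theorem integral_mFun_of_correctlySpecified (h : ObsModel P θ) {astar a : 𝒜}
    {η : Nuisance 𝒞 𝒜 𝒵} (hw : WellDefinedMean P astar a η) (hc : CorrectlySpecified P η) :
    ∫ x, mFun astar a η x ∂P = θ astar - θ a := by
  have hm := h.hasSum_integral_mFun hw
  rcases hc with ⟨he, hA, hC⟩ | ⟨he, hZ⟩ | ⟨hZ, hA⟩
  -- Correct `e` kills the residual term. With correct margins the factors `p(b)/p(b)` are `1`, so
  -- the sums involving `η.pZ` cancel between the treatment and covariate terms.
  · have hmarg : ∀ b, η.margA b = probA P b := fun b => by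
      rw [← h.margA_eq b, Nuisance.margA, hA, hC, Nuisance.margA]
    simp only [he, hC, hmarg, sub_self, zero_mul, zero_div, h.eSum_true,
      div_self (h.probA_pos _).ne', one_mul] at hm
    have := hm.unique hasSum_zero
    linarith
  -- Correct `e` kills the residual term, correct `pZ` kills the treatment term, and the covariate
  -- term alone has mean `θ`.
  · simp only [he, hZ, sub_self, zero_mul, zero_div, mul_zero, h.eSum_true] at hm
    have := hm.unique hasSum_zero
    linarith
  -- Correct `pZ` kills the treatment term. With `pA` correct as well, the denominator cancels the
  -- conditional law of `Z` given `C`, and the residual term replaces `η.e` by the true `e` in the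
  -- mean of the covariate term.
  · have hs : ∀ b ∈ ({astar, a} : Set 𝒜), HasSum (fun zc : 𝒵 × 𝒞 => η.e zc.1 zc.2
        * (trueNuisance P).pZ b zc.1 * (trueNuisance P).pC zc.2)
        (eSum η.e ((trueNuisance P).pZ b) (trueNuisance P).pC) := fun b hb =>
      (hw.summable b hb _ (by simp) _ (by simp)).hasSum
    have h1 := ((h.hasSum astar).sub (h.hasSum a)).sub
      ((hs astar (by simp)).sub (hs a (by simp)))
    rw [hZ, hA] at hm
    have h2 := hm.unique (h1.congr_fun fun zc => ?_)
    · simp only [sub_self, mul_zero] at h2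
      linarith
    · obtain ⟨z, c⟩ := zc
      have hpos := h.real_ZC_pos z c
      rw [h.real_ZC z c] at hpos
      have hne : (∑' b, (trueNuisance P).pA c b * (trueNuisance P).pZ b z) ≠ 0 := fun h0 => by
        rw [h0, mul_zero] at hpos
        exact lt_irrefl _ hpos
      field_simp

end ObsModel

end TripleDoor

/-! ### Consistency. -/

namespace TripleDoor

theorem IsLittleOpOne.isBigOpOne_add_const {Ω : ℕ → Type*} [∀ n, MeasurableSpace (Ω n)]
    {μ : ∀ n, Measure (Ω n)} {f : ∀ n, Ω n → ℝ} (hf : IsLittleOpOne μ f) (c : ℝ) :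
    IsBigOpOne μ fun n ω => f n ω + c := by
  intro δ hδ
  refine ⟨|c| + 1, by positivity, ?_⟩
  filter_upwards [ENNReal.tendsto_nhds_zero.1 (hf 1 one_pos) δ hδ] with n hn
  refine (measure_mono fun ω hω => ?_).trans hn
  simp only [Set.mem_ofPred_eq] at hω ⊢
  linarith [abs_add_le (f n ω) c]

/-- The Lipschitz bound resulting from a common bound on the partial derivatives. -/
theorem norm_sub_le_of_norm_partial_le {ι : Type*} [Fintype ι] [DecidableEq ι] {E : ι → Type*}
    [∀ j, NormedAddCommGroup (E j)] [∀ j, NormedSpace ℝ (E j)] {f : (∀ j, E j) → ℝ}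
    {U : Set (∀ j, E j)} (hU : Convex ℝ U) {M : ℝ}
    (hd : ∀ β ∈ U, DifferentiableAt ℝ f β)
    (hM : ∀ β ∈ U, ∀ j, ‖fderiv ℝ (fun v => f (Function.update β j v)) (β j)‖ ≤ M)
    {β β' : ∀ j, E j} (hβ : β ∈ U) (hβ' : β' ∈ U) :
    |f β' - f β| ≤ Fintype.card ι * |M| * ‖β' - β‖ := by
  -- The full derivative is a sum of partial derivatives over the coordinates, whence the factor
  -- `card ι` in the sup norm. `|M|` replaces `M` because `M` may be negative when `ι` is empty.
  refine hU.norm_image_sub_le_of_norm_fderiv_le (𝕜 := ℝ) hd (fun b hb => ?_) hβ hβ'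
  refine ContinuousLinearMap.opNorm_le_bound _ (by positivity) fun v => ?_
  have h1 : ∀ j, fderiv ℝ f b (Pi.single j (v j))
      = fderiv ℝ (fun w => f (Function.update b j w)) (b j) (v j) := fun j => by
    have h2 : HasFDerivAt f (fderiv ℝ f b) (Function.update b j (b j)) := by
      rw [Function.update_eq_self]
      exact (hd b hb).hasFDerivAt
    have h3 := h2.comp (b j) (hasFDerivAt_update b (b j))
    have h4 : fderiv ℝ (fun w => f (Function.update b j w)) (b j) = _ := h3.fderiv
    rw [h4, ContinuousLinearMap.comp_apply]
    congr 1
    ext i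
    by_cases hij : i = j
    · subst hij; simp
    · simp [hij]
  have h5 : fderiv ℝ f b v = ∑ j, fderiv ℝ f b (Pi.single j (v j)) := by
    rw [← map_sum, Finset.univ_sum_single]
  rw [h5]
  refine (norm_sum_le _ _).trans ?_
  calc _ ≤ ∑ _j : ι, |M| * ‖v‖ := Finset.sum_le_sum fun j _ => by
        rw [h1 j]
        refine (ContinuousLinearMap.le_opNorm _ _).trans ?_
        gcongr
        · exact (hM b hb j).trans (le_abs_self M)
        · exact norm_le_pi_norm v j
    _ = _ := by simp; ring

section Solution

variable {𝒞 𝒜 𝒵 : Type u} {astar a : 𝒜}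

/-- The equation is linear in its last argument, so its solution is explicit. At `n = 0` it is void
and leaves the estimator arbitrary. -/
theorem SolvesEstimatingEquation.eq_average {N : ℕ → ℕ}
    {ηhat : ∀ n, Data 𝒞 𝒜 𝒵 n (N n) → Nuisance 𝒞 𝒜 𝒵} {T : ∀ n, Data 𝒞 𝒜 𝒵 n (N n) → ℝ}
    (h : SolvesEstimatingEquation astar a N ηhat T) {n : ℕ} (hn : n ≠ 0)
    (D : Data 𝒞 𝒜 𝒵 n (N n)) :
    T n D = (n : ℝ)⁻¹ * ∑ i, mFun astar a (ηhat n D) (D.1 i) := by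
  have h1 := h n D
  have hn' : (n : ℝ) ≠ 0 := by positivity
  simp only [phi, Finset.sum_sub_distrib, Finset.sum_const, Finset.card_univ, Fintype.card_fin,
    nsmul_eq_mul, mul_sub] at h1
  rw [inv_mul_cancel_left₀ hn'] at h1
  linarith

end Solution

/-- Consistency of the solution of the estimating equation. -/
theorem isLittleOpOne_of_consistencyRegularity {𝒞 𝒜 𝒵 : Type u} [MeasurableSpace 𝒞]
    [MeasurableSpace 𝒜] [MeasurableSpace 𝒵] {P : Measure (Obs 𝒞 𝒜 𝒵)} [IsProbabilityMeasure P]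
    {astar a : 𝒜} {N : ℕ → ℕ} {ηhat : ∀ n, Data 𝒞 𝒜 𝒵 n (N n) → Nuisance 𝒞 𝒜 𝒵}
    {T : ∀ n, Data 𝒞 𝒜 𝒵 n (N n) → ℝ} (hT : SolvesEstimatingEquation astar a N ηhat T)
    {ι : Type*} [Fintype ι] [DecidableEq ι] {E : ι → Type*} [∀ j, NormedAddCommGroup (E j)]
    [∀ j, NormedSpace ℝ (E j)] {η : (∀ j, E j) → Nuisance 𝒞 𝒜 𝒵}
    {βhat : ∀ n, Data 𝒞 𝒜 𝒵 n (N n) → ∀ j, E j} {βbar : ∀ j, E j}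
    (hη : ∀ n D, ηhat n D = η (βhat n D))
    (hβ : ∀ j, IsLittleOpOne (fun n => sampleLaw P n (N n)) fun n D => ‖βhat n D j - βbar j‖)
    (hi : Integrable (mFun astar a (η βbar)) P)
    (hr : ConsistencyRegularity P astar a η βbar) :
    IsLittleOpOne (fun n => sampleLaw P n (N n))
      fun n D => T n D - ∫ x, mFun astar a (η βbar) x ∂P := by
  obtain ⟨M, hM, U, hU, hx⟩ := hr
  obtain ⟨ρ, hρ, hball⟩ := Metric.mem_nhds_iff.1 hU
  have hnorm : IsLittleOpOne (fun n => sampleLaw P n (N n))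
      fun n D => ‖βhat n D - βbar‖ := by
    refine (IsLittleOpOne.sum Finset.univ fun j _ => hβ j).of_abs_le
      (Eventually.of_forall fun n D => ?_)
    rw [abs_norm]
    refine le_trans ?_ (le_abs_self _)
    refine (pi_norm_le_iff_of_nonneg (Finset.sum_nonneg fun _ _ => norm_nonneg _)).2 fun j => ?_
    exact Finset.single_le_sum (f := fun j => ‖βhat n D j - βbar j‖)
      (fun _ _ => norm_nonneg _) (Finset.mem_univ j)
  -- The sample mean of `|M|`, the random Lipschitz constant up to the factor `card ι`, is `O_p(1)`.
  have h1 := (isLittleOpOne_average_sub_integral hM.abs N).isBigOpOne_add_const (∫ x, |M x| ∂P)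
  simp only [sub_add_cancel] at h1
  have h2 := ((hnorm.mul_isBigOpOne h1).const_mul (Fintype.card ι)).abs.add
    (isLittleOpOne_average_sub_integral hi N).abs
  -- Excluded are samples with `β̂` outside a ball contained in `U`, and the null set of samples
  -- with an observation at which the derivative condition fails. A ball is used because the mean
  -- value inequality needs convexity.
  refine h2.of_abs_le_of_notMem (B := fun n => {D | ρ ≤ |‖βhat n D - βbar‖|} ∪
    {D | ¬ ∀ i, ∀ β ∈ U, DifferentiableAt ℝ (fun β' => mFun astar a (η β') (D.1 i)) β ∧
      ∀ j, ‖fderiv ℝ (fun v => mFun astar a (η (Function.update β j v)) (D.1 i)) (β j)‖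
        ≤ M (D.1 i)}) ?_ ?_
  · refine tendsto_of_tendsto_of_tendsto_of_le_of_le tendsto_const_nhds (hnorm ρ hρ)
      (fun _ => zero_le) fun n => (measure_union_le _ _).trans ?_
    rw [ae_iff.1 (ae_sample_of_ae hx), add_zero]
  · filter_upwards [eventually_ne_atTop 0] with n hn D hD
    simp only [Set.mem_union, Set.mem_ofPred_eq, not_or, not_not, not_le, abs_norm] at hD
    obtain ⟨hD1, hD2⟩ := hD
    rw [hT.eq_average hn, hη]
    have hkey : ∀ i, |mFun astar a (η (βhat n D)) (D.1 i) - mFun astar a (η βbar) (D.1 i)|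
        ≤ Fintype.card ι * |M (D.1 i)| * ‖βhat n D - βbar‖ := fun i =>
      norm_sub_le_of_norm_partial_le (f := fun β => mFun astar a (η β) (D.1 i))
        (convex_ball βbar ρ)
        (fun β hb => (hD2 i β (hball hb)).1) (fun β hb => (hD2 i β (hball hb)).2)
        (Metric.mem_ball_self hρ) (by rwa [Metric.mem_ball, dist_eq_norm])
    have e1 : (n : ℝ)⁻¹ * ∑ i, mFun astar a (η (βhat n D)) (D.1 i)
        - ∫ x, mFun astar a (η βbar) x ∂P
        = (n : ℝ)⁻¹ * ∑ i, (mFun astar a (η (βhat n D)) (D.1 i) - mFun astar a (η βbar) (D.1 i))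
          + ((n : ℝ)⁻¹ * ∑ i, mFun astar a (η βbar) (D.1 i)
            - ∫ x, mFun astar a (η βbar) x ∂P) := by
      rw [Finset.sum_sub_distrib]; ring
    rw [e1]
    refine le_trans ((abs_add_le _ _).trans (add_le_add ?_ le_rfl)) (le_abs_self _)
    refine le_trans ?_ (le_abs_self _)
    rw [abs_mul, abs_of_nonneg (by positivity : (0 : ℝ) ≤ (n : ℝ)⁻¹)]
    calc _ ≤ (n : ℝ)⁻¹ * ∑ i, Fintype.card ι * |M (D.1 i)| * ‖βhat n D - βbar‖ := by
          gcongr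
          exact (Finset.abs_sum_le_sum_abs _ _).trans (Finset.sum_le_sum fun i _ => hkey i)
      _ = _ := by
          rw [← Finset.sum_mul, ← Finset.mul_sum]; ring

end TripleDoor

/-! ### Functions affine in the outcome on atoms, and equicontinuity. -/

namespace TripleDoor

variable {𝒞 𝒜 𝒵 : Type u} [MeasurableSpace 𝒞] [MeasurableSpace 𝒜] [MeasurableSpace 𝒵]

/-- The event `(C, A, Z) = t`. -/
def atomSet (t : 𝒞 × 𝒜 × 𝒵) : Set (Obs 𝒞 𝒜 𝒵) := {x | x.1 = t.1 ∧ x.2.1 = t.2.1 ∧ x.2.2.1 = t.2.2}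

/-- The mean outcome on an atom. -/
noncomputable def atomMean (P : Measure (Obs 𝒞 𝒜 𝒵)) (t : 𝒞 × 𝒜 × 𝒵) : ℝ :=
  (∫ x in atomSet t, x.2.2.2 ∂P) / P.real (atomSet t)

/-- The centred outcome on an atom. -/
noncomputable def atomResid (P : Measure (Obs 𝒞 𝒜 𝒵)) (t : 𝒞 × 𝒜 × 𝒵) : Obs 𝒞 𝒜 𝒵 → ℝ :=
  (atomSet t).indicator fun x => x.2.2.2 - atomMean P t

/-- The indicator of an atom. -/
noncomputable def atomInd (t : 𝒞 × 𝒜 × 𝒵) : Obs 𝒞 𝒜 𝒵 → ℝ := (atomSet t).indicator fun _ => 1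

/-- The coefficient of `Y` in `m`. -/
noncomputable def mSlope (astar a : 𝒜) (η : Nuisance 𝒞 𝒜 𝒵) (t : 𝒞 × 𝒜 × 𝒵) : ℝ :=
  (η.pZ astar t.2.2 - η.pZ a t.2.2) / (∑' b, η.pA t.1 b * η.pZ b t.2.2)

/-- The value of `m` at `Y = 0`. -/
noncomputable def mBase (astar a : 𝒜) (η : Nuisance 𝒞 𝒜 𝒵) (t : 𝒞 × 𝒜 × 𝒵) : ℝ :=
  mFun astar a η (t.1, t.2.1, t.2.2, 0)

/-- Whatever the nuisance, `m` depends on `Y` affinely, with coefficients that are functions of `(C,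
A, Z)`. With finitely many atoms this confines all estimated `m` to one finite-dimensional space. -/
theorem mFun_eq_slope_base (astar a : 𝒜) (η : Nuisance 𝒞 𝒜 𝒵) (x : Obs 𝒞 𝒜 𝒵) :
    mFun astar a η x = x.2.2.2 * mSlope astar a η (x.1, x.2.1, x.2.2.1)
      + mBase astar a η (x.1, x.2.1, x.2.2.1) := by
  obtain ⟨c, b, z, y⟩ := x
  simp only [mBase, mSlope, mFun]
  ring

section Finite

variable [MeasurableSingletonClass 𝒞] [MeasurableSingletonClass 𝒜] [MeasurableSingletonClass 𝒵]

theorem measurableSet_atomSet (t : 𝒞 × 𝒜 × 𝒵) : MeasurableSet (atomSet t) :=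
  (measurableSet_obsC _).inter ((measurableSet_obsA _).inter (measurableSet_obsZ _))

variable [Fintype 𝒞] [Fintype 𝒜] [Fintype 𝒵] {P : Measure (Obs 𝒞 𝒜 𝒵)}

/-- Expansion in the fixed family of centred outcomes and indicators of atoms. Centring at the atom
mean makes this family orthogonal in `L²(P)`, so that each coefficient can be bounded by the norm of
the function. -/
theorem sum_atoms (P : Measure (Obs 𝒞 𝒜 𝒵)) {F : Obs 𝒞 𝒜 𝒵 → ℝ} {s w : 𝒞 × 𝒜 × 𝒵 → ℝ}
    (h : ∀ x, F x = x.2.2.2 * s (x.1, x.2.1, x.2.2.1) + w (x.1, x.2.1, x.2.2.1))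
    (x : Obs 𝒞 𝒜 𝒵) :
    F x = ∑ t, (s t * atomResid P t x + (w t + s t * atomMean P t) * atomInd t x) := by
  classical
  rw [Finset.sum_eq_single (x.1, x.2.1, x.2.2.1)]
  · have hx : x ∈ atomSet (x.1, x.2.1, x.2.2.1) := ⟨rfl, rfl, rfl⟩
    rw [h x, atomResid, atomInd, Set.indicator_of_mem hx, Set.indicator_of_mem hx]
    ring
  · intro t _ ht
    have hx : x ∉ atomSet t := fun hx => ht (by
      obtain ⟨c, b, z⟩ := t
      obtain ⟨h1, h2, h3⟩ := hx
      simp only at h1 h2 h3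
      simp [h1, h2, h3])
    rw [atomResid, atomInd, Set.indicator_of_notMem hx, Set.indicator_of_notMem hx]
    ring
  · simp

variable [IsProbabilityMeasure P]

theorem memLp_atomInd (t : 𝒞 × 𝒜 × 𝒵) (p : ENNReal) :
    MemLp (atomInd t : Obs 𝒞 𝒜 𝒵 → ℝ) p P :=
  (memLp_const 1).indicator (measurableSet_atomSet t)

theorem memLp_atomResid {p : ENNReal} (hY : MemLp (fun x : Obs 𝒞 𝒜 𝒵 => x.2.2.2) p P)
    (t : 𝒞 × 𝒜 × 𝒵) : MemLp (atomResid P t) p P :=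
  (hY.sub (memLp_const _)).indicator (measurableSet_atomSet t)

theorem memLp_of_affine {p : ENNReal} (hY : MemLp (fun x : Obs 𝒞 𝒜 𝒵 => x.2.2.2) p P)
    {F : Obs 𝒞 𝒜 𝒵 → ℝ} {s w : 𝒞 × 𝒜 × 𝒵 → ℝ}
    (h : ∀ x, F x = x.2.2.2 * s (x.1, x.2.1, x.2.2.1) + w (x.1, x.2.1, x.2.2.1)) :
    MemLp F p P := by
  rw [show F = _ from funext (sum_atoms P h)]
  exact memLp_finsetSum _ fun t _ =>
    ((memLp_atomResid hY t).const_mul _).add ((memLp_atomInd t p).const_mul _)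

theorem memLp_mFun {p : ENNReal} (hY : MemLp (fun x : Obs 𝒞 𝒜 𝒵 => x.2.2.2) p P) (astar a : 𝒜)
    (η : Nuisance 𝒞 𝒜 𝒵) : MemLp (mFun astar a η) p P :=
  memLp_of_affine hY (mFun_eq_slope_base astar a η)

theorem integrable_of_discrete (f : 𝒞 → 𝒜 → 𝒵 → ℝ) :
    Integrable (fun x : Obs 𝒞 𝒜 𝒵 => f x.1 x.2.1 x.2.2.1) P := by
  have hX : Measurable fun x : Obs 𝒞 𝒜 𝒵 => (x.1, x.2.1, x.2.2.1) := by fun_prop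
  exact integrable_comp_of_summable (h := fun t : 𝒞 × 𝒜 × 𝒵 => f t.1 t.2.1 t.2.2) hX
    Summable.of_finite

theorem empProc_atoms (hY : Integrable (fun x : Obs 𝒞 𝒜 𝒵 => x.2.2.2) P)
    {F : Obs 𝒞 𝒜 𝒵 → ℝ} {s w : 𝒞 × 𝒜 × 𝒵 → ℝ}
    (h : ∀ x, F x = x.2.2.2 * s (x.1, x.2.1, x.2.2.1) + w (x.1, x.2.1, x.2.2.1)) {n N : ℕ}
    (D : Data 𝒞 𝒜 𝒵 n N) :
    empProc P F D = ∑ t, (s t * empProc P (atomResid P t) D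
      + (w t + s t * atomMean P t) * empProc P (atomInd t) D) := by
  have hY1 := memLp_one_iff_integrable.2 hY
  have i1 : ∀ t, Integrable (atomResid P t) P := fun t =>
    memLp_one_iff_integrable.1 (memLp_atomResid hY1 t)
  have i2 : ∀ t, Integrable (atomInd t) P := fun t =>
    memLp_one_iff_integrable.1 (memLp_atomInd t 1)
  have e : ∫ x, F x ∂P = ∑ t, (s t * ∫ x, atomResid P t x ∂P
      + (w t + s t * atomMean P t) * ∫ x, atomInd t x ∂P) := by
    simp_rw [sum_atoms P h]
    refine (integral_finsetSum _ fun t _ =>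
      ((i1 t).const_mul (s t)).add ((i2 t).const_mul (w t + s t * atomMean P t))).trans ?_
    refine Finset.sum_congr rfl fun t _ => ?_
    rw [integral_add' ((i1 t).const_mul _) ((i2 t).const_mul _), integral_const_mul,
      integral_const_mul]
  unfold empProc
  simp only [sum_atoms P h (D.1 _)]
  rw [e, Finset.sum_comm, Finset.mul_sum, ← Finset.sum_sub_distrib, Finset.mul_sum]
  refine Finset.sum_congr rfl fun t _ => ?_
  rw [Finset.sum_add_distrib, ← Finset.mul_sum, ← Finset.mul_sum]
  ring

/-- Coefficients of a function affine in the outcome on every atom are controlled by its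
`L²`-norm. -/
theorem abs_coeff_mul_l2norm_le (hY : MemLp (fun x : Obs 𝒞 𝒜 𝒵 => x.2.2.2) 2 P)
    {F : Obs 𝒞 𝒜 𝒵 → ℝ} {s w : 𝒞 × 𝒜 × 𝒵 → ℝ}
    (h : ∀ x, F x = x.2.2.2 * s (x.1, x.2.1, x.2.2.1) + w (x.1, x.2.1, x.2.2.1))
    (t : 𝒞 × 𝒜 × 𝒵) (ht : 0 < P.real (atomSet t)) :
    |s t| * l2norm P (atomResid P t) ≤ l2norm P F ∧
      |w t + s t * atomMean P t| * l2norm P (atomInd t) ≤ l2norm P F := by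
  have hm := measurableSet_atomSet t
  have hYi := hY.integrable one_le_two
  set v := w t + s t * atomMean P t with hv
  have hF : MemLp F 2 P := memLp_of_affine hY h
  have h1 : ∫ x in atomSet t, F x ^ 2 ∂P ≤ ∫ x, F x ^ 2 ∂P :=
    setIntegral_le_integral hF.integrable_sq (ae_of_all _ fun _ => sq_nonneg _)
  have hres : MemLp (fun x : Obs 𝒞 𝒜 𝒵 => x.2.2.2 - atomMean P t) 2 P := hY.sub (memLp_const _)
  have i0 : ∫ x in atomSet t, (x.2.2.2 - atomMean P t) ∂P = 0 := by
    rw [integral_sub hYi.integrableOn (integrable_const _)]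
    simp only [integral_const, measureReal_restrict_apply_univ, smul_eq_mul, atomMean]
    field_simp
    ring
  -- Pythagoras on the atom: the cross term vanishes because the outcome is centred there.
  have h2 : ∫ x in atomSet t, F x ^ 2 ∂P
      = s t ^ 2 * ∫ x in atomSet t, (x.2.2.2 - atomMean P t) ^ 2 ∂P
        + v ^ 2 * P.real (atomSet t) := by
    rw [setIntegral_congr_fun (g := fun x => s t ^ 2 * (x.2.2.2 - atomMean P t) ^ 2
      + 2 * s t * v * (x.2.2.2 - atomMean P t) + v ^ 2) hm fun x hx => ?_]
    · rw [integral_add _ (integrable_const _), integral_add, integral_const_mul,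
        integral_const_mul, i0]
      · simp [mul_comm]
      · exact (hres.integrable_sq.integrableOn).const_mul _
      · exact ((hres.integrable one_le_two).integrableOn).const_mul _
      · exact ((hres.integrable_sq.integrableOn).const_mul _).add
          (((hres.integrable one_le_two).integrableOn).const_mul _)
    · obtain ⟨e1, e2, e3⟩ := hx
      have : (x.1, x.2.1, x.2.2.1) = t := by simp [e1, e2, e3]
      simp only [h x, this, hv]
      ring
  have h3 : ∫ x, atomResid P t x ^ 2 ∂P
      = ∫ x in atomSet t, (x.2.2.2 - atomMean P t) ^ 2 ∂P := by
    rw [← integral_indicator hm]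
    congr 1
    ext x
    by_cases hx : x ∈ atomSet t <;> simp [atomResid, hx]
  have h4 : ∫ x, atomInd t x ^ 2 ∂P = P.real (atomSet t) := by
    have : (fun x => atomInd t x ^ 2) = (atomSet t).indicator fun _ => (1 : ℝ) := by
      ext x
      by_cases hx : x ∈ atomSet t <;> simp [atomInd, hx]
    rw [this, integral_indicator hm]
    simp
  have h5 : 0 ≤ ∫ x in atomSet t, (x.2.2.2 - atomMean P t) ^ 2 ∂P :=
    integral_nonneg fun _ => sq_nonneg _
  constructor
  · rw [l2norm, l2norm, h3, ← Real.sqrt_sq_eq_abs, ← Real.sqrt_mul (sq_nonneg _)]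
    apply Real.sqrt_le_sqrt
    nlinarith [mul_nonneg (sq_nonneg v) ht.le]
  · rw [l2norm, l2norm, h4, ← Real.sqrt_sq_eq_abs, ← Real.sqrt_mul (sq_nonneg _)]
    apply Real.sqrt_le_sqrt
    nlinarith [mul_nonneg (sq_nonneg (s t)) h5]

/-- Stochastic equicontinuity: a random function affine in the outcome on every atom, with
`L²`-norm tending to zero, has asymptotically negligible empirical process. -/
theorem isLittleOpOne_empProc_of_l2norm (hY : MemLp (fun x : Obs 𝒞 𝒜 𝒵 => x.2.2.2) 2 P)
    (hpos : ∀ t, 0 < P.real (atomSet t : Set (Obs 𝒞 𝒜 𝒵))) {N : ℕ → ℕ}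
    {F : ∀ n, Data 𝒞 𝒜 𝒵 n (N n) → Obs 𝒞 𝒜 𝒵 → ℝ}
    {s w : ∀ n, Data 𝒞 𝒜 𝒵 n (N n) → 𝒞 × 𝒜 × 𝒵 → ℝ}
    (h : ∀ n D x, F n D x
      = x.2.2.2 * s n D (x.1, x.2.1, x.2.2.1) + w n D (x.1, x.2.1, x.2.2.1))
    (hF : IsLittleOpOne (fun n => sampleLaw P n (N n)) fun n D => l2norm P (F n D)) :
    IsLittleOpOne (fun n => sampleLaw P n (N n)) fun n D => empProc P (F n D) D := by
  have e : ∀ n D, empProc P (F n D) D = ∑ t, (s n D t * empProc P (atomResid P t) D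
      + (w n D t + s n D t * atomMean P t) * empProc P (atomInd t) D) := fun n D =>
    empProc_atoms (hY.integrable one_le_two) (h n D) D
  simp_rw [e]
  have hl : ∀ f : Obs 𝒞 𝒜 𝒵 → ℝ, 0 ≤ l2norm P f := fun f => Real.sqrt_nonneg _
  refine IsLittleOpOne.sum _ fun t _ => IsLittleOpOne.add ?_ ?_
  · refine IsLittleOpOne.mul_empProc (memLp_atomResid hY t)
      (hF.of_abs_le (Eventually.of_forall fun n D => ?_))
    rw [abs_of_nonneg (mul_nonneg (abs_nonneg _) (hl _)), abs_of_nonneg (hl _)]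
    exact (abs_coeff_mul_l2norm_le hY (h n D) t (hpos t)).1
  · refine IsLittleOpOne.mul_empProc (memLp_atomInd t 2)
      (hF.of_abs_le (Eventually.of_forall fun n D => ?_))
    rw [abs_of_nonneg (mul_nonneg (abs_nonneg _) (hl _)), abs_of_nonneg (hl _)]
    exact (abs_coeff_mul_l2norm_le hY (h n D) t (hpos t)).2

end Finite

end TripleDoor

/-! ### Finiteness of the index sets under the boundedness conditions. -/

namespace TripleDoor

variable {𝒞 𝒜 𝒵 : Type u} [MeasurableSpace 𝒞] [MeasurableSpace 𝒜] [MeasurableSpace 𝒵]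

theorem finite_of_summable_of_lt {ι : Type*} {f : ι → ℝ} (hf : Summable f) {ε : ℝ} (hε : 0 < ε)
    (h : ∀ i, ε < f i) : Finite ι := by
  have h1 := hf.tendsto_cofinite_zero.eventually_lt_const hε
  have h2 : {i | ¬ f i < ε} = Set.univ := by
    ext i; simpa using (h i).le
  rw [Filter.eventually_cofinite, h2] at h1
  exact Set.finite_univ_iff.1 h1

namespace ObsModel

variable {P : Measure (Obs 𝒞 𝒜 𝒵)} {θ : 𝒜 → ℝ}

/-- Every atom has positive mass, so no value of the discrete variables can hide in a null set. -/
theorem ae_iff_forall (h : ObsModel P θ) {q : 𝒞 → 𝒜 → 𝒵 → Prop} :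
    (∀ᵐ x ∂P, q x.1 x.2.1 x.2.2.1) ↔ ∀ c b z, q c b z := by
  refine ⟨fun hq c b z => ?_, fun hq => ae_of_all _ fun x => hq _ _ _⟩
  by_contra hc
  have h1 := h.pos c b z
  have h2 : P {x | x.1 = c ∧ x.2.1 = b ∧ x.2.2.1 = z} = 0 := by
    refine measure_mono_null (fun x hx => ?_) (ae_iff.1 hq)
    obtain ⟨e1, e2, e3⟩ := hx
    simpa [e1, e2, e3] using hc
  rw [measureReal_def, h2] at h1
  exact lt_irrefl _ h1

theorem pZ_le_one (h : ObsModel P θ) (b : 𝒜) (z : 𝒵) : (trueNuisance P).pZ b z ≤ 1 := by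
  have := h.prob
  exact div_le_one_of_le₀ (measureReal_mono fun x hx => hx.2) measureReal_nonneg

theorem pC_le_one (h : ObsModel P θ) (c : 𝒞) : (trueNuisance P).pC c ≤ 1 := by
  have := h.prob
  exact measureReal_le_one

variable [MeasurableSingletonClass 𝒞] [MeasurableSingletonClass 𝒜] [MeasurableSingletonClass 𝒵]

/-- Probabilities bounded below by a fixed `ε > 0` and with finite sum can only be finitely many.
This applies to `p(c)`, to `p(·|c)` and to `p(·|b)`. -/
theorem finite_of_boundedness [Countable 𝒞] [Countable 𝒜] [Countable 𝒵] (h : ObsModel P θ)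
    {astar a : 𝒜} {N : ℕ → ℕ} {ηhat : ∀ n, Data 𝒞 𝒜 𝒵 n (N n) → Nuisance 𝒞 𝒜 𝒵}
    (hb : Boundedness P astar a N ηhat) : Finite 𝒞 ∧ Finite 𝒜 ∧ Finite 𝒵 := by
  have := h.prob
  obtain ⟨⟨c⟩, ⟨b⟩, ⟨z⟩⟩ := h.nonempty
  refine ⟨?_, ?_, ?_⟩
  · obtain ⟨ε, hε, hx⟩ := hb.pC_gt
    have hx' := h.ae_iff_forall (q := fun c _ _ => ε < (trueNuisance P).pC c) |>.1 hx
    have hX : Measurable fun x : Obs 𝒞 𝒜 𝒵 => x.1 := by fun_prop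
    exact finite_of_summable_of_lt (hasSum_measureReal_fiber (μ := P) hX).summable hε
      fun c => hx' c b z
  · obtain ⟨ε, hε, hx⟩ := hb.pA_obs
    have hx' := h.ae_iff_forall (q := fun c b _ => ε < (trueNuisance P).pA c b) |>.1 hx
    have hX : Measurable fun x : Obs 𝒞 𝒜 𝒵 => x.2.1 := by fun_prop
    have hs := (hasSum_measureReal_inter_fiber (μ := P) hX (measurableSet_obsC c)).summable.mul_left
      ((trueNuisance P).pC c)⁻¹
    refine finite_of_summable_of_lt hs hε fun b => (hx' c b z).trans_eq ?_
    change _ = ((trueNuisance P).pC c)⁻¹ * P.real ({x | x.1 = c} ∩ {x | x.2.1 = b})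
    rw [Set.inter_comm, inv_mul_eq_div]
    rfl
  · obtain ⟨ε, hε, hx⟩ := hb.pZ_obs
    have hx' := h.ae_iff_forall (q := fun _ b z => ε < (trueNuisance P).pZ b z) |>.1 hx
    have hX : Measurable fun x : Obs 𝒞 𝒜 𝒵 => x.2.2.1 := by fun_prop
    have hs := (hasSum_measureReal_inter_fiber (μ := P) hX (measurableSet_obsA b)).summable.mul_left
      (probA P b)⁻¹
    refine finite_of_summable_of_lt hs hε fun z => (hx' c b z).trans_eq ?_
    change _ = (probA P b)⁻¹ * P.real ({x | x.2.1 = b} ∩ {x | x.2.2.1 = z})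
    rw [Set.inter_comm, inv_mul_eq_div]
    rfl

end ObsModel

/-! ### The second-order bias and asymptotic linearity. -/

section Drift

/-- The contribution of the treatment value `b` to the bias of the estimating function at `η`. -/
noncomputable def drift (P : Measure (Obs 𝒞 𝒜 𝒵)) [Fintype 𝒞] [Fintype 𝒵] (η : Nuisance 𝒞 𝒜 𝒵)
    (b : 𝒜) : ℝ :=
  ∑ zc : 𝒵 × 𝒞, ((trueNuisance P).pC zc.2
      * ((∑' b', (trueNuisance P).pA zc.2 b' * (trueNuisance P).pZ b' zc.1)
        / (∑' b', η.pA zc.2 b' * η.pZ b' zc.1) - 1)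
      * ((trueNuisance P).e zc.1 zc.2 - η.e zc.1 zc.2) * η.pZ b zc.1
    + ((trueNuisance P).pZ b zc.1 - η.pZ b zc.1)
      * ((probA P b / η.margA b - 1) * η.pC zc.2 * η.e zc.1 zc.2
        + (η.pC zc.2 - (trueNuisance P).pC zc.2) * η.e zc.1 zc.2
        + (trueNuisance P).pC zc.2 * (η.e zc.1 zc.2 - (trueNuisance P).e zc.1 zc.2)))

/-- Bounds on a nuisance value and on the denominators in `m`. -/
structure NuisanceBound (astar a : 𝒜) (η : Nuisance 𝒞 𝒜 𝒵) (K : ℝ) : Prop where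
  one_le : 1 ≤ K
  e : ∀ z c, |η.e z c| ≤ K
  pZ : ∀ b ∈ ({astar, a} : Set 𝒜), ∀ z, |η.pZ b z| ≤ K
  pA : ∀ c b, |η.pA c b| ≤ K
  pC : ∀ c, |η.pC c| ≤ K
  dens_ne : ∀ z c, (∑' b, η.pA c b * η.pZ b z) ≠ 0
  dens : ∀ z c, |(∑' b, η.pA c b * η.pZ b z)⁻¹| ≤ K
  marg_ne : ∀ b ∈ ({astar, a} : Set 𝒜), η.margA b ≠ 0
  marg : ∀ b ∈ ({astar, a} : Set 𝒜), |(η.margA b)⁻¹| ≤ K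

/-- A sum of products of two estimation errors. -/
noncomputable def driftBound (P : Measure (Obs 𝒞 𝒜 𝒵)) [Fintype 𝒞] [Fintype 𝒜] [Fintype 𝒵]
    (η : Nuisance 𝒞 𝒜 𝒵) (b : 𝒜) : ℝ :=
  ∑ zc : 𝒵 × 𝒞, (∑ b', (|η.e zc.1 zc.2 - (trueNuisance P).e zc.1 zc.2|
        * |η.pA zc.2 b' - (trueNuisance P).pA zc.2 b'|
      + |η.e zc.1 zc.2 - (trueNuisance P).e zc.1 zc.2|
        * |η.pZ b' zc.1 - (trueNuisance P).pZ b' zc.1|)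
    + (|η.pZ b zc.1 - (trueNuisance P).pZ b zc.1| * |η.margA b - probA P b|
      + |η.pZ b zc.1 - (trueNuisance P).pZ b zc.1| * |η.pC zc.2 - (trueNuisance P).pC zc.2|
      + |η.e zc.1 zc.2 - (trueNuisance P).e zc.1 zc.2|
        * |η.pZ b zc.1 - (trueNuisance P).pZ b zc.1|))

variable [Fintype 𝒞] [Fintype 𝒜] [Fintype 𝒵]
  {P : Measure (Obs 𝒞 𝒜 𝒵)} {θ : 𝒜 → ℝ}

/-- The ratio of true to estimated denominators minus `1` is at most `K²` times errors of `pA` and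
`pZ`, and `p(b)/η.margA b - 1` is at most `K` times the margin error. The remaining factors are
bounded by `K` or `1`, and no term collects more than `K³`. -/
theorem ObsModel.abs_drift_le (h : ObsModel P θ) {astar a : 𝒜} {η : Nuisance 𝒞 𝒜 𝒵} {K : ℝ}
    (hK : NuisanceBound astar a η K) {b : 𝒜} (hb : b ∈ ({astar, a} : Set 𝒜)) :
    |drift P η b| ≤ K ^ 3 * driftBound P η b := by
  unfold drift driftBound
  rw [Finset.mul_sum]
  refine (Finset.abs_sum_le_sum_abs _ _).trans (Finset.sum_le_sum fun zc _ => ?_)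
  obtain ⟨z, c⟩ := zc
  set p := trueNuisance P with hp
  have hK1 := hK.one_le
  have hK0 : 0 ≤ K := by linarith
  have hpC : |p.pC c| ≤ 1 := by
    rw [abs_of_pos (h.pC_pos c)]; exact h.pC_le_one c
  have hpZ : ∀ b, |p.pZ b z| ≤ 1 := fun b => by
    rw [abs_of_pos (h.pZ_pos b z)]; exact h.pZ_le_one b z
  set π₀ := ∑' b', p.pA c b' * p.pZ b' z with hπ₀
  set π := ∑' b', η.pA c b' * η.pZ b' z with hπ
  set de := |η.e z c - p.e z c|
  have hde : |p.e z c - η.e z c| = de := abs_sub_comm _ _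
  set S := ∑ b', (|η.pA c b' - p.pA c b'| + |η.pZ b' z - p.pZ b' z|) with hS
  have hS0 : 0 ≤ S := by positivity
  have h1 : |π₀ - π| ≤ K * S := by
    rw [hπ₀, hπ, tsum_fintype, tsum_fintype, ← Finset.sum_sub_distrib, hS, Finset.mul_sum]
    refine (Finset.abs_sum_le_sum_abs _ _).trans (Finset.sum_le_sum fun b' _ => ?_)
    -- The true `pZ`, at most `1`, is paired with the error of `pA`, and the estimated `pA` with the
    -- error of `pZ`. An upper bound on `η.pZ` for general treatment values is thereby avoided, as
    -- it is available only at `a*` and `a`.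
    have e1 : p.pA c b' * p.pZ b' z - η.pA c b' * η.pZ b' z
        = -((η.pA c b' - p.pA c b') * p.pZ b' z + η.pA c b' * (η.pZ b' z - p.pZ b' z)) := by ring
    rw [e1, abs_neg]
    refine (abs_add_le _ _).trans ?_
    rw [abs_mul, abs_mul, mul_add]
    refine add_le_add ?_ ?_
    · rw [mul_comm]
      exact mul_le_mul_of_nonneg_right ((hpZ b').trans hK1) (abs_nonneg _)
    · exact mul_le_mul_of_nonneg_right (hK.pA c b') (abs_nonneg _)
  have h2 : |π₀ / π - 1| ≤ K * (K * S) := by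
    have e1 : π₀ / π - 1 = π⁻¹ * (π₀ - π) := by
      have : π ≠ 0 := hK.dens_ne z c
      field_simp
    rw [e1, abs_mul]
    exact mul_le_mul (hK.dens z c) h1 (abs_nonneg _) hK0
  have h3 : |probA P b / η.margA b - 1| ≤ K * |η.margA b - probA P b| := by
    have e1 : probA P b / η.margA b - 1 = (η.margA b)⁻¹ * (probA P b - η.margA b) := by
      have := hK.marg_ne b hb
      field_simp
    rw [e1, abs_mul, abs_sub_comm (probA P b)]
    exact mul_le_mul_of_nonneg_right (hK.marg b hb) (abs_nonneg _)
  have hdZ : |p.pZ b z - η.pZ b z| = |η.pZ b z - p.pZ b z| := abs_sub_comm _ _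
  have t1 : |p.pC c * (π₀ / π - 1) * (p.e z c - η.e z c) * η.pZ b z| ≤ K ^ 3 * (de * S) := by
    rw [abs_mul, abs_mul, abs_mul, hde]
    calc _ ≤ 1 * (K * (K * S)) * de * K := by
          gcongr
          exact hK.pZ b hb z
      _ = _ := by ring
  have hK3 : K ≤ K ^ 3 := by nlinarith [mul_nonneg hK0 (sub_nonneg.2 hK1), sq_nonneg K]
  have hK13 : 1 ≤ K ^ 3 := hK1.trans hK3
  have t2 : |(probA P b / η.margA b - 1) * η.pC c * η.e z c| ≤ K ^ 3 * |η.margA b - probA P b| := by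
    rw [abs_mul, abs_mul]
    calc _ ≤ (K * |η.margA b - probA P b|) * K * K := by
          gcongr
          · exact hK.pC c
          · exact hK.e z c
      _ = _ := by ring
  have t3 : |(η.pC c - p.pC c) * η.e z c| ≤ K ^ 3 * |η.pC c - p.pC c| := by
    rw [abs_mul, mul_comm]
    exact mul_le_mul_of_nonneg_right ((hK.e z c).trans hK3) (abs_nonneg _)
  have t4 : |p.pC c * (η.e z c - p.e z c)| ≤ K ^ 3 * de := by
    rw [abs_mul]
    exact mul_le_mul_of_nonneg_right (hpC.trans hK13) (abs_nonneg _)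
  have t5 := (abs_add_le _ _).trans (add_le_add ((abs_add_le _ _).trans (add_le_add t2 t3)) t4)
  refine (abs_add_le _ _).trans ?_
  rw [abs_mul (p.pZ b z - η.pZ b z), hdZ]
  calc _ ≤ K ^ 3 * (de * S) + |η.pZ b z - p.pZ b z| * (K ^ 3 * |η.margA b - probA P b|
        + K ^ 3 * |η.pC c - p.pC c| + K ^ 3 * de) :=
        add_le_add t1 (mul_le_mul_of_nonneg_left t5 (abs_nonneg _))
    _ = _ := by
        rw [hS, Finset.mul_sum]
        simp only [mul_add]
        ring

variable [MeasurableSingletonClass 𝒞] [MeasurableSingletonClass 𝒜] [MeasurableSingletonClass 𝒵]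

theorem ObsModel.wellDefinedMean (h : ObsModel P θ) (astar a : 𝒜) (η : Nuisance 𝒞 𝒜 𝒵) :
    WellDefinedMean P astar a η := by
  have := h.prob
  exact ⟨memLp_one_iff_integrable.1 (memLp_mFun (memLp_one_iff_integrable.2 h.integrable) _ _ _),
    fun _ _ _ _ _ _ => Summable.of_finite⟩

/-- The bias of the estimating function. -/
theorem ObsModel.integral_mFun_sub (h : ObsModel P θ) (astar a : 𝒜) (η : Nuisance 𝒞 𝒜 𝒵) :
    ∫ x, mFun astar a η x ∂P - (θ astar - θ a) = drift P η astar - drift P η a := by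
  have h1 := (h.hasSum_integral_mFun (h.wellDefinedMean astar a η)).unique (hasSum_fintype _)
  rw [sub_eq_iff_eq_add, sub_eq_iff_eq_add] at h1
  rw [h1, ← h.eSum_true astar, ← h.eSum_true a]
  simp only [eSum, tsum_fintype (L := .unconditional _) (β := 𝒵 × 𝒞), drift, Finset.mul_sum,
    ← Finset.sum_add_distrib, ← Finset.sum_sub_distrib]
  refine Finset.sum_congr rfl fun zc _ => ?_
  ring

theorem ObsModel.abs_integral_mFun_sub_le (h : ObsModel P θ) {astar a : 𝒜} {η : Nuisance 𝒞 𝒜 𝒵}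
    {K : ℝ} (hK : NuisanceBound astar a η K) :
    |∫ x, mFun astar a η x ∂P - (θ astar - θ a)|
      ≤ K ^ 3 * (driftBound P η astar + driftBound P η a) := by
  rw [h.integral_mFun_sub, mul_add]
  exact (abs_sub _ _).trans (add_le_add (h.abs_drift_le hK (by simp)) (h.abs_drift_le hK (by simp)))

/-- A single atom already contributes its value times the root of its mass to the norm. Since all
masses are positive, rates in `L²` become rates at every point. -/
theorem abs_mul_sqrt_le_l2norm [IsProbabilityMeasure P] (f : 𝒞 → 𝒜 → 𝒵 → ℝ) (c : 𝒞) (b : 𝒜)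
    (z : 𝒵) :
    |f c b z| * √(P.real (atomSet (c, b, z)))
      ≤ l2norm P fun x : Obs 𝒞 𝒜 𝒵 => f x.1 x.2.1 x.2.2.1 := by
  have hm := measurableSet_atomSet (c, b, z)
  rw [l2norm, ← Real.sqrt_sq_eq_abs, ← Real.sqrt_mul (sq_nonneg _)]
  apply Real.sqrt_le_sqrt
  have h1 : ∫ x in atomSet (c, b, z), f x.1 x.2.1 x.2.2.1 ^ 2 ∂P
      = f c b z ^ 2 * P.real (atomSet (c, b, z)) := by
    rw [setIntegral_congr_fun (g := fun _ => f c b z ^ 2) hm fun x hx => by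
      simp only [hx.1, hx.2.1, hx.2.2]]
    simp [mul_comm]
  rw [← h1]
  exact setIntegral_le_integral (integrable_of_discrete fun c b z => f c b z ^ 2)
    (ae_of_all _ fun _ => sq_nonneg _)

/-- If the product of the `L²`-norms of two errors is negligible, so is the product of their values
at all points. -/
theorem ObsModel.isLittleOpOne_mul_abs (h : ObsModel P θ) {N : ℕ → ℕ}
    {f g : ∀ n, Data 𝒞 𝒜 𝒵 n (N n) → 𝒞 → 𝒜 → 𝒵 → ℝ} {r : ℕ → ℝ} (hr : ∀ n, 0 ≤ r n)
    (hfg : IsLittleOpOne (fun n => sampleLaw P n (N n)) fun n D => r n *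
      (l2norm P (fun x => f n D x.1 x.2.1 x.2.2.1) * l2norm P (fun x => g n D x.1 x.2.1 x.2.2.1)))
    (t s : 𝒞 × 𝒜 × 𝒵) :
    IsLittleOpOne (fun n => sampleLaw P n (N n)) fun n D => r n *
      (|f n D t.1 t.2.1 t.2.2| * |g n D s.1 s.2.1 s.2.2|) := by
  have := h.prob
  have hq : ∀ t : 𝒞 × 𝒜 × 𝒵, 0 < √(P.real (atomSet t)) := fun t =>
    Real.sqrt_pos.2 (h.pos t.1 t.2.1 t.2.2)
  refine (hfg.const_mul (√(P.real (atomSet t)) * √(P.real (atomSet s)))⁻¹).of_abs_le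
    (Eventually.of_forall fun n D => ?_)
  have h1 := abs_mul_sqrt_le_l2norm (P := P) (f n D) t.1 t.2.1 t.2.2
  have h2 := abs_mul_sqrt_le_l2norm (P := P) (g n D) s.1 s.2.1 s.2.2
  have h3 := mul_le_mul h1 h2 (by positivity) (Real.sqrt_nonneg _)
  have hr' := hr n
  rw [abs_of_nonneg (by positivity)]
  refine le_trans ?_ (le_abs_self _)
  rw [inv_mul_eq_div, le_div_iff₀ (mul_pos (hq t) (hq s))]
  calc _ = r n * ((|f n D t.1 t.2.1 t.2.2| * √(P.real (atomSet t)))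
        * (|g n D s.1 s.2.1 s.2.2| * √(P.real (atomSet s)))) := by ring
    _ ≤ _ := mul_le_mul_of_nonneg_left h3 hr'

theorem ObsModel.isLittleOpOne_driftBound (h : ObsModel P θ) {astar a : 𝒜} {N : ℕ → ℕ}
    {ηhat : ∀ n, Data 𝒞 𝒜 𝒵 n (N n) → Nuisance 𝒞 𝒜 𝒵} (hp : ProductRates P astar a N ηhat)
    {b : 𝒜} (hb : b ∈ ({astar, a} : Set 𝒜)) :
    IsLittleOpOne (fun n => sampleLaw P n (N n))
      fun n D => √(n : ℝ) * driftBound P (ηhat n D) b := by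
  have := h.prob
  set p := trueNuisance P with hpd
  have hr : ∀ n : ℕ, 0 ≤ √(n : ℝ) := fun n => Real.sqrt_nonneg _
  simp only [driftBound, Finset.mul_sum, mul_add]
  obtain ⟨⟨c₀⟩, ⟨b₀⟩, ⟨z₀⟩⟩ := h.nonempty
  refine IsLittleOpOne.sum _ fun zc _ => ((IsLittleOpOne.sum _ fun b' _ => ?_).add
    ((IsLittleOpOne.add ?_ ?_).add ?_))
  · refine IsLittleOpOne.add ?_ ?_
    · exact h.isLittleOpOne_mul_abs (f := fun n D c _ z => (ηhat n D).e z c - p.e z c)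
        (g := fun n D c b _ => (ηhat n D).pA c b - p.pA c b) hr hp.e_pA (zc.2, b', zc.1)
        (zc.2, b', zc.1)
    · exact h.isLittleOpOne_mul_abs (f := fun n D c _ z => (ηhat n D).e z c - p.e z c)
        (g := fun n D _ b z => (ηhat n D).pZ b z - p.pZ b z) hr hp.e_pZ (zc.2, b', zc.1)
        (zc.2, b', zc.1)
  · refine (h.isLittleOpOne_mul_abs (f := fun n D _ _ z => (ηhat n D).pZ b z - p.pZ b z)
      (g := fun n D _ _ _ => (ηhat n D).margA b - probA P b) hr ?_ (zc.2, b, zc.1)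
      (zc.2, b, zc.1))
    -- The margin error does not depend on the observation, so its norm is its absolute value.
    refine (hp.pZ_margA b hb).of_abs_le (Eventually.of_forall fun n D => le_of_eq ?_)
    have : l2norm P (fun _ => (ηhat n D).margA b - probA P b)
        = |(ηhat n D).margA b - probA P b| := by
      simp [l2norm, Real.sqrt_sq_eq_abs]
    rw [this]
  · exact h.isLittleOpOne_mul_abs (f := fun n D _ _ z => (ηhat n D).pZ b z - p.pZ b z)
      (g := fun n D c _ _ => (ηhat n D).pC c - p.pC c) hr (hp.pZ_pC b hb) (zc.2, b, zc.1)
      (zc.2, b, zc.1)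
  · exact h.isLittleOpOne_mul_abs (f := fun n D c _ z => (ηhat n D).e z c - p.e z c)
      (g := fun n D _ _ z => (ηhat n D).pZ b z - p.pZ b z) hr (hp.e_pZ_at b hb) (zc.2, b, zc.1)
      (zc.2, b, zc.1)

/-- The almost sure bound is a bound at all points, hence a countable intersection of measurable
events. This makes the passage to complements legitimate. -/
theorem ObsModel.tendsto_compl_zero (h : ObsModel P θ) {N : ℕ → ℕ}
    {q : ∀ n, Data 𝒞 𝒜 𝒵 n (N n) → 𝒞 → 𝒜 → 𝒵 → Prop}
    (hq : ∀ n c b z, MeasurableSet {D | q n D c b z})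
    (hw : WithProbTendingToOne (fun n => sampleLaw P n (N n))
      fun n => {D | ∀ᵐ x ∂P, q n D x.1 x.2.1 x.2.2.1}) :
    Tendsto (fun n => sampleLaw P n (N n) {D | ¬ ∀ c b z, q n D c b z}) atTop (𝓝 0) := by
  have := h.prob
  have e : ∀ n, {D | ∀ᵐ x ∂P, q n D x.1 x.2.1 x.2.2.1} = ⋂ c, ⋂ b, ⋂ z, {D | q n D c b z} :=
    fun n => by
      ext D
      simp only [Set.mem_iInter, Set.mem_ofPred_eq]
      exact h.ae_iff_forall
  have hm : ∀ n, MeasurableSet {D | ∀ᵐ x ∂P, q n D x.1 x.2.1 x.2.2.1} := fun n => by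
    rw [e]
    exact MeasurableSet.iInter fun c => MeasurableSet.iInter fun b => MeasurableSet.iInter fun z =>
      hq n c b z
  refine ((withProbTendingToOne_iff_compl hm).1 hw).congr fun n => ?_
  congr 1
  ext D
  simp only [Set.mem_compl_iff, Set.mem_ofPred_eq]
  exact not_congr h.ae_iff_forall

theorem tendsto_measure_union_zero {Ω : ℕ → Type*} [∀ n, MeasurableSpace (Ω n)]
    {μ : ∀ n, Measure (Ω n)} {A B : ∀ n, Set (Ω n)}
    (hA : Tendsto (fun n => μ n (A n)) atTop (𝓝 0)) (hB : Tendsto (fun n => μ n (B n)) atTop (𝓝 0)) :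
    Tendsto (fun n => μ n (A n ∪ B n)) atTop (𝓝 0) := by
  have := hA.add hB
  rw [add_zero] at this
  exact tendsto_of_tendsto_of_tendsto_of_le_of_le tendsto_const_nhds this (fun _ => zero_le)
    fun n => measure_union_le _ _

theorem tendsto_measure_iUnion_zero {ι : Type*} [Fintype ι] {Ω : ℕ → Type*}
    [∀ n, MeasurableSpace (Ω n)] {μ : ∀ n, Measure (Ω n)} {A : ι → ∀ n, Set (Ω n)}
    (hA : ∀ i, Tendsto (fun n => μ n (A i n)) atTop (𝓝 0)) :
    Tendsto (fun n => μ n (⋃ i, A i n)) atTop (𝓝 0) := by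
  have := tendsto_finsetSum Finset.univ fun i _ => hA i
  simp only [Finset.sum_const_zero] at this
  refine tendsto_of_tendsto_of_tendsto_of_le_of_le tendsto_const_nhds this (fun _ => zero_le)
    fun n => ?_
  exact measure_iUnion_fintype_le _ _

/-- Under the boundedness conditions, the estimated nuisance is bounded by a constant with
probability tending to one. -/
theorem ObsModel.exists_nuisanceBound (h : ObsModel P θ) {astar a : 𝒜} {N : ℕ → ℕ}
    {ηhat : ∀ n, Data 𝒞 𝒜 𝒵 n (N n) → Nuisance 𝒞 𝒜 𝒵} (hη : ∀ n, MeasurableNuisance (ηhat n))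
    (hb : Boundedness P astar a N ηhat) :
    ∃ K : ℝ, Tendsto (fun n => sampleLaw P n (N n) {D | ¬ NuisanceBound astar a (ηhat n D) K})
      atTop (𝓝 0) := by
  have := h.prob
  obtain ⟨⟨c₀⟩, ⟨b₀⟩, ⟨z₀⟩⟩ := h.nonempty
  obtain ⟨ε₁, h1⟩ := hb.e_hat_lt
  obtain ⟨ε₂, h2⟩ := hb.pZ_hat_lt
  obtain ⟨ε₃, p3, h3⟩ := hb.pZ_hat_gt
  obtain ⟨ε₄, h4⟩ := hb.pA_hat_lt
  obtain ⟨ε₅, p5, h5⟩ := hb.pA_hat_gt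
  obtain ⟨ε₆, p6, h6⟩ := hb.margA_hat_gt
  obtain ⟨ε₇, h7⟩ := hb.pC_hat_lt
  have mm : ∀ n b, Measurable fun D => (ηhat n D).margA b := fun n b => by
    simp only [Nuisance.margA, tsum_fintype]
    exact Finset.measurable_fun_sum _ fun c _ => ((hη n).pC c).mul ((hη n).pA c b)
  have k1 := h.tendsto_compl_zero (q := fun n D c _ z => |(ηhat n D).e z c| < ε₁)
    (fun n c b z => measurableSet_lt ((hη n).e z c).abs measurable_const) h1
  have k2 : ∀ b ∈ ({astar, a} : Set 𝒜), _ := fun b hb' =>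
    h.tendsto_compl_zero (q := fun n D _ _ z => |(ηhat n D).pZ b z| < ε₂)
    (fun n c b' z => measurableSet_lt ((hη n).pZ b z).abs measurable_const) (h2 b hb')
  have k3 := tendsto_measure_iUnion_zero fun b =>
    h.tendsto_compl_zero (q := fun n D _ _ z => ε₃ < (ηhat n D).pZ b z)
    (fun n c b' z => measurableSet_lt measurable_const ((hη n).pZ b z)) (h3 b)
  have k4 := h.tendsto_compl_zero (q := fun n D c b _ => |(ηhat n D).pA c b| < ε₄)
    (fun n c b z => measurableSet_lt ((hη n).pA c b).abs measurable_const) h4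
  have k5 := tendsto_measure_iUnion_zero fun b =>
    h.tendsto_compl_zero (q := fun n D c _ _ => ε₅ < (ηhat n D).pA c b)
    (fun n c b' z => measurableSet_lt measurable_const ((hη n).pA c b)) (h5 b)
  have k6 : ∀ b ∈ ({astar, a} : Set 𝒜), Tendsto (fun n => sampleLaw P n (N n)
      {D | ε₆ < (ηhat n D).margA b}ᶜ) atTop (𝓝 0) := fun b hb' =>
    (withProbTendingToOne_iff_compl fun n => measurableSet_lt measurable_const (mm n b)).1
      (h6 b hb')
  have k7 := h.tendsto_compl_zero (q := fun n D c _ _ => |(ηhat n D).pC c| < ε₇)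
    (fun n c b z => measurableSet_lt ((hη n).pC c).abs measurable_const) h7
  have kk := tendsto_measure_union_zero (tendsto_measure_union_zero (tendsto_measure_union_zero
    (tendsto_measure_union_zero k1 (k2 astar (by simp)))
      (tendsto_measure_union_zero (k2 a (by simp)) k3)) (tendsto_measure_union_zero k4 k5))
    (tendsto_measure_union_zero (tendsto_measure_union_zero (k6 astar (by simp)) (k6 a (by simp)))
      k7)
  -- The two reciprocals bound the inverse denominator, of which a single summand already exceeds
  -- `ε₅ ε₃`, and the inverse margin. The rest are the upper bounds on the estimates.
  set K := 1 + |ε₁| + |ε₂| + |ε₄| + |ε₇| + (ε₅ * ε₃)⁻¹ + ε₆⁻¹ with hK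
  have q1 := abs_nonneg ε₁
  have q2 := abs_nonneg ε₂
  have q4 := abs_nonneg ε₄
  have q7 := abs_nonneg ε₇
  have q5 : 0 < (ε₅ * ε₃)⁻¹ := by positivity
  have q6 : 0 < ε₆⁻¹ := by positivity
  refine ⟨K, tendsto_of_tendsto_of_tendsto_of_le_of_le tendsto_const_nhds kk (fun _ => zero_le)
    fun n => measure_mono fun D hD => ?_⟩
  by_contra hc
  simp only [Set.mem_union, not_or, Set.mem_iUnion, not_exists, Set.mem_ofPred_eq, not_not,
    Set.mem_compl_iff] at hc
  obtain ⟨⟨⟨⟨r1, r2⟩, r2', r3⟩, r4, r5⟩, ⟨r6, r6'⟩, r7⟩ := hc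
  have hdens : ∀ z c, ε₅ * ε₃ < ∑' b, (ηhat n D).pA c b * (ηhat n D).pZ b z := fun z c => by
    rw [tsum_fintype]
    have hpos : ∀ b, ε₅ * ε₃ < (ηhat n D).pA c b * (ηhat n D).pZ b z := fun b =>
      mul_lt_mul'' (r5 b c b₀ z₀) (r3 b c₀ b₀ z) p5.le p3.le
    refine (hpos b₀).trans_le (Finset.single_le_sum (f := fun b =>
      (ηhat n D).pA c b * (ηhat n D).pZ b z) (fun b _ => ?_) (Finset.mem_univ b₀))
    exact ((mul_pos p5 p3).trans (hpos b)).le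
  have hinv : ∀ {x ε : ℝ}, 0 < ε → ε < x → |x⁻¹| ≤ ε⁻¹ := fun {x ε} hε hx => by
    rw [abs_of_pos (inv_pos.2 (hε.trans hx))]
    exact inv_anti₀ hε hx.le
  refine hD ⟨by linarith, fun z c => ?_, ?_, fun c b => ?_, fun c => ?_, fun z c => ?_,
    fun z c => ?_, ?_, ?_⟩
  · linarith [r1 c b₀ z, le_abs_self ε₁]
  · rintro b (rfl | rfl) z
    · linarith [r2 c₀ b₀ z, le_abs_self ε₂]
    · linarith [r2' c₀ b₀ z, le_abs_self ε₂]
  · linarith [r4 c b z₀, le_abs_self ε₄]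
  · linarith [r7 c b₀ z₀, le_abs_self ε₇]
  · exact ((mul_pos p5 p3).trans (hdens z c)).ne'
  · linarith [hinv (mul_pos p5 p3) (hdens z c)]
  · rintro b (rfl | rfl)
    · exact (p6.trans r6).ne'
    · exact (p6.trans r6').ne'
  · rintro b (rfl | rfl)
    · linarith [hinv p6 r6]
    · linarith [hinv p6 r6']

/-- Asymptotic linearity of the solution of the estimating equation. -/
theorem ObsModel.asympLinear (h : ObsModel P θ) {astar a : 𝒜} {N : ℕ → ℕ}
    {ηhat : ∀ n, Data 𝒞 𝒜 𝒵 n (N n) → Nuisance 𝒞 𝒜 𝒵} (hη : ∀ n, MeasurableNuisance (ηhat n))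
    {T : ∀ n, Data 𝒞 𝒜 𝒵 n (N n) → ℝ} (hT : SolvesEstimatingEquation astar a N ηhat T)
    (hY : MemLp (fun x : Obs 𝒞 𝒜 𝒵 => x.2.2.2) 2 P)
    (hb : Boundedness P astar a N ηhat)
    (hl : IsLittleOpOne (fun n => sampleLaw P n (N n))
      (fun n D => l2norm P (fun x => mFun astar a (ηhat n D) x -
          mFun astar a (trueNuisance P) x) ^ 2))
    (hp : ProductRates P astar a N ηhat) :
    AsympLinear P (θ astar - θ a) N T (phi astar a (trueNuisance P) (θ astar - θ a)) := by
  have := h.prob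
  have hmean : ∫ x, mFun astar a (trueNuisance P) x ∂P = θ astar - θ a :=
    h.integral_mFun_of_correctlySpecified (h.wellDefinedMean astar a _)
      (Or.inl ⟨rfl, rfl, rfl⟩)
  have hmem : ∀ η, MemLp (mFun astar a η) 2 P := fun η => memLp_mFun hY astar a η
  have hint : ∀ η, Integrable (mFun astar a η) P := fun η => (hmem η).integrable one_le_two
  refine ⟨(hmem _).sub (memLp_const _), ?_, ?_⟩
  · simp only [phi]
    rw [integral_sub (hint _) (integrable_const _), hmean]
    simp
  · have hl' : IsLittleOpOne (fun n => sampleLaw P n (N n)) fun n D =>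
        l2norm P (fun x => mFun astar a (ηhat n D) x - mFun astar a (trueNuisance P) x) := by
      refine hl.sqrt.of_abs_le (Eventually.of_forall fun n D => le_of_eq ?_)
      rw [Real.sqrt_sq_eq_abs, abs_abs]
    -- The empirical process of `m(·, η̂) - m(·, η₀)`, negligible by equicontinuity.
    have e1 := isLittleOpOne_empProc_of_l2norm hY (fun t => h.pos t.1 t.2.1 t.2.2) (N := N)
      (F := fun n D x => mFun astar a (ηhat n D) x - mFun astar a (trueNuisance P) x)
      (s := fun n D t => mSlope astar a (ηhat n D) t - mSlope astar a (trueNuisance P) t)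
      (w := fun n D t => mBase astar a (ηhat n D) t - mBase astar a (trueNuisance P) t)
      (fun n D x => by
        rw [mFun_eq_slope_base, mFun_eq_slope_base astar a (trueNuisance P)]; ring) hl'
    obtain ⟨K, hK⟩ := h.exists_nuisanceBound hη hb
    -- The scaled bias of `m(·, η̂)`, negligible by the product rates on the event where the
    -- nuisance bound holds. Adding `e1` gives exactly the remainder of the expansion.
    have e2 : IsLittleOpOne (fun n => sampleLaw P n (N n)) fun n D => √(n : ℝ) *
        (∫ x, mFun astar a (ηhat n D) x ∂P - (θ astar - θ a)) := by
      refine (((h.isLittleOpOne_driftBound hp (b := astar) (by simp)).add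
        (h.isLittleOpOne_driftBound hp (b := a) (by simp))).const_mul
          (K ^ 3)).of_abs_le_of_notMem hK (Eventually.of_forall fun n D hD => ?_)
      simp only [Set.mem_ofPred_eq, not_not] at hD
      refine le_trans ?_ (le_abs_self _)
      rw [abs_mul, abs_of_nonneg (Real.sqrt_nonneg _)]
      calc _ ≤ √(n : ℝ) * (K ^ 3 * (driftBound P (ηhat n D) astar
            + driftBound P (ηhat n D) a)) := by
            gcongr
            exact h.abs_integral_mFun_sub_le hD
        _ = _ := by ring
    refine (e1.add e2).of_abs_le ?_
    filter_upwards [eventually_ne_atTop 0] with n hn D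
    refine le_of_eq (congrArg abs ?_)
    have hn0 : (0 : ℝ) < n := by positivity
    have hsq : (√(n : ℝ))⁻¹ = √(n : ℝ) * (n : ℝ)⁻¹ := by
      rw [inv_eq_iff_eq_inv, mul_inv, inv_inv, ← div_eq_inv_mul, Real.div_sqrt]
    rw [hT.eq_average hn, empProc, integral_sub (hint _) (hint _), hmean, hsq]
    simp only [phi, Finset.sum_sub_distrib, Finset.sum_const, Finset.card_univ, Fintype.card_fin,
      nsmul_eq_mul]
    field_simp
    ring

end Drift

end TripleDoor

/-! ### Hellinger estimates for pairs of laws and local paths. -/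

namespace TripleDoor

section DensityPair

variable {𝓧 : Type*} [MeasurableSpace 𝓧] {ν P Q : Measure 𝓧} {p q : 𝓧 → ℝ}

theorem integrable_withDensity_ofReal_iff (hp : Measurable p) (h0 : ∀ x, 0 ≤ p x) {E : Type*}
    [NormedAddCommGroup E] [NormedSpace ℝ E] {g : 𝓧 → E} :
    Integrable g (ν.withDensity fun x => ENNReal.ofReal (p x))
      ↔ Integrable (fun x => p x • g x) ν := by
  rw [integrable_withDensity_iff_integrable_smul' hp.ennreal_ofReal
    (ae_of_all _ fun _ => ENNReal.ofReal_lt_top)]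
  simp only [ENNReal.toReal_ofReal (h0 _)]

theorem integral_withDensity_ofReal (hp : Measurable p) (h0 : ∀ x, 0 ≤ p x) {E : Type*}
    [NormedAddCommGroup E] [NormedSpace ℝ E] (g : 𝓧 → E) :
    ∫ x, g x ∂(ν.withDensity fun x => ENNReal.ofReal (p x)) = ∫ x, p x • g x ∂ν := by
  rw [integral_withDensity_eq_integral_toReal_smul hp.ennreal_ofReal
    (ae_of_all _ fun _ => ENNReal.ofReal_lt_top)]
  simp only [ENNReal.toReal_ofReal (h0 _)]

/-- The Cauchy-Schwarz inequality. -/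
theorem integral_abs_mul_le_sqrt {f g : 𝓧 → ℝ} (hf : MemLp f 2 ν) (hg : MemLp g 2 ν) :
    ∫ x, |f x * g x| ∂ν ≤ √(∫ x, f x ^ 2 ∂ν) * √(∫ x, g x ^ 2 ∂ν) := by
  have h := integral_mul_le_Lp_mul_Lq_of_nonneg (μ := ν) (p := 2) (q := 2)
    (by constructor <;> norm_num)
    (ae_of_all _ fun x => abs_nonneg (f x)) (ae_of_all _ fun x => abs_nonneg (g x))
    (by rw [show ENNReal.ofReal (2 : ℝ) = 2 by simp]; exact hf.abs)
    (by rw [show ENNReal.ofReal (2 : ℝ) = 2 by simp]; exact hg.abs)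
  simp only [abs_mul]
  refine h.trans (le_of_eq ?_)
  simp [Real.sqrt_eq_rpow]

/-- Two laws with densities with respect to a common measure. -/
structure DensityPair (ν P Q : Measure 𝓧) (p q : 𝓧 → ℝ) : Prop where
  prob_left : IsProbabilityMeasure P
  prob_right : IsProbabilityMeasure Q
  left_eq : P = ν.withDensity fun x => ENNReal.ofReal (p x)
  right_eq : Q = ν.withDensity fun x => ENNReal.ofReal (q x)
  measurable_left : Measurable p
  measurable_right : Measurable q
  left_nonneg : ∀ x, 0 ≤ p x
  right_nonneg : ∀ x, 0 ≤ q x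

/-- The difference of the root densities. -/
noncomputable def rootDiff (p q : 𝓧 → ℝ) (x : 𝓧) : ℝ := √(q x) - √(p x)

namespace DensityPair

theorem symm (h : DensityPair ν P Q p q) : DensityPair ν Q P q p :=
  ⟨h.2, h.1, h.4, h.3, h.6, h.5, h.8, h.7⟩

theorem integrable_iff (h : DensityPair ν P Q p q) {E : Type*} [NormedAddCommGroup E]
    [NormedSpace ℝ E] {g : 𝓧 → E} : Integrable g P ↔ Integrable (fun x => p x • g x) ν := by
  rw [h.left_eq, integrable_withDensity_ofReal_iff h.measurable_left h.left_nonneg]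

theorem integral_eq (h : DensityPair ν P Q p q) {E : Type*} [NormedAddCommGroup E]
    [NormedSpace ℝ E] (g : 𝓧 → E) : ∫ x, g x ∂P = ∫ x, p x • g x ∂ν := by
  conv_lhs => rw [h.left_eq]
  exact integral_withDensity_ofReal h.measurable_left h.left_nonneg g

theorem integrable_left (h : DensityPair ν P Q p q) : Integrable p ν := by
  have := h.prob_left
  simpa using h.integrable_iff.1 (integrable_const (1 : ℝ))

theorem setIntegral_left (h : DensityPair ν P Q p q) {E : Set 𝓧} (hE : MeasurableSet E) :
    ∫ x in E, p x ∂ν = P.real E := by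
  have h1 := h.integral_eq (E.indicator fun _ => (1 : ℝ))
  rw [integral_indicator hE] at h1
  simp only [integral_const, measureReal_restrict_apply_univ, smul_eq_mul, mul_one] at h1
  rw [h1, ← integral_indicator hE]
  congr 1
  ext x
  by_cases hx : x ∈ E <;> simp [hx]

theorem measurable_rootDiff (h : DensityPair ν P Q p q) : Measurable (rootDiff p q) :=
  h.measurable_right.sqrt.sub h.measurable_left.sqrt

theorem rootDiff_sq_le (h : DensityPair ν P Q p q) (x : 𝓧) :
    rootDiff p q x ^ 2 ≤ 2 * (p x + q x) := by
  have h1 := Real.sq_sqrt (h.left_nonneg x)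
  have h2 := Real.sq_sqrt (h.right_nonneg x)
  unfold rootDiff
  nlinarith [sq_nonneg (√(q x) + √(p x))]

theorem integrable_rootDiff_sq (h : DensityPair ν P Q p q) :
    Integrable (fun x => rootDiff p q x ^ 2) ν := by
  refine Integrable.mono' ((h.integrable_left.add h.symm.integrable_left).const_mul 2)
    (h.measurable_rootDiff.pow_const 2).aestronglyMeasurable (ae_of_all _ fun x => ?_)
  rw [Real.norm_of_nonneg (sq_nonneg _)]
  exact h.rootDiff_sq_le x

theorem memLp_rootDiff (h : DensityPair ν P Q p q) : MemLp (rootDiff p q) 2 ν :=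
  (memLp_two_iff_integrable_sq h.measurable_rootDiff.aestronglyMeasurable).2
    h.integrable_rootDiff_sq

theorem abs_sub_le (h : DensityPair ν P Q p q) (x : 𝓧) :
    |q x - p x| ≤ 2 * √(p x) * |rootDiff p q x| + rootDiff p q x ^ 2 := by
  have h1 := Real.sq_sqrt (h.left_nonneg x)
  have h2 := Real.sq_sqrt (h.right_nonneg x)
  have e : q x - p x = 2 * √(p x) * rootDiff p q x + rootDiff p q x ^ 2 := by
    unfold rootDiff
    nlinarith
  rw [e]
  refine (abs_add_le _ _).trans (le_of_eq ?_)
  rw [abs_mul, abs_of_nonneg (by positivity : 0 ≤ 2 * √(p x)),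
    abs_of_nonneg (sq_nonneg (rootDiff p q x))]

variable {f : 𝓧 → ℝ}

theorem integrable_sq_mul (h : DensityPair ν P Q p q) (hP : MemLp f 2 P) (hQ : MemLp f 2 Q) :
    Integrable (fun x => f x ^ 2 * (2 * (p x + q x))) ν := by
  have h1 := h.integrable_iff.1 hP.integrable_sq
  have h2 := h.symm.integrable_iff.1 hQ.integrable_sq
  refine ((h1.add h2).const_mul 2).congr (ae_of_all _ fun x => ?_)
  simp only [Pi.add_apply, smul_eq_mul]
  ring

theorem integral_sq_mul (h : DensityPair ν P Q p q) (hP : MemLp f 2 P) (hQ : MemLp f 2 Q) :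
    ∫ x, f x ^ 2 * (2 * (p x + q x)) ∂ν = 2 * (∫ x, f x ^ 2 ∂P + ∫ x, f x ^ 2 ∂Q) := by
  have h1 := h.integrable_iff.1 hP.integrable_sq
  have h2 := h.symm.integrable_iff.1 hQ.integrable_sq
  rw [h.integral_eq, h.symm.integral_eq, ← integral_add h1 h2, ← integral_const_mul]
  congr 1
  ext x
  simp only [smul_eq_mul]
  ring

/-- If `w² ≤ 2(p + q)`, then `f w` is square integrable, with the natural bound. -/
theorem memLp_mul (h : DensityPair ν P Q p q) (hf : Measurable f) (hP : MemLp f 2 P)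
    (hQ : MemLp f 2 Q) {w : 𝓧 → ℝ} (hw : Measurable w) (hw2 : ∀ x, w x ^ 2 ≤ 2 * (p x + q x)) :
    MemLp (fun x => f x * w x) 2 ν ∧
      ∫ x, (f x * w x) ^ 2 ∂ν ≤ 2 * (∫ x, f x ^ 2 ∂P + ∫ x, f x ^ 2 ∂Q) := by
  have hle : ∀ x, (f x * w x) ^ 2 ≤ f x ^ 2 * (2 * (p x + q x)) := fun x => by
    rw [mul_pow]
    exact mul_le_mul_of_nonneg_left (hw2 x) (sq_nonneg _)
  have hi : Integrable (fun x => (f x * w x) ^ 2) ν := by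
    refine (h.integrable_sq_mul hP hQ).mono' ((hf.mul hw).pow_const 2).aestronglyMeasurable
      (ae_of_all _ fun x => ?_)
    rw [Real.norm_of_nonneg (sq_nonneg _)]
    exact hle x
  refine ⟨(memLp_two_iff_integrable_sq (hf.mul hw).aestronglyMeasurable).2 hi, ?_⟩
  rw [← h.integral_sq_mul hP hQ]
  exact integral_mono hi (h.integrable_sq_mul hP hQ) hle

theorem norm_integral_sub_le_integral (h : DensityPair ν P Q p q) {E : Type*}
    [NormedAddCommGroup E] [NormedSpace ℝ E] {g : 𝓧 → E} (hP : Integrable g P)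
    (hQ : Integrable g Q) :
    ‖∫ x, g x ∂Q - ∫ x, g x ∂P‖ ≤ ∫ x, |q x - p x| * ‖g x‖ ∂ν := by
  rw [h.integral_eq, h.symm.integral_eq,
    ← integral_sub (h.symm.integrable_iff.1 hQ) (h.integrable_iff.1 hP)]
  refine (norm_integral_le_integral_norm _).trans (le_of_eq ?_)
  congr 1
  ext x
  rw [← sub_smul, norm_smul, Real.norm_eq_abs]

/-- Means under two laws differ by at most a multiple of the Hellinger distance. -/
theorem abs_integral_sub_le (h : DensityPair ν P Q p q) (hf : Measurable f) (hP : MemLp f 2 P)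
    (hQ : MemLp f 2 Q) :
    |∫ x, f x ∂Q - ∫ x, f x ∂P| ≤ √(2 * (∫ x, f x ^ 2 ∂P + ∫ x, f x ^ 2 ∂Q))
      * √(∫ x, rootDiff p q x ^ 2 ∂ν) := by
  have := h.prob_left
  have := h.prob_right
  obtain ⟨hm, hle⟩ := h.memLp_mul hf hP hQ (w := fun x => √(q x) + √(p x))
    (h.measurable_right.sqrt.add h.measurable_left.sqrt) fun x => by
      have h1 := Real.sq_sqrt (h.left_nonneg x)
      have h2 := Real.sq_sqrt (h.right_nonneg x)
      nlinarith [sq_nonneg (√(q x) - √(p x))]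
  refine (h.norm_integral_sub_le_integral (hP.integrable one_le_two)
    (hQ.integrable one_le_two)).trans ?_
  -- The factorisation `q - p = (√q + √p)(√q - √p)` prepares Cauchy-Schwarz.
  have e : ∀ x, |q x - p x| * ‖f x‖ = |(f x * (√(q x) + √(p x))) * rootDiff p q x| := fun x => by
    have h1 := Real.sq_sqrt (h.left_nonneg x)
    have h2 := Real.sq_sqrt (h.right_nonneg x)
    rw [Real.norm_eq_abs, ← abs_mul]
    congr 1
    have e3 : q x - p x = (√(q x) + √(p x)) * (√(q x) - √(p x)) := by nlinarith
    rw [rootDiff, e3]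
    ring
  simp_rw [e]
  refine (integral_abs_mul_le_sqrt hm h.memLp_rootDiff).trans ?_
  gcongr

/-- Cauchy-Schwarz for `f · rootDiff` against `rootDiff`. The set `E` is kept in the second factor,
where the negligibility condition of a local path can act. -/
theorem integral_abs_mul_rootDiff_sq (h : DensityPair ν P Q p q) (hf : Measurable f)
    (hP : MemLp f 2 P) (hQ : MemLp f 2 Q) (E : Set 𝓧) :
    Integrable (fun x => |f x| * rootDiff p q x ^ 2) ν ∧
    ∫ x in E, |f x| * rootDiff p q x ^ 2 ∂ν ≤ √(2 * (∫ x, f x ^ 2 ∂P + ∫ x, f x ^ 2 ∂Q))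
      * √(∫ x in E, rootDiff p q x ^ 2 ∂ν) := by
  obtain ⟨hm, hle⟩ := h.memLp_mul hf hP hQ h.measurable_rootDiff h.rootDiff_sq_le
  have e : ∀ x, |f x| * rootDiff p q x ^ 2 = |(f x * rootDiff p q x) * rootDiff p q x| := fun x => by
    rw [mul_assoc, ← pow_two, abs_mul, abs_of_nonneg (sq_nonneg (rootDiff p q x))]
  simp_rw [e]
  refine ⟨(hm.integrable_mul h.memLp_rootDiff).abs, ?_⟩
  refine (integral_abs_mul_le_sqrt (ν := ν.restrict E) (hm.restrict E)
    (h.memLp_rootDiff.restrict E)).trans ?_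
  gcongr
  exact (setIntegral_le_integral hm.integrable_sq (ae_of_all _ fun _ => sq_nonneg _)).trans hle

/-- From `q - p = 2√p (√q - √p) + (√q - √p)²`. In contrast with `abs_integral_sub_le`, the
first-order term involves only the second moment under the fixed law `P`, which dominated
convergence can make small. -/
theorem norm_integral_sub_le (h : DensityPair ν P Q p q) {g : 𝓧 → ℂ} (hg : Measurable g)
    (hP : MemLp g 2 P) (hQ : MemLp g 2 Q) :
    ‖∫ x, g x ∂Q - ∫ x, g x ∂P‖ ≤ 2 * (√(∫ x, ‖g x‖ ^ 2 ∂P) * √(∫ x, rootDiff p q x ^ 2 ∂ν))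
      + ∫ x, ‖g x‖ * rootDiff p q x ^ 2 ∂ν := by
  have := h.prob_left
  have := h.prob_right
  refine (h.norm_integral_sub_le_integral (hP.integrable one_le_two)
    (hQ.integrable one_le_two)).trans ?_
  have i1 := (h.integral_abs_mul_rootDiff_sq hg.norm hP.norm hQ.norm Set.univ).1
  simp only [abs_norm] at i1
  have hmp : MemLp (fun x => √(p x) * ‖g x‖) 2 ν := by
    refine (memLp_two_iff_integrable_sq
      (h.measurable_left.sqrt.mul hg.norm).aestronglyMeasurable).2 ?_
    refine (h.integrable_iff.1 hP.norm.integrable_sq).congr (ae_of_all _ fun x => ?_)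
    change p x * ‖g x‖ ^ 2 = (√(p x) * ‖g x‖) ^ 2
    rw [mul_pow, Real.sq_sqrt (h.left_nonneg x)]
  have e1 : ∫ x, (√(p x) * ‖g x‖) ^ 2 ∂ν = ∫ x, ‖g x‖ ^ 2 ∂P := by
    rw [h.integral_eq]
    simp only [mul_pow, Real.sq_sqrt (h.left_nonneg _), smul_eq_mul]
  have i2 : Integrable (fun x => |(√(p x) * ‖g x‖) * rootDiff p q x|) ν :=
    (hmp.integrable_mul h.memLp_rootDiff).abs
  calc _ ≤ ∫ x, (2 * |(√(p x) * ‖g x‖) * rootDiff p q x| + ‖g x‖ * rootDiff p q x ^ 2) ∂ν := by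
        refine integral_mono_of_nonneg (ae_of_all _ fun x => by positivity)
          ((i2.const_mul 2).add i1) (ae_of_all _ fun x => ?_)
        have h1 := mul_le_mul_of_nonneg_right (h.abs_sub_le x) (norm_nonneg (g x))
        refine h1.trans (le_of_eq ?_)
        simp only
        rw [abs_mul, abs_mul, abs_of_nonneg (Real.sqrt_nonneg (p x)), abs_norm]
        ring
    _ = 2 * ∫ x, |(√(p x) * ‖g x‖) * rootDiff p q x| ∂ν
        + ∫ x, ‖g x‖ * rootDiff p q x ^ 2 ∂ν := by
        rw [integral_add (i2.const_mul 2) i1, integral_const_mul]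
    _ ≤ _ := by
        gcongr
        rw [← e1]
        exact integral_abs_mul_le_sqrt hmp h.memLp_rootDiff

end DensityPair

/-- A sequence of laws at Hellinger distance `O(n^{-1/2})` from `P`, whose root density
differences, rescaled by `√n`, are uniformly square integrable relative to `P`. -/
structure LocalPath (ν P : Measure 𝓧) (Q : ℕ → Measure 𝓧) (p : 𝓧 → ℝ) (q : ℕ → 𝓧 → ℝ) : Prop where
  pair : ∀ n, DensityPair ν P (Q n) p (q n)
  bound : ∃ C : ℝ, ∀ n : ℕ, n * ∫ x, rootDiff p (q n) x ^ 2 ∂ν ≤ C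
  negligible : ∀ E : ℕ → Set 𝓧, (∀ n, MeasurableSet (E n)) →
    Tendsto (fun n => P (E n)) atTop (𝓝 0) →
    Tendsto (fun n : ℕ => n * ∫ x in E n, rootDiff p (q n) x ^ 2 ∂ν) atTop (𝓝 0)

namespace LocalPath

variable {Q : ℕ → Measure 𝓧} {q : ℕ → 𝓧 → ℝ} {f : 𝓧 → ℝ}

theorem sqrt_mul_sqrt_le (h : LocalPath ν P Q p q) : ∃ C : ℝ, 0 ≤ C ∧ ∀ n : ℕ,
    √(n : ℝ) * √(∫ x, rootDiff p (q n) x ^ 2 ∂ν) ≤ C := by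
  obtain ⟨C, hC⟩ := h.bound
  refine ⟨√C, Real.sqrt_nonneg _, fun n => ?_⟩
  rw [← Real.sqrt_mul (Nat.cast_nonneg n)]
  exact Real.sqrt_le_sqrt (hC n)

/-- Means of functions with bounded second moments differ by `O(n^{-1/2})`. -/
theorem integral_sub_isBigO (h : LocalPath ν P Q p q) (hf : Measurable f) (hP : MemLp f 2 P)
    (hQ : ∀ n, MemLp f 2 (Q n)) {K : ℝ} (hK : ∀ n, ∫ x, f x ^ 2 ∂(Q n) ≤ K) :
    ∃ C : ℝ, ∀ n : ℕ, √(n : ℝ) * |∫ x, f x ∂(Q n) - ∫ x, f x ∂P| ≤ C := by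
  obtain ⟨C, hC0, hC⟩ := h.sqrt_mul_sqrt_le
  refine ⟨√(2 * (∫ x, f x ^ 2 ∂P + K)) * C, fun n => ?_⟩
  calc _ ≤ √(n : ℝ) * (√(2 * (∫ x, f x ^ 2 ∂P + ∫ x, f x ^ 2 ∂(Q n)))
        * √(∫ x, rootDiff p (q n) x ^ 2 ∂ν)) := by
        gcongr
        exact (h.pair n).abs_integral_sub_le hf hP (hQ n)
    _ = √(2 * (∫ x, f x ^ 2 ∂P + ∫ x, f x ^ 2 ∂(Q n)))
        * (√(n : ℝ) * √(∫ x, rootDiff p (q n) x ^ 2 ∂ν)) := by ring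
    _ ≤ _ := by
        gcongr
        · exact hK n
        · exact hC n

/-- Truncation of `|f|` at `κₙ = n^{1/4}`. Below the level, `√n κₙ = n / κₙ` and the squared
Hellinger distance is `O(1/n)`. Above it, the event has vanishing `P`-probability by Markov, so
Cauchy-Schwarz and negligibility apply. Bounded second moments under `Qₙ` thus suffice, without
uniform integrability of `f²`. -/
theorem tendsto_sqrt_integral_abs_mul (h : LocalPath ν P Q p q) (hf : Measurable f)
    (hP : MemLp f 2 P) (hQ : ∀ n, MemLp f 2 (Q n)) {K : ℝ} (hK : ∀ n, ∫ x, f x ^ 2 ∂(Q n) ≤ K) :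
    Tendsto (fun n : ℕ => √(n : ℝ) * ∫ x, |f x| * rootDiff p (q n) x ^ 2 ∂ν) atTop (𝓝 0) := by
  have := (h.pair 0).prob_left
  obtain ⟨C, hC⟩ := h.bound
  set κ : ℕ → ℝ := fun n => √√(n : ℝ) with hκ
  have hκt : Tendsto κ atTop atTop := Real.tendsto_sqrt_atTop.comp
    (Real.tendsto_sqrt_atTop.comp tendsto_natCast_atTop_atTop)
  have hκsq : ∀ n, κ n * κ n = √(n : ℝ) := fun n => Real.mul_self_sqrt (Real.sqrt_nonneg _)
  set E : ℕ → Set 𝓧 := fun n => {x | κ n < |f x|} with hE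
  have hEm : ∀ n, MeasurableSet (E n) := fun n => measurableSet_lt measurable_const hf.abs
  have hEP : Tendsto (fun n => P (E n)) atTop (𝓝 0) := by
    have h1 : Tendsto (fun n => (∫⁻ x, ‖f x‖ₑ ∂P) / ENNReal.ofReal (κ n)) atTop (𝓝 0) := by
      have h2 : Tendsto (fun n => ENNReal.ofReal (κ n)) atTop (𝓝 ⊤) :=
        ENNReal.tendsto_ofReal_nhds_top.2 hκt
      have h3 := ENNReal.Tendsto.const_div h2 (a := ∫⁻ x, ‖f x‖ₑ ∂P)
        (Or.inr (hP.integrable one_le_two).2.ne)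
      simpa using h3
    refine tendsto_of_tendsto_of_tendsto_of_le_of_le' tendsto_const_nhds h1
      (Eventually.of_forall fun _ => zero_le) ?_
    filter_upwards [hκt.eventually_gt_atTop 0] with n hn
    rw [ENNReal.le_div_iff_mul_le (Or.inl (by simpa using hn)) (Or.inl ENNReal.ofReal_ne_top),
      mul_comm]
    refine le_trans (mul_le_mul_right (measure_mono fun x hx => ?_) _)
      (mul_meas_ge_le_lintegral₀ hf.enorm.aemeasurable _)
    change ENNReal.ofReal (κ n) ≤ ‖f x‖ₑ
    rw [Real.enorm_eq_ofReal_abs]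
    exact ENNReal.ofReal_le_ofReal (le_of_lt hx)
  have hneg := h.negligible E hEm hEP
  set B := √(2 * (∫ x, f x ^ 2 ∂P + K))
  have hlim : Tendsto (fun n : ℕ => B * √(n * ∫ x in E n, rootDiff p (q n) x ^ 2 ∂ν)
      + (κ n)⁻¹ * C) atTop (𝓝 0) := by
    have h1 := (hneg.sqrt.const_mul B).add (hκt.inv_tendsto_atTop.mul_const C)
    simpa using h1
  refine tendsto_of_tendsto_of_tendsto_of_le_of_le' tendsto_const_nhds hlim
    (Eventually.of_forall fun n => by positivity) ?_
  filter_upwards [hκt.eventually_gt_atTop 0] with n hn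
  obtain ⟨hi, hle⟩ := (h.pair n).integral_abs_mul_rootDiff_sq hf hP (hQ n) (E n)
  have hi2 := (h.pair n).integrable_rootDiff_sq
  rw [← integral_add_compl (hEm n) hi, mul_add]
  refine add_le_add ?_ ?_
  · rw [Real.sqrt_mul (Nat.cast_nonneg n), mul_left_comm]
    refine mul_le_mul_of_nonneg_left (hle.trans ?_) (Real.sqrt_nonneg _)
    refine mul_le_mul_of_nonneg_right (Real.sqrt_le_sqrt ?_) (Real.sqrt_nonneg _)
    linarith [hK n]
  · have h1 : ∫ x in (E n)ᶜ, |f x| * rootDiff p (q n) x ^ 2 ∂ν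
        ≤ κ n * ∫ x, rootDiff p (q n) x ^ 2 ∂ν := by
      rw [← integral_const_mul]
      refine (setIntegral_mono_on hi.integrableOn (hi2.const_mul (κ n)).integrableOn
        (hEm n).compl fun x hx => ?_).trans (setIntegral_le_integral (hi2.const_mul _)
          (ae_of_all _ fun x => mul_nonneg hn.le (sq_nonneg _)))
      refine mul_le_mul_of_nonneg_right ?_ (sq_nonneg _)
      simpa [hE] using hx
    calc _ ≤ √(n : ℝ) * (κ n * ∫ x, rootDiff p (q n) x ^ 2 ∂ν) := by gcongr
      _ = (κ n)⁻¹ * ((κ n * κ n * (κ n * κ n)) * ∫ x, rootDiff p (q n) x ^ 2 ∂ν) := by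
          rw [← hκsq]; field_simp
      _ ≤ _ := by
          rw [hκsq, Real.mul_self_sqrt (Nat.cast_nonneg n)]
          gcongr
          exact hC n

end LocalPath

end DensityPair

end TripleDoor

/-! ### Characteristic functions along a local path. -/

namespace TripleDoor

/-- The second order remainder `e^{iu} - 1 - iu`. -/
noncomputable def expRem (u : ℝ) : ℂ := Complex.exp (Complex.I * u) - 1 - Complex.I * u

theorem continuous_expRem : Continuous expRem := by
  unfold expRem; fun_prop

theorem norm_expRem_le (u : ℝ) : ‖expRem u‖ ≤ 2 * |u| := by
  unfold expRem
  refine (norm_sub_le _ _).trans ?_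
  have h1 := Real.norm_exp_I_mul_ofReal_sub_one_le (x := u)
  have h2 : ‖Complex.I * (u : ℂ)‖ = |u| := by simp
  rw [Real.norm_eq_abs] at h1
  linarith

theorem norm_expRem_le_sq (u : ℝ) : ‖expRem u‖ ≤ 2 * u ^ 2 := by
  have h2 : ‖Complex.I * (u : ℂ)‖ = |u| := by simp
  rcases le_total |u| 1 with hu | hu
  · have h1 := Complex.norm_exp_sub_one_sub_id_le (x := Complex.I * u) (by rwa [h2])
    rw [h2, sq_abs] at h1
    unfold expRem
    nlinarith [sq_nonneg u]
  · refine (norm_expRem_le u).trans ?_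
    rw [← sq_abs u]
    nlinarith

theorem norm_expRem_add_le {u : ℝ} (hu : |u| ≤ 1) :
    ‖expRem u + (u : ℂ) ^ 2 / 2‖ ≤ |u| ^ 3 := by
  have h2 : ‖Complex.I * (u : ℂ)‖ = |u| := by simp
  have h1 := Complex.exp_bound (x := Complex.I * u) (by rwa [h2]) (n := 3) (by norm_num)
  rw [h2] at h1
  have e : Complex.exp (Complex.I * u)
      - ∑ m ∈ Finset.range 3, (Complex.I * (u : ℂ)) ^ m / (m.factorial : ℂ)
      = expRem u + (u : ℂ) ^ 2 / 2 := by
    simp only [expRem, Finset.sum_range_succ, Finset.sum_range_zero, mul_pow, Complex.I_sq]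
    simp
    ring
  rw [e] at h1
  refine h1.trans ?_
  have : ((Nat.succ 3 : ℕ) : ℝ) * ((Nat.factorial 3 : ℕ) * ((3 : ℕ) : ℝ))⁻¹ ≤ 1 := by
    norm_num [Nat.factorial]
  exact mul_le_of_le_one_right (by positivity) this

/-- The quadratic term gives the limit; the cubic error is `n|s|³ = (√n s)² |s|`, which tends to
zero. -/
theorem tendsto_sq_mul_expRem {s : ℕ → ℝ} {t : ℝ}
    (hs : Tendsto (fun n : ℕ => √(n : ℝ) * s n) atTop (𝓝 t)) :
    Tendsto (fun n : ℕ => (n : ℂ) * expRem (s n)) atTop (𝓝 (-(t : ℂ) ^ 2 / 2)) := by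
  have hn : Tendsto (fun n : ℕ => (√(n : ℝ))⁻¹) atTop (𝓝 0) :=
    tendsto_inv_atTop_zero.comp (Real.tendsto_sqrt_atTop.comp tendsto_natCast_atTop_atTop)
  have hs0 : Tendsto s atTop (𝓝 0) := by
    have h1 := hs.mul hn
    rw [mul_zero] at h1
    refine h1.congr' ?_
    filter_upwards [eventually_gt_atTop 0] with n hn
    have : 0 < √(n : ℝ) := Real.sqrt_pos.2 (by positivity)
    field_simp
  have h1 : Tendsto (fun n : ℕ => (√(n : ℝ) * s n) ^ 2 * |s n|) atTop (𝓝 0) := by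
    have := (hs.pow 2).mul hs0.abs
    simpa using this
  have h2 : Tendsto (fun n : ℕ => (n : ℂ) * (expRem (s n) + (s n : ℂ) ^ 2 / 2)) atTop (𝓝 0) := by
    refine squeeze_zero_norm' ?_ h1
    filter_upwards [hs0.abs.eventually_lt_const (u := 1) (by simp)] with n hn
    rw [norm_mul, Complex.norm_natCast]
    calc _ ≤ (n : ℝ) * |s n| ^ 3 := by
          gcongr
          exact norm_expRem_add_le hn.le
      _ = _ := by
          rw [mul_pow, Real.sq_sqrt (Nat.cast_nonneg n), ← sq_abs (s n)]; ring
  have h3 : Tendsto (fun n : ℕ => (((√(n : ℝ) * s n) ^ 2 / 2 : ℝ) : ℂ)) atTop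
      (𝓝 ((t ^ 2 / 2 : ℝ) : ℂ)) :=
    (Complex.continuous_ofReal.tendsto _).comp ((hs.pow 2).div_const 2)
  have h4 := h2.sub h3
  convert h4 using 1
  · ext n
    rw [mul_pow, Real.sq_sqrt (Nat.cast_nonneg n)]
    push_cast
    ring
  · push_cast; ring_nf

namespace LocalPath

variable {𝓧 : Type*} [MeasurableSpace 𝓧] {ν P : Measure 𝓧} {p : 𝓧 → ℝ}
  {Q : ℕ → Measure 𝓧} {q : ℕ → 𝓧 → ℝ} {f : 𝓧 → ℝ}

theorem tendsto_integral (h : LocalPath ν P Q p q) (hf : Measurable f) (hP : MemLp f 2 P)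
    (hQ : ∀ n, MemLp f 2 (Q n)) {K : ℝ} (hK : ∀ n, ∫ x, f x ^ 2 ∂(Q n) ≤ K) :
    Tendsto (fun n => ∫ x, f x ∂(Q n)) atTop (𝓝 (∫ x, f x ∂P)) := by
  obtain ⟨C, hC⟩ := h.integral_sub_isBigO hf hP hQ hK
  rw [tendsto_iff_norm_sub_tendsto_zero]
  have hn : Tendsto (fun n : ℕ => C * (√(n : ℝ))⁻¹) atTop (𝓝 0) := by
    have := (tendsto_inv_atTop_zero.comp
      (Real.tendsto_sqrt_atTop.comp tendsto_natCast_atTop_atTop)).const_mul C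
    simpa using this
  refine tendsto_of_tendsto_of_tendsto_of_le_of_le' tendsto_const_nhds hn
    (Eventually.of_forall fun n => norm_nonneg _) ?_
  filter_upwards [eventually_gt_atTop 0] with n hn
  have : 0 < √(n : ℝ) := Real.sqrt_pos.2 (by positivity)
  rw [← div_eq_mul_inv, le_div_iff₀ this, mul_comm]
  exact hC n

/-- The expansion of the characteristic function of a centred summand along a local path. -/
theorem tendsto_integral_exp_pow (h : LocalPath ν P Q p q) (hf : Measurable f) (hP : MemLp f 2 P)
    (hQ : ∀ n, MemLp f 2 (Q n)) {K : ℝ} (hK : ∀ n, ∫ x, f x ^ 2 ∂(Q n) ≤ K)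
    (h0 : ∫ x, f x ∂P = 0) (t : ℝ) :
    Tendsto (fun n : ℕ => (∫ x, Complex.exp (Complex.I *
      ((t * ((√(n : ℝ))⁻¹ * (f x - ∫ y, f y ∂(Q n))) : ℝ) : ℂ)) ∂(Q n)) ^ n) atTop
      (𝓝 (Complex.exp (-((t ^ 2 * ∫ x, f x ^ 2 ∂P : ℝ) : ℂ) / 2))) := by
  have := (h.pair 0).prob_left
  have hprob : ∀ n, IsProbabilityMeasure (Q n) := fun n => (h.pair n).prob_right
  set m : ℕ → ℝ := fun n => ∫ y, f y ∂(Q n) with hm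
  have hm0 : Tendsto m atTop (𝓝 0) := h0 ▸ h.tendsto_integral hf hP hQ hK
  set u : ℕ → 𝓧 → ℝ := fun n x => t * ((√(n : ℝ))⁻¹ * (f x - m n)) with hu
  have hum : ∀ n, Measurable (u n) := fun n =>
    ((hf.sub_const _).const_mul _).const_mul _
  have huP : ∀ n, MemLp (u n) 2 P := fun n =>
    ((hP.sub (memLp_const _)).const_mul _).const_mul _
  have huQ : ∀ n, MemLp (u n) 2 (Q n) := fun n =>
    (((hQ n).sub (memLp_const _)).const_mul _).const_mul _
  set g : ℕ → 𝓧 → ℂ := fun n x => expRem (u n x) with hg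
  have hgm : ∀ n, Measurable (g n) := fun n => continuous_expRem.measurable.comp (hum n)
  have hgmem : ∀ {μ : Measure 𝓧} {n}, MemLp (u n) 2 μ → MemLp (g n) 2 μ := fun {μ n} hμ =>
    (hμ.const_mul 2).mono (hgm n).aestronglyMeasurable (ae_of_all _ fun x => by
      rw [norm_mul, Real.norm_eq_abs, Real.norm_eq_abs, abs_two]
      exact norm_expRem_le _)
  have hgP : ∀ n, MemLp (g n) 2 P := fun n => hgmem (huP n)
  have hgQ : ∀ n, MemLp (g n) 2 (Q n) := fun n => hgmem (huQ n)
  have hsq : ∀ n : ℕ, n ≠ 0 → ∀ x, √(n : ℝ) * u n x = t * (f x - m n) := fun n hn x => by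
    have : 0 < √(n : ℝ) := Real.sqrt_pos.2 (by positivity)
    simp only [hu]
    field_simp
  have hsq2 : ∀ n : ℕ, n ≠ 0 → ∀ x, (n : ℝ) * u n x ^ 2 = t ^ 2 * (f x - m n) ^ 2 := fun n hn x => by
    have h1 := congrArg (· ^ 2) (hsq n hn x)
    simp only [mul_pow, Real.sq_sqrt (Nat.cast_nonneg n)] at h1
    exact h1
  have hlim : ∀ x, Tendsto (fun n : ℕ => √(n : ℝ) * u n x) atTop (𝓝 (t * f x)) := fun x => by
    have h1 : Tendsto (fun n => t * (f x - m n)) atTop (𝓝 (t * (f x - 0))) :=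
      (tendsto_const_nhds.sub hm0).const_mul t
    rw [sub_zero] at h1
    refine h1.congr' ?_
    filter_upwards [eventually_ne_atTop 0] with n hn
    exact (hsq n hn x).symm
  have hmle : ∀ᶠ n in atTop, |m n| < 1 := hm0.abs.eventually_lt_const (by simp)
  have hfb : ∀ n, |m n| < 1 → ∀ x, (f x - m n) ^ 2 ≤ 2 * (f x ^ 2 + 1) := fun n hn x => by
    have : m n ^ 2 ≤ 1 := by rw [← sq_abs]; nlinarith [abs_nonneg (m n)]
    nlinarith [sq_nonneg (f x + m n)]
  have hbint : ∀ c : ℝ, Integrable (fun x => c * (2 * (f x ^ 2 + 1))) P := fun c =>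
    ((hP.integrable_sq.add (integrable_const 1)).const_mul 2).const_mul c
  -- Under the fixed law `P`, dominated convergence gives the Gaussian exponent; the quadratic bound
  -- on `expRem` supplies the dominating function.
  have A1 : Tendsto (fun n : ℕ => (n : ℂ) * ∫ x, g n x ∂P) atTop
      (𝓝 (-((t ^ 2 * ∫ x, f x ^ 2 ∂P : ℝ) : ℂ) / 2)) := by
    have hl : (∫ x, -((t * f x : ℝ) : ℂ) ^ 2 / 2 ∂P)
        = -((t ^ 2 * ∫ x, f x ^ 2 ∂P : ℝ) : ℂ) / 2 := by
      have e : ∀ x, -((t * f x : ℝ) : ℂ) ^ 2 / 2 = ((-(t ^ 2 * f x ^ 2) / 2 : ℝ) : ℂ) := fun x => by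
        push_cast
        ring
      simp_rw [e]
      rw [integral_complex_ofReal, integral_div, integral_neg, integral_const_mul]
      push_cast
      rfl
    rw [← hl]
    simp_rw [← integral_const_mul]
    refine tendsto_integral_filter_of_dominated_convergence
      (fun x => 2 * t ^ 2 * (2 * (f x ^ 2 + 1))) ?_ ?_ (hbint _) ?_
    · exact Eventually.of_forall fun n => ((hgm n).const_mul _).aestronglyMeasurable
    · filter_upwards [hmle, eventually_ne_atTop 0] with n hn hn0
      refine ae_of_all _ fun x => ?_
      rw [norm_mul, Complex.norm_natCast]
      calc _ ≤ (n : ℝ) * (2 * u n x ^ 2) := by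
            gcongr
            exact norm_expRem_le_sq _
        _ = 2 * t ^ 2 * (f x - m n) ^ 2 := by
            rw [mul_left_comm, hsq2 n hn0]; ring
        _ ≤ _ := by
            gcongr
            exact hfb n hn x
    · exact ae_of_all _ fun x => tendsto_sq_mul_expRem (hlim x)
  -- Here `n ‖g‖²` tends to zero pointwise, since `n ‖g‖` converges and `‖g‖` vanishes; the linear
  -- bound on `expRem` dominates it.
  have A2 : Tendsto (fun n : ℕ => (n : ℝ) * ∫ x, ‖g n x‖ ^ 2 ∂P) atTop (𝓝 0) := by
    simp_rw [← integral_const_mul]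
    rw [show (0 : ℝ) = ∫ _, (0 : ℝ) ∂P by simp]
    refine tendsto_integral_filter_of_dominated_convergence
      (fun x => 4 * t ^ 2 * (2 * (f x ^ 2 + 1))) ?_ ?_ (hbint _) ?_
    · exact Eventually.of_forall fun n =>
        (((hgm n).norm.pow_const 2).const_mul _).aestronglyMeasurable
    · filter_upwards [hmle, eventually_ne_atTop 0] with n hn hn0
      refine ae_of_all _ fun x => ?_
      rw [Real.norm_of_nonneg (by positivity)]
      calc _ ≤ (n : ℝ) * (2 * |u n x|) ^ 2 := by
            gcongr
            exact norm_expRem_le _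
        _ = 4 * t ^ 2 * (f x - m n) ^ 2 := by
            rw [mul_pow, sq_abs, mul_left_comm, hsq2 n hn0]; ring
        _ ≤ _ := by
            gcongr
            exact hfb n hn x
    · refine ae_of_all _ fun x => ?_
      have h1 := tendsto_sq_mul_expRem (hlim x)
      have h2 : Tendsto (fun n => ‖g n x‖) atTop (𝓝 0) := by
        have hu0 : Tendsto (fun n => u n x) atTop (𝓝 0) := by
          have hn : Tendsto (fun n : ℕ => (√(n : ℝ))⁻¹) atTop (𝓝 0) :=
            tendsto_inv_atTop_zero.comp
              (Real.tendsto_sqrt_atTop.comp tendsto_natCast_atTop_atTop)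
          have h3 : Tendsto (fun n : ℕ => t * ((√(n : ℝ))⁻¹ * (f x - m n))) atTop
              (𝓝 (t * (0 * (f x - 0)))) := (hn.mul (tendsto_const_nhds.sub hm0)).const_mul t
          rw [zero_mul, mul_zero] at h3
          exact h3
        have h4 := (continuous_expRem.tendsto 0).comp hu0
        have h5 := h4.norm
        simpa [expRem, hg] using h5
      have h3 := h1.norm.mul h2
      rw [mul_zero] at h3
      refine h3.congr fun n => ?_
      rw [norm_mul, Complex.norm_natCast]
      ring
  obtain ⟨C, hC0, hC⟩ := h.sqrt_mul_sqrt_le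
  obtain ⟨B, hB⟩ := h.bound
  have A3 := h.tendsto_sqrt_integral_abs_mul hf hP hQ hK
  -- Replacing `P` by `Qₙ`: the first-order part is controlled by `A2` and the Hellinger bound. The
  -- quadratic part uses `‖g‖ ≤ 2|u|`, whose factor `n^{-1/2}` leaves the quantity in `A3` and a
  -- multiple of `|m n|`.
  have A4 : Tendsto (fun n : ℕ => (n : ℂ) * (∫ x, g n x ∂(Q n) - ∫ x, g n x ∂P)) atTop (𝓝 0) := by
    have hlim2 : Tendsto (fun n : ℕ => 2 * (√((n : ℝ) * ∫ x, ‖g n x‖ ^ 2 ∂P) * C)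
        + 2 * |t| * (√(n : ℝ) * ∫ x, |f x| * rootDiff p (q n) x ^ 2 ∂ν + |m n| * B)) atTop
        (𝓝 0) := by
      have := ((A2.sqrt.mul_const C).const_mul 2).add
        ((A3.add (hm0.abs.mul_const B)).const_mul (2 * |t|))
      simpa using this
    refine squeeze_zero_norm' ?_ hlim2
    filter_upwards [eventually_ne_atTop 0] with n hn0
    have hn1 : (1 : ℝ) ≤ n := by exact_mod_cast Nat.one_le_iff_ne_zero.2 hn0
    have hs1 : √(n : ℝ) ≤ n := by
      rw [Real.sqrt_le_left (by positivity)]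
      nlinarith
    rw [norm_mul, Complex.norm_natCast]
    have hi := ((h.pair n).integral_abs_mul_rootDiff_sq hf hP (hQ n) Set.univ).1
    have hi2 := (h.pair n).integrable_rootDiff_sq
    have hd : 0 ≤ ∫ x, rootDiff p (q n) x ^ 2 ∂ν := integral_nonneg fun _ => sq_nonneg _
    have e1 : (n : ℝ) * ∫ x, ‖g n x‖ * rootDiff p (q n) x ^ 2 ∂ν
        ≤ 2 * |t| * (√(n : ℝ) * ∫ x, |f x| * rootDiff p (q n) x ^ 2 ∂ν + |m n| * B) := by
      calc _ ≤ (n : ℝ) * ∫ x, (2 * |t| * (√(n : ℝ))⁻¹) * (|f x| * rootDiff p (q n) x ^ 2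
            + |m n| * rootDiff p (q n) x ^ 2) ∂ν := by
            gcongr (n : ℝ) * ?_
            refine integral_mono_of_nonneg (ae_of_all _ fun x => by positivity)
              ((hi.add (hi2.const_mul _)).const_mul _) (ae_of_all _ fun x => ?_)
            simp only
            rw [← add_mul, ← mul_assoc]
            refine mul_le_mul_of_nonneg_right ?_ (sq_nonneg _)
            refine (norm_expRem_le _).trans ?_
            simp only [hu]
            rw [abs_mul, abs_mul, abs_of_nonneg (by positivity : 0 ≤ (√(n : ℝ))⁻¹)]
            have := abs_sub (f x) (m n)
            calc _ = 2 * |t| * (√(n : ℝ))⁻¹ * |f x - m n| := by ring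
              _ ≤ _ := by gcongr
        _ = 2 * |t| * ((n * (√(n : ℝ))⁻¹) * ∫ x, |f x| * rootDiff p (q n) x ^ 2 ∂ν
            + |m n| * ((n * (√(n : ℝ))⁻¹) * ∫ x, rootDiff p (q n) x ^ 2 ∂ν)) := by
            rw [integral_const_mul, integral_add hi (hi2.const_mul _), integral_const_mul]
            ring
        _ ≤ _ := by
            rw [← div_eq_mul_inv, Real.div_sqrt]
            gcongr
            exact (mul_le_mul_of_nonneg_right hs1 hd).trans (hB n)
    have e2 : (n : ℝ) * (2 * (√(∫ x, ‖g n x‖ ^ 2 ∂P) * √(∫ x, rootDiff p (q n) x ^ 2 ∂ν)))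
        ≤ 2 * (√((n : ℝ) * ∫ x, ‖g n x‖ ^ 2 ∂P) * C) := by
      rw [Real.sqrt_mul (Nat.cast_nonneg n)]
      calc _ = 2 * (√(n : ℝ) * √(∫ x, ‖g n x‖ ^ 2 ∂P)
            * (√(n : ℝ) * √(∫ x, rootDiff p (q n) x ^ 2 ∂ν))) := by
            conv_lhs => rw [← Real.mul_self_sqrt (Nat.cast_nonneg (α := ℝ) n)]
            ring
        _ ≤ _ := by
            gcongr
            exact hC n
    calc _ ≤ (n : ℝ) * (2 * (√(∫ x, ‖g n x‖ ^ 2 ∂P) * √(∫ x, rootDiff p (q n) x ^ 2 ∂ν))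
          + ∫ x, ‖g n x‖ * rootDiff p (q n) x ^ 2 ∂ν) := by
          gcongr
          exact (h.pair n).norm_integral_sub_le (hgm n) (hgP n) (hgQ n)
      _ ≤ _ := by
          rw [mul_add]
          exact add_le_add e2 e1
  have A5 : Tendsto (fun n : ℕ => (n : ℂ) * ∫ x, g n x ∂(Q n)) atTop
      (𝓝 (-((t ^ 2 * ∫ x, f x ^ 2 ∂P : ℝ) : ℂ) / 2)) := by
    have := A1.add A4
    rw [add_zero] at this
    refine this.congr fun n => by ring
  -- Centring at the `Qₙ`-mean removes the linear term, so the characteristic function of one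
  -- summand is exactly `1 + ∫ g n`.
  refine (Complex.tendsto_one_add_pow_exp_of_tendsto A5).congr fun n => ?_
  congr 1
  have hfi : Integrable f (Q n) := (hQ n).integrable one_le_two
  have hui : Integrable (u n) (Q n) := (huQ n).integrable one_le_two
  have hu0 : ∫ x, u n x ∂(Q n) = 0 := by
    simp only [hu]
    rw [integral_const_mul, integral_const_mul, integral_sub hfi (integrable_const _)]
    simp [hm]
  have e : ∀ x, Complex.exp (Complex.I * (u n x : ℂ)) = 1 + (g n x + Complex.I * (u n x : ℂ)) :=
    fun x => by simp only [hg, expRem]; ring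
  have hgi : Integrable (g n) (Q n) := (hgQ n).integrable one_le_two
  have hui' : Integrable (fun x => Complex.I * (u n x : ℂ)) (Q n) := hui.ofReal.const_mul _
  change _ = ∫ x, Complex.exp (Complex.I * (u n x : ℂ)) ∂(Q n)
  simp_rw [e]
  refine ((integral_add (integrable_const (1 : ℂ)) (hgi.add hui')).trans ?_).symm
  rw [integral_add' hgi hui', integral_const_mul, integral_complex_ofReal, hu0]
  simp

end LocalPath

end TripleDoor

/-! ### Contiguity of the data laws. -/

namespace TripleDoor

section ProductDensity

variable {𝓧 : Type*} [MeasurableSpace 𝓧] {P : Measure 𝓧} [IsProbabilityMeasure P]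

theorem lintegral_pi_prod {ρ : 𝓧 → ENNReal} (hρ : Measurable ρ) (m : ℕ) :
    ∫⁻ x, ∏ i, ρ (x i) ∂(Measure.pi fun _ : Fin m => P) = (∫⁻ x, ρ x ∂P) ^ m := by
  have hind : iIndepFun (fun (i : Fin m) (x : Fin m → 𝓧) => ρ (x i))
      (Measure.pi fun _ : Fin m => P) :=
    iIndepFun_pi (X := fun _ => ρ) fun _ => hρ.aemeasurable
  have h := lintegral_prod_eq_prod_lintegral_of_indepFun Finset.univ _ hind
    fun i => hρ.comp (measurable_pi_apply i)
  rw [h]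
  have h2 : ∀ i : Fin m, ∫⁻ x, ρ (x i) ∂(Measure.pi fun _ : Fin m => P) = ∫⁻ x, ρ x ∂P :=
    fun i => (measurePreserving_eval (fun _ : Fin m => P) i).lintegral_comp hρ
  simp [h2]

theorem pi_withDensity {ρ : 𝓧 → ENNReal} (hρ : Measurable ρ) [SigmaFinite (P.withDensity ρ)]
    (m : ℕ) : (Measure.pi fun _ : Fin m => P.withDensity ρ)
      = (Measure.pi fun _ : Fin m => P).withDensity fun x => ∏ i, ρ (x i) := by
  refine Measure.pi_eq fun s hs => ?_
  rw [withDensity_apply _ (MeasurableSet.univ_pi hs), ← lintegral_indicator (MeasurableSet.univ_pi hs)]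
  have hind : iIndepFun (fun (i : Fin m) (x : Fin m → 𝓧) => (s i).indicator ρ (x i))
      (Measure.pi fun _ : Fin m => P) :=
    iIndepFun_pi (X := fun i => (s i).indicator ρ) fun i => (hρ.indicator (hs i)).aemeasurable
  have h := lintegral_prod_eq_prod_lintegral_of_indepFun Finset.univ _ hind
    fun i => (hρ.indicator (hs i)).comp (measurable_pi_apply i)
  have e : ∀ x : Fin m → 𝓧, (Set.univ.pi s).indicator (fun x => ∏ i, ρ (x i)) x
      = ∏ i, (s i).indicator ρ (x i) := fun x => by
    by_cases hx : x ∈ Set.univ.pi s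
    · rw [Set.indicator_of_mem hx]
      exact Finset.prod_congr rfl fun i _ => (Set.indicator_of_mem (hx i trivial) _).symm
    · rw [Set.indicator_of_notMem hx]
      simp only [Set.mem_pi, not_forall] at hx
      obtain ⟨i, _, hi⟩ := hx
      exact (Finset.prod_eq_zero (Finset.mem_univ i) (Set.indicator_of_notMem hi _)).symm
  simp_rw [e]
  rw [h]
  refine Finset.prod_congr rfl fun i _ => ?_
  rw [(measurePreserving_eval (fun _ : Fin m => P) i).lintegral_comp (hρ.indicator (hs i)),
    lintegral_indicator (hs i), withDensity_apply _ (hs i)]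

end ProductDensity

section Contiguity

variable {𝒞 𝒜 𝒵 : Type u} [MeasurableSpace 𝒞] [MeasurableSpace 𝒜] [MeasurableSpace 𝒵]
  {P Q : Measure (Obs 𝒞 𝒜 𝒵)} {n N : ℕ}

theorem sampleLaw_withDensity [IsProbabilityMeasure P] {ρ : Obs 𝒞 𝒜 𝒵 → ENNReal}
    (hρ : Measurable ρ) [SigmaFinite (P.withDensity ρ)] :
    sampleLaw (P.withDensity ρ) n N
      = (sampleLaw P n N).withDensity fun D => (∏ i, ρ (D.1 i)) * ∏ j, ρ (D.2 j) := by
  unfold sampleLaw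
  rw [pi_withDensity hρ, pi_withDensity hρ, prod_withDensity]
  · exact Finset.measurable_fun_prod _ fun i _ => hρ.comp (measurable_pi_apply i)
  · exact Finset.measurable_fun_prod _ fun i _ => hρ.comp (measurable_pi_apply i)

/-- The event that all observations lie in `G`. -/
def allIn (G : Set (Obs 𝒞 𝒜 𝒵)) (n N : ℕ) : Set (Data 𝒞 𝒜 𝒵 n N) :=
  (Set.univ.pi fun _ => G) ×ˢ (Set.univ.pi fun _ => G)

theorem sampleLaw_restrict [IsProbabilityMeasure Q] (G : Set (Obs 𝒞 𝒜 𝒵)) :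
    (sampleLaw Q n N).restrict (allIn G n N) = sampleLaw (Q.restrict G) n N := by
  unfold sampleLaw allIn
  rw [← Measure.prod_restrict, Measure.restrict_pi_pi, Measure.restrict_pi_pi]

theorem sampleLaw_compl_allIn_le [IsProbabilityMeasure Q] {G : Set (Obs 𝒞 𝒜 𝒵)}
    (hG : MeasurableSet G) :
    sampleLaw Q n N (allIn G n N)ᶜ ≤ ENNReal.ofReal ((n + N) * Q.real Gᶜ) := by
  have hm : MeasurableSet (allIn G n N) :=
    (MeasurableSet.univ_pi fun _ => hG).prod (MeasurableSet.univ_pi fun _ => hG)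
  rw [← ofReal_measureReal, probReal_compl_eq_one_sub hm]
  refine ENNReal.ofReal_le_ofReal ?_
  have e : (sampleLaw Q n N).real (allIn G n N) = Q.real G ^ (n + N) := by
    rw [measureReal_def, sampleLaw, allIn, Measure.prod_prod, Measure.pi_pi, Measure.pi_pi]
    simp [measureReal_def, pow_add]
  rw [e, probReal_compl_eq_one_sub hG]
  -- Bernoulli's inequality bounds the probability that all `n + N` observations lie in `G` from
  -- below.
  have h := one_add_mul_le_pow (a := Q.real G - 1) (by linarith [measureReal_nonneg (μ := Q) (s := G)])
    (n + N)
  rw [add_sub_cancel] at h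
  push_cast at h
  linarith

/-- On the event that all observations lie in `G`, the law under `Q` has a product density with
respect to that under `P`. Cauchy-Schwarz against the indicator of `A` leaves its second moment,
which is a power of the one-observation moment. -/
theorem sampleLaw_le [IsProbabilityMeasure P] [IsProbabilityMeasure Q] {ρ : Obs 𝒞 𝒜 𝒵 → ENNReal}
    (hρ : Measurable ρ) {G : Set (Obs 𝒞 𝒜 𝒵)} (hG : MeasurableSet G)
    (h : Q.restrict G = P.withDensity ρ) (A : Set (Data 𝒞 𝒜 𝒵 n N)) :
    sampleLaw Q n N A ≤ ((∫⁻ x, ρ x ^ 2 ∂P) ^ (n + N)) ^ (1 / 2 : ℝ)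
        * sampleLaw P n N A ^ (1 / 2 : ℝ) + ENNReal.ofReal ((n + N) * Q.real Gᶜ) := by
  have hm : MeasurableSet (allIn G n N) :=
    (MeasurableSet.univ_pi fun _ => hG).prod (MeasurableSet.univ_pi fun _ => hG)
  have : SigmaFinite (P.withDensity ρ) := by rw [← h]; infer_instance
  have h1 : Measurable fun D : Data 𝒞 𝒜 𝒵 n N => ∏ i, ρ (D.1 i) :=
    Finset.measurable_fun_prod _ fun i _ => hρ.comp ((measurable_pi_apply i).comp measurable_fst)
  have h2 : Measurable fun D : Data 𝒞 𝒜 𝒵 n N => ∏ j, ρ (D.2 j) :=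
    Finset.measurable_fun_prod _ fun i _ => hρ.comp ((measurable_pi_apply i).comp measurable_snd)
  have hsq : ∫⁻ D, ((∏ i, ρ (D.1 i)) * ∏ j, ρ (D.2 j)) ^ (2 : ℝ) ∂(sampleLaw P n N)
      = (∫⁻ x, ρ x ^ 2 ∂P) ^ (n + N) := by
    have e : ∀ D : Data 𝒞 𝒜 𝒵 n N, ((∏ i, ρ (D.1 i)) * ∏ j, ρ (D.2 j)) ^ (2 : ℝ)
        = (∏ i, ρ (D.1 i) ^ 2) * ∏ j, ρ (D.2 j) ^ 2 := fun D => by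
      rw [ENNReal.rpow_ofNat, mul_pow, Finset.prod_pow, Finset.prod_pow]
    simp_rw [e]
    rw [sampleLaw, lintegral_prod_mul (f := fun x : Fin n → Obs 𝒞 𝒜 𝒵 => ∏ i, ρ (x i) ^ 2)
      (g := fun x : Fin N → Obs 𝒞 𝒜 𝒵 => ∏ i, ρ (x i) ^ 2)]
    · rw [lintegral_pi_prod (hρ.pow_const 2), lintegral_pi_prod (hρ.pow_const 2), pow_add]
    · exact (Finset.measurable_fun_prod _ fun i _ =>
        (hρ.pow_const 2).comp (measurable_pi_apply i)).aemeasurable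
    · exact (Finset.measurable_fun_prod _ fun i _ =>
        (hρ.pow_const 2).comp (measurable_pi_apply i)).aemeasurable
  calc sampleLaw Q n N A ≤ sampleLaw Q n N (A ∩ allIn G n N) + sampleLaw Q n N (A \ allIn G n N) :=
        measure_le_inter_add_sdiff _ _ _
    _ ≤ (sampleLaw Q n N).restrict (allIn G n N) A + sampleLaw Q n N (allIn G n N)ᶜ := by
        rw [Measure.restrict_apply' hm]
        gcongr
        exact fun x hx => hx.2
    _ ≤ _ := by
        refine add_le_add ?_ (sampleLaw_compl_allIn_le hG)
        rw [sampleLaw_restrict, h, sampleLaw_withDensity hρ, withDensity_apply']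
        have hcs := ENNReal.lintegral_mul_le_Lp_mul_Lq ((sampleLaw P n N).restrict A)
          (p := 2) (q := 2) (by constructor <;> norm_num) (h1.mul h2).aemeasurable
          (aemeasurable_const (b := (1 : ENNReal)))
        simp only [Pi.mul_apply, mul_one, ENNReal.one_rpow, lintegral_const, one_mul,
          Measure.restrict_apply_univ] at hcs
        refine hcs.trans ?_
        gcongr
        rw [← hsq]
        exact setLIntegral_le_lintegral _ _

end Contiguity

section LikelihoodRatio

variable {𝓧 : Type*} [MeasurableSpace 𝓧] {ν P Q : Measure 𝓧} {p q : 𝓧 → ℝ}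

/-- The region where the likelihood ratio is at most four. -/
def ratioSet (p q : 𝓧 → ℝ) : Set 𝓧 := {x | q x ≤ 4 * p x}

/-- The likelihood ratio on `ratioSet`. -/
noncomputable def ratio (p q : 𝓧 → ℝ) : 𝓧 → ENNReal :=
  (ratioSet p q).indicator fun x => ENNReal.ofReal (q x / p x)

namespace DensityPair

theorem measurableSet_ratioSet (h : DensityPair ν P Q p q) : MeasurableSet (ratioSet p q) :=
  measurableSet_le h.measurable_right (h.measurable_left.const_mul 4)

theorem measurable_ratio (h : DensityPair ν P Q p q) : Measurable (ratio p q) :=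
  (h.measurable_right.div h.measurable_left).ennreal_ofReal.indicator h.measurableSet_ratioSet

theorem restrict_ratioSet (h : DensityPair ν P Q p q) :
    Q.restrict (ratioSet p q) = P.withDensity (ratio p q) := by
  conv_lhs => rw [h.right_eq]
  conv_rhs => rw [h.left_eq]
  rw [restrict_withDensity h.measurableSet_ratioSet, ← withDensity_indicator h.measurableSet_ratioSet,
    ← withDensity_mul _ h.measurable_left.ennreal_ofReal h.measurable_ratio]
  congr 1
  ext x
  rw [Pi.mul_apply]
  by_cases hx : x ∈ ratioSet p q
  · rw [ratio, Set.indicator_of_mem hx, Set.indicator_of_mem hx,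
      ← ENNReal.ofReal_mul (h.left_nonneg x)]
    congr 1
    -- Where `p = 0` the bound `q ≤ 4p` forces `q = 0`, so `Q` restricted to the set has no part
    -- singular to `P`.
    by_cases h0 : p x = 0
    · have h1 : q x ≤ 4 * p x := hx
      have h2 := h.right_nonneg x
      rw [h0] at h1 ⊢
      linarith
    · field_simp
  · rw [ratio, Set.indicator_of_notMem hx, Set.indicator_of_notMem hx, mul_zero]

/-- On the ratio set `q²/p = 2q - p + (q - p)²/p`, and `(√q + √p)² ≤ 9p` bounds the last term by
`9(√q - √p)²`. Off the set the right-hand integrand is still nonnegative. It integrates to `1` plus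
nine times the squared Hellinger distance. -/
theorem lintegral_ratio_sq_le (h : DensityPair ν P Q p q) :
    ∫⁻ x, ratio p q x ^ 2 ∂P ≤ ENNReal.ofReal (1 + 9 * ∫ x, rootDiff p q x ^ 2 ∂ν) := by
  have := h.prob_left
  have := h.prob_right
  have hp := h.integrable_left
  have hq := h.symm.integrable_left
  have e1 : ∫ x, p x ∂ν = 1 := by
    have := h.setIntegral_left MeasurableSet.univ
    simpa using this
  have e2 : ∫ x, q x ∂ν = 1 := by
    have := h.symm.setIntegral_left MeasurableSet.univ
    simpa using this
  have hi : Integrable (fun x => (2 * q x - p x) + 9 * rootDiff p q x ^ 2) ν :=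
    ((hq.const_mul 2).sub hp).add (h.integrable_rootDiff_sq.const_mul 9)
  have e3 : ∫ x, ((2 * q x - p x) + 9 * rootDiff p q x ^ 2) ∂ν
      = 1 + 9 * ∫ x, rootDiff p q x ^ 2 ∂ν := by
    refine (integral_add ((hq.const_mul 2).sub hp) (h.integrable_rootDiff_sq.const_mul 9)).trans ?_
    rw [integral_sub' (hq.const_mul 2) hp, integral_const_mul, integral_const_mul, e1, e2]
    norm_num
  have key : ∀ x, ENNReal.ofReal (p x) * ratio p q x ^ 2
      ≤ ENNReal.ofReal ((2 * q x - p x) + 9 * rootDiff p q x ^ 2) ∧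
      0 ≤ (2 * q x - p x) + 9 * rootDiff p q x ^ 2 := fun x => by
    have hp0 := h.left_nonneg x
    have hq0 := h.right_nonneg x
    by_cases hx : x ∈ ratioSet p q
    · have hx' : q x ≤ 4 * p x := hx
      have hr : q x ^ 2 / p x ≤ (2 * q x - p x) + 9 * rootDiff p q x ^ 2 := by
        rcases hp0.eq_or_lt with h0 | h0
        · have : q x = 0 := by linarith
          rw [this, ← h0]
          simp only [zero_div, ne_eq, OfNat.ofNat_ne_zero, not_false_eq_true, zero_pow, mul_zero,
            sub_zero, zero_add]
          positivity
        · rw [div_le_iff₀ h0]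
          have s1 := Real.sq_sqrt hp0
          have s2 := Real.sq_sqrt hq0
          have s3 : √(q x) ≤ 2 * √(p x) := by
            rw [show (2 : ℝ) * √(p x) = √(4 * p x) by
              rw [Real.sqrt_mul (by norm_num), show (4 : ℝ) = 2 ^ 2 by norm_num,
                Real.sqrt_sq (by norm_num)]]
            exact Real.sqrt_le_sqrt hx'
          have s4 : (√(q x) + √(p x)) ^ 2 ≤ 9 * p x := by
            nlinarith [Real.sqrt_nonneg (p x), Real.sqrt_nonneg (q x)]
          have s5 : (q x - p x) ^ 2 = rootDiff p q x ^ 2 * (√(q x) + √(p x)) ^ 2 := by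
            rw [rootDiff, ← mul_pow]
            congr 1
            nlinarith
          nlinarith [mul_le_mul_of_nonneg_left s4 (sq_nonneg (rootDiff p q x))]
      rw [ratio, Set.indicator_of_mem hx, ← ENNReal.ofReal_pow (by positivity),
        ← ENNReal.ofReal_mul hp0]
      refine ⟨ENNReal.ofReal_le_ofReal ?_, le_trans (by positivity) hr⟩
      refine le_trans (le_of_eq ?_) hr
      by_cases h0 : p x = 0
      · rw [h0]; simp
      · field_simp
    · have hx' : 4 * p x < q x := not_le.1 hx
      have h3 : 0 ≤ (2 * q x - p x) + 9 * rootDiff p q x ^ 2 := by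
        nlinarith [sq_nonneg (rootDiff p q x)]
      refine ⟨?_, h3⟩
      rw [ratio, Set.indicator_of_notMem hx]
      simp
  rw [← e3, ofReal_integral_eq_lintegral_ofReal hi (ae_of_all _ fun x => (key x).2)]
  conv_lhs => rw [h.left_eq]
  rw [lintegral_withDensity_eq_lintegral_mul _ h.measurable_left.ennreal_ofReal
    (h.measurable_ratio.pow_const 2)]
  exact lintegral_mono fun x => (key x).1

/-- Where `q > 4p`, the difference `√q - √p` exceeds both `√p` and half of `√q`. Keeping the
integral for `Q` on the complement allows negligibility to give `o(1/n)`. -/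
theorem real_compl_ratioSet_le (h : DensityPair ν P Q p q) :
    P.real (ratioSet p q)ᶜ ≤ ∫ x, rootDiff p q x ^ 2 ∂ν ∧
    Q.real (ratioSet p q)ᶜ ≤ 4 * ∫ x in (ratioSet p q)ᶜ, rootDiff p q x ^ 2 ∂ν := by
  have hm := h.measurableSet_ratioSet.compl
  have hs : ∀ x ∈ (ratioSet p q)ᶜ, p x ≤ rootDiff p q x ^ 2 ∧ q x ≤ 4 * rootDiff p q x ^ 2 :=
    fun x hx => by
    have hx' : 4 * p x < q x := not_le.1 hx
    have hp0 := h.left_nonneg x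
    have hq0 := h.right_nonneg x
    have s1 := Real.sq_sqrt hp0
    have s2 := Real.sq_sqrt hq0
    have s3 : 2 * √(p x) ≤ √(q x) := by
      rw [show (2 : ℝ) * √(p x) = √(4 * p x) by
        rw [Real.sqrt_mul (by norm_num), show (4 : ℝ) = 2 ^ 2 by norm_num,
          Real.sqrt_sq (by norm_num)]]
      exact Real.sqrt_le_sqrt hx'.le
    unfold rootDiff
    constructor <;> nlinarith [Real.sqrt_nonneg (p x), Real.sqrt_nonneg (q x)]
  constructor
  · rw [← h.setIntegral_left hm]
    refine (setIntegral_mono_on h.integrable_left.integrableOn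
      h.integrable_rootDiff_sq.integrableOn hm fun x hx => (hs x hx).1).trans ?_
    exact setIntegral_le_integral h.integrable_rootDiff_sq (ae_of_all _ fun x => sq_nonneg _)
  · rw [← h.symm.setIntegral_left hm, ← integral_const_mul]
    exact setIntegral_mono_on h.symm.integrable_left.integrableOn
      (h.integrable_rootDiff_sq.const_mul 4).integrableOn hm fun x hx => (hs x hx).2

end DensityPair

end LikelihoodRatio

namespace LocalPath

variable {𝒞 𝒜 𝒵 : Type u} [MeasurableSpace 𝒞] [MeasurableSpace 𝒜] [MeasurableSpace 𝒵]
  {ν P : Measure (Obs 𝒞 𝒜 𝒵)} {Q : ℕ → Measure (Obs 𝒞 𝒜 𝒵)} {p : Obs 𝒞 𝒜 𝒵 → ℝ}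
  {q : ℕ → Obs 𝒞 𝒜 𝒵 → ℝ} {N : ℕ → ℕ}

/-- The laws of the data along a local path are contiguous. -/
theorem contiguous (h : LocalPath ν P Q p q) {K : ℕ} (hN : ∀ n, N n ≤ K * (n + 1))
    {A : ∀ n, Set (Data 𝒞 𝒜 𝒵 n (N n))}
    (hA : Tendsto (fun n => sampleLaw P n (N n) (A n)) atTop (𝓝 0)) :
    Tendsto (fun n => sampleLaw (Q n) n (N n) (A n)) atTop (𝓝 0) := by
  have := (h.pair 0).prob_left
  have hprob : ∀ n, IsProbabilityMeasure (Q n) := fun n => (h.pair n).prob_right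
  obtain ⟨C, hC⟩ := h.bound
  set I : ℕ → ℝ := fun n => ∫ x, rootDiff p (q n) x ^ 2 ∂ν with hI
  have hI0 : ∀ n, 0 ≤ I n := fun n => integral_nonneg fun _ => sq_nonneg _
  -- For `n ≥ 1`, `K(n + 1) ≤ 2Kn`; the total sample size is of order `n`.
  have hn : ∀ n : ℕ, n ≠ 0 → ((n : ℝ) + N n) ≤ (2 * K + 1) * n := fun n hn => by
    have h1 : (N n : ℝ) ≤ K * (n + 1) := by exact_mod_cast hN n
    have h2 : (1 : ℝ) ≤ n := by exact_mod_cast Nat.one_le_iff_ne_zero.2 hn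
    have h3 : (0 : ℝ) ≤ K := Nat.cast_nonneg K
    nlinarith
  have hIt : Tendsto I atTop (𝓝 0) := by
    have h1 : Tendsto (fun n : ℕ => C * (n : ℝ)⁻¹) atTop (𝓝 0) := by
      have := (tendsto_inv_atTop_zero.comp (tendsto_natCast_atTop_atTop (R := ℝ))).const_mul C
      simpa using this
    refine tendsto_of_tendsto_of_tendsto_of_le_of_le' tendsto_const_nhds h1
      (Eventually.of_forall hI0) ?_
    filter_upwards [eventually_gt_atTop 0] with n hn
    have : (0 : ℝ) < n := by exact_mod_cast hn
    rw [← div_eq_mul_inv, le_div_iff₀ this, mul_comm]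
    exact hC n
  have hPG : Tendsto (fun n => P (ratioSet p (q n))ᶜ) atTop (𝓝 0) := by
    have h1 : Tendsto (fun n => ENNReal.ofReal (I n)) atTop (𝓝 0) := by
      simpa using (ENNReal.tendsto_ofReal hIt)
    refine tendsto_of_tendsto_of_tendsto_of_le_of_le tendsto_const_nhds h1 (fun _ => zero_le)
      fun n => ?_
    simp only
    rw [← ofReal_measureReal]
    exact ENNReal.ofReal_le_ofReal (h.pair n).real_compl_ratioSet_le.1
  have hneg := h.negligible _ (fun n => (h.pair n).measurableSet_ratioSet.compl) hPG
  have hlim : Tendsto (fun n => ENNReal.ofReal (Real.exp (9 * ((2 * K + 1) * C))) ^ (1 / 2 : ℝ)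
      * sampleLaw P n (N n) (A n) ^ (1 / 2 : ℝ)
      + ENNReal.ofReal ((2 * K + 1) * (4 * (n * ∫ x in (ratioSet p (q n))ᶜ,
        rootDiff p (q n) x ^ 2 ∂ν)))) atTop (𝓝 0) := by
    have h1 : Tendsto (fun n => sampleLaw P n (N n) (A n) ^ (1 / 2 : ℝ)) atTop (𝓝 0) := by
      have := (ENNReal.continuous_rpow_const (y := (1 / 2 : ℝ))).tendsto 0 |>.comp hA
      rwa [ENNReal.zero_rpow_of_pos (by norm_num)] at this
    have h2 := ENNReal.Tendsto.const_mul h1 (a := ENNReal.ofReal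
      (Real.exp (9 * ((2 * K + 1) * C))) ^ (1 / 2 : ℝ))
      (Or.inr (ENNReal.rpow_ne_top_of_nonneg (by norm_num) ENNReal.ofReal_ne_top))
    have h3 := ENNReal.tendsto_ofReal ((hneg.const_mul 4).const_mul (2 * (K : ℝ) + 1))
    simpa using h2.add h3
  refine tendsto_of_tendsto_of_tendsto_of_le_of_le' tendsto_const_nhds hlim
    (Eventually.of_forall fun _ => zero_le) ?_
  filter_upwards [eventually_ne_atTop 0] with n hn0
  have hK0 : (0 : ℝ) ≤ 2 * K + 1 := by positivity
  refine (sampleLaw_le (h.pair n).measurable_ratio (h.pair n).measurableSet_ratioSet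
    (h.pair n).restrict_ratioSet (A n)).trans ?_
  refine add_le_add (mul_le_mul_left (ENNReal.rpow_le_rpow ?_ (by norm_num)) _)
    (ENNReal.ofReal_le_ofReal ?_)
  · refine (pow_le_pow_left' (h.pair n).lintegral_ratio_sq_le _).trans ?_
    rw [← ENNReal.ofReal_pow (by linarith [hI0 n])]
    refine ENNReal.ofReal_le_ofReal ?_
    -- By `1 + x ≤ eˣ` the second moment of the whole likelihood ratio is at most `exp(9 (n + N)
    -- I)`, bounded because `n I ≤ C`.
    calc _ ≤ Real.exp (9 * I n) ^ (n + N n) := by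
          refine pow_le_pow_left₀ (by linarith [hI0 n]) ?_ _
          linarith [Real.add_one_le_exp (9 * I n)]
      _ = Real.exp (9 * (((n : ℝ) + N n) * I n)) := by
          rw [← Real.exp_nat_mul]
          push_cast
          ring_nf
      _ ≤ _ := by
          refine Real.exp_le_exp.2 (mul_le_mul_of_nonneg_left ?_ (by norm_num))
          calc _ ≤ ((2 * K + 1) * n) * I n := mul_le_mul_of_nonneg_right (hn n hn0) (hI0 n)
            _ = (2 * K + 1) * (n * I n) := by ring
            _ ≤ _ := mul_le_mul_of_nonneg_left (hC n) hK0
  · calc _ ≤ ((2 * K + 1) * n) * (4 * ∫ x in (ratioSet p (q n))ᶜ, rootDiff p (q n) x ^ 2 ∂ν) :=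
          mul_le_mul (hn n hn0) (h.pair n).real_compl_ratioSet_le.2 measureReal_nonneg
            (by positivity)
      _ = _ := by ring

theorem isLittleOpOne (h : LocalPath ν P Q p q) {K : ℕ} (hN : ∀ n, N n ≤ K * (n + 1))
    {f : ∀ n, Data 𝒞 𝒜 𝒵 n (N n) → ℝ} (hf : IsLittleOpOne (fun n => sampleLaw P n (N n)) f) :
    IsLittleOpOne (fun n => sampleLaw (Q n) n (N n)) f :=
  fun ε hε => h.contiguous hN (hf ε hε)

end LocalPath

end TripleDoor

/-! ### Weak convergence through characteristic functions. -/

namespace TripleDoor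

section WeakConvergence

variable {Ω : ℕ → Type*} [∀ n, MeasurableSpace (Ω n)] {μ : ∀ n, Measure (Ω n)}
  [∀ n, IsProbabilityMeasure (μ n)] {V W : ∀ n, Ω n → ℝ}

theorem norm_exp_I_sub_exp_I_le (x y : ℝ) :
    ‖Complex.exp (Complex.I * x) - Complex.exp (Complex.I * y)‖ ≤ |x - y| := by
  have h := Real.norm_exp_I_mul_ofReal_sub_one_le (x := x - y)
  have e : Complex.exp (Complex.I * x) - Complex.exp (Complex.I * y)
      = Complex.exp (Complex.I * y) * (Complex.exp (Complex.I * ((x - y : ℝ) : ℂ)) - 1) := by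
    rw [mul_sub, ← Complex.exp_add, mul_one]
    congr 2
    push_cast
    ring
  rw [e, norm_mul, mul_comm Complex.I (y : ℂ), Complex.norm_exp_ofReal_mul_I, one_mul]
  exact h

theorem norm_exp_I (x : ℝ) : ‖Complex.exp (Complex.I * x)‖ = 1 := by
  rw [mul_comm, Complex.norm_exp_ofReal_mul_I]

theorem integrable_exp_I {Ω : Type*} [MeasurableSpace Ω] {μ : Measure Ω} [IsFiniteMeasure μ]
    {V : Ω → ℝ} (hV : Measurable V) : Integrable (fun ω => Complex.exp (Complex.I * V ω)) μ :=
  Integrable.of_bound (by fun_prop) 1 (ae_of_all _ fun ω => (norm_exp_I _).le)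

/-- The exponentials differ by at most `|t| ε` where `|V - W| < ε`, and by at most `2` on an event
of vanishing probability. -/
theorem tendsto_integral_exp_sub_zero (hV : ∀ n, Measurable (V n)) (hW : ∀ n, Measurable (W n))
    (h : IsLittleOpOne μ fun n ω => V n ω - W n ω) (t : ℝ) :
    Tendsto (fun n => ∫ ω, Complex.exp (Complex.I * ((t * V n ω : ℝ) : ℂ)) ∂(μ n)
      - ∫ ω, Complex.exp (Complex.I * ((t * W n ω : ℝ) : ℂ)) ∂(μ n)) atTop (𝓝 0) := by
  rw [Metric.tendsto_atTop']
  intro δ hδ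
  set ε := δ / (2 * (|t| + 1)) with hε
  have hε0 : 0 < ε := by positivity
  have h1 : Tendsto (fun n => (μ n).real {ω | ε ≤ |V n ω - W n ω|}) atTop (𝓝 0) := by
    have := (ENNReal.tendsto_toReal ENNReal.zero_ne_top).comp (h ε hε0)
    rw [ENNReal.toReal_zero] at this
    exact this
  obtain ⟨n₀, hn₀⟩ := eventually_atTop.1 (h1.eventually_lt_const (show (0 : ℝ) < δ / 4 by positivity))
  refine ⟨n₀, fun n hn => ?_⟩
  rw [dist_zero_right, ← integral_sub (integrable_exp_I ((hV n).const_mul t))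
    (integrable_exp_I ((hW n).const_mul t))]
  have hm : MeasurableSet {ω | ε ≤ |V n ω - W n ω|} :=
    measurableSet_le measurable_const ((hV n).sub (hW n)).abs
  have hi : Integrable (fun ω => {ω | ε ≤ |V n ω - W n ω|}.indicator (fun _ => (2 : ℝ)) ω) (μ n) :=
    (integrable_const 2).indicator hm
  calc _ ≤ ∫ ω, ‖Complex.exp (Complex.I * ((t * V n ω : ℝ) : ℂ))
        - Complex.exp (Complex.I * ((t * W n ω : ℝ) : ℂ))‖ ∂(μ n) :=
        norm_integral_le_integral_norm _
    _ ≤ ∫ ω, (|t| * ε + {ω | ε ≤ |V n ω - W n ω|}.indicator (fun _ => (2 : ℝ)) ω) ∂(μ n) := by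
        refine integral_mono_of_nonneg (ae_of_all _ fun _ => norm_nonneg _)
          ((integrable_const _).add hi) (ae_of_all _ fun ω => ?_)
        simp only
        by_cases hω : ω ∈ {ω | ε ≤ |V n ω - W n ω|}
        · rw [Set.indicator_of_mem hω]
          refine (norm_sub_le _ _).trans ?_
          rw [norm_exp_I, norm_exp_I]
          have : 0 ≤ |t| * ε := by positivity
          linarith
        · rw [Set.indicator_of_notMem hω, add_zero]
          refine (norm_exp_I_sub_exp_I_le _ _).trans ?_
          rw [← mul_sub, abs_mul]
          exact mul_le_mul_of_nonneg_left (le_of_lt (not_le.1 hω)) (abs_nonneg t)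
    _ = |t| * ε + (μ n).real {ω | ε ≤ |V n ω - W n ω|} * 2 := by
        refine (integral_add (integrable_const _) hi).trans ?_
        rw [integral_indicator hm]
        simp
    _ < δ := by
        have h2 := hn₀ n hn.le
        have h3 : |t| * ε ≤ δ / 2 := by
          rw [hε, mul_div_assoc', div_le_div_iff₀ (by positivity) (by positivity)]
          nlinarith [abs_nonneg t]
        linarith

/-- Weak convergence from convergence of characteristic functions, up to `o_p(1)`. -/
theorem tendsto_integral_of_tendsto_charFun (hV : ∀ n, Measurable (V n))
    (hW : ∀ n, Measurable (W n)) (h : IsLittleOpOne μ fun n ω => V n ω - W n ω) {L : Measure ℝ}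
    [IsProbabilityMeasure L]
    (hc : ∀ t : ℝ, Tendsto (fun n => ∫ ω, Complex.exp (Complex.I * ((t * W n ω : ℝ) : ℂ)) ∂(μ n))
      atTop (𝓝 (charFun L t))) (g : ℝ →ᵇ ℝ) :
    Tendsto (fun n => ∫ ω, g (V n ω) ∂(μ n)) atTop (𝓝 (∫ x, g x ∂L)) := by
  set M : ℕ → ProbabilityMeasure ℝ := fun n =>
    ⟨(μ n).map (V n), Measure.isProbabilityMeasure_map (hV n).aemeasurable⟩ with hM
  have h1 : Tendsto M atTop (𝓝 ⟨L, inferInstance⟩) := by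
    refine ProbabilityMeasure.tendsto_iff_tendsto_charFun.2 fun t => ?_
    have h2 := (tendsto_integral_exp_sub_zero hV hW h t).add (hc t)
    rw [zero_add] at h2
    refine h2.congr fun n => ?_
    rw [sub_add_cancel, charFun_apply_real]
    change _ = ∫ x, Complex.exp (t * x * Complex.I) ∂((μ n).map (V n))
    rw [integral_map (hV n).aemeasurable (by fun_prop)]
    congr 1
    ext ω
    congr 1
    push_cast
    ring
  have h3 := ProbabilityMeasure.tendsto_iff_forall_integral_tendsto.1 h1 g
  refine h3.congr fun n => ?_
  change ∫ x, g x ∂((μ n).map (V n)) = _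
  exact integral_map (hV n).aemeasurable g.continuous.aestronglyMeasurable

end WeakConvergence

section Sample

variable {𝒞 𝒜 𝒵 : Type u} [MeasurableSpace 𝒞] [MeasurableSpace 𝒜] [MeasurableSpace 𝒵]

theorem integral_exp_sample_sum {Q : Measure (Obs 𝒞 𝒜 𝒵)} [IsProbabilityMeasure Q] {n N : ℕ}
    {f : Obs 𝒞 𝒜 𝒵 → ℝ} (hf : Measurable f) (t s : ℝ) :
    ∫ D, Complex.exp (Complex.I * ((t * (s * ∑ i, f (D.1 i)) : ℝ) : ℂ)) ∂(sampleLaw Q n N)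
      = (∫ x, Complex.exp (Complex.I * ((t * (s * f x) : ℝ) : ℂ)) ∂Q) ^ n := by
  have h1 := integral_fintype_prod_eq_pow (ι := Fin n) (μ := Q)
    (fun x => Complex.exp (Complex.I * ((t * (s * f x) : ℝ) : ℂ)))
  rw [Fintype.card_fin] at h1
  rw [← h1]
  have hm := measurePreserving_sample_fst (P := Q) (n := n) (N := N)
  rw [← hm.map_eq, integral_map hm.measurable.aemeasurable]
  · congr 1
    ext D
    rw [← Complex.exp_sum]
    congr 1
    push_cast
    rw [Finset.mul_sum, Finset.mul_sum, Finset.mul_sum]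
  · refine (Finset.measurable_fun_prod _ fun i _ => ?_).aestronglyMeasurable
    have : Measurable fun x : Fin n → Obs 𝒞 𝒜 𝒵 => f (x i) := hf.comp (measurable_pi_apply i)
    fun_prop

/-- A statistic that is asymptotically linear along a local path is asymptotically normal. -/
theorem LocalPath.tendsto_integral_of_expansion {ν P : Measure (Obs 𝒞 𝒜 𝒵)}
    {Q : ℕ → Measure (Obs 𝒞 𝒜 𝒵)} {p : Obs 𝒞 𝒜 𝒵 → ℝ} {q : ℕ → Obs 𝒞 𝒜 𝒵 → ℝ} {N : ℕ → ℕ}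
    {f : Obs 𝒞 𝒜 𝒵 → ℝ} (h : LocalPath ν P Q p q) (hf : Measurable f) (hP : MemLp f 2 P)
    (hQ : ∀ n, MemLp f 2 (Q n)) {K : ℝ} (hK : ∀ n, ∫ x, f x ^ 2 ∂(Q n) ≤ K)
    (h0 : ∫ x, f x ∂P = 0) {V : ∀ n, Data 𝒞 𝒜 𝒵 n (N n) → ℝ} (hV : ∀ n, Measurable (V n))
    (hVW : IsLittleOpOne (fun n => sampleLaw (Q n) n (N n))
      fun n D => V n D - (√(n : ℝ))⁻¹ * ∑ i, (f (D.1 i) - ∫ x, f x ∂(Q n))) (g : ℝ →ᵇ ℝ) :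
    Tendsto (fun n => ∫ D, g (V n D) ∂(sampleLaw (Q n) n (N n))) atTop
      (𝓝 (∫ x, g x ∂(gaussianReal 0 (∫ x, f x ^ 2 ∂P).toNNReal))) := by
  have hprob : ∀ n, IsProbabilityMeasure (Q n) := fun n => (h.pair n).prob_right
  refine tendsto_integral_of_tendsto_charFun hV (fun n => ?_) hVW (fun t => ?_) g
  · refine (Finset.measurable_fun_sum _ fun i _ => ?_).const_mul _
    exact (hf.comp ((measurable_pi_apply i).comp measurable_fst)).sub_const _
  · rw [charFun_gaussianReal]
    have e : Complex.exp (t * (0 : ℝ) * Complex.I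
        - ((∫ x, f x ^ 2 ∂P).toNNReal : ℝ) * (t : ℂ) ^ 2 / 2)
        = Complex.exp (-((t ^ 2 * ∫ x, f x ^ 2 ∂P : ℝ) : ℂ) / 2) := by
      rw [Real.coe_toNNReal _ (integral_nonneg fun x => sq_nonneg _)]
      congr 1
      push_cast
      ring
    refine Tendsto.congr (fun n => ?_) (e ▸ h.tendsto_integral_exp_pow hf hP hQ hK h0 t)
    exact (integral_exp_sample_sum (hf.sub_const _) t _).symm

end Sample

end TripleDoor

/-! ### Local paths from differentiability in quadratic mean. -/

namespace TripleDoor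

theorem tendsto_inv_sqrt_natCast : Tendsto (fun n : ℕ => (√(n : ℝ))⁻¹) atTop (𝓝 0) :=
  tendsto_inv_atTop_zero.comp (Real.tendsto_sqrt_atTop.comp tendsto_natCast_atTop_atTop)

section Path

variable {𝓧 : Type*} [MeasurableSpace 𝓧] {ν P : Measure 𝓧} {Q : ℕ → Measure 𝓧}

theorem tendsto_zero_of_sqrt_mul_norm_le {E : Type*} [NormedAddCommGroup E] {β : ℕ → E} {B : ℝ}
    (hB : ∀ n : ℕ, √(n : ℝ) * ‖β n‖ ≤ B) : Tendsto β atTop (𝓝 0) := by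
  have h1 : Tendsto (fun n : ℕ => B * (√(n : ℝ))⁻¹) atTop (𝓝 0) := by
    simpa using tendsto_inv_sqrt_natCast.const_mul B
  refine squeeze_zero_norm' ?_ h1
  filter_upwards [eventually_gt_atTop 0] with n hn
  have : 0 < √(n : ℝ) := Real.sqrt_pos.2 (by positivity)
  rw [← div_eq_mul_inv, le_div_iff₀ this, mul_comm]
  exact hB n

/-- Differentiability in quadratic mean provides local paths. -/
theorem LocalPath.of_qmd {k : ℕ} {d : (Fin k → ℝ) → 𝓧 → ℝ} {s : Fin k → 𝓧 → ℝ}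
    {β : ℕ → Fin k → ℝ} (hpair : ∀ n, DensityPair ν P (Q n) (d 0) (d (β n)))
    (hsm : ∀ j, Measurable (s j)) (hs : ∀ j, MemLp (s j) 2 P)
    (hq : (fun β => ∫ x, (√(d β x) - √(d 0 x)
      - (1 / 2) * (∑ j, β j * s j x) * √(d 0 x)) ^ 2 ∂ν) =o[𝓝 0] fun β => ‖β‖ ^ 2) {B : ℝ}
    (hB : ∀ n : ℕ, √(n : ℝ) * ‖β n‖ ≤ B) : LocalPath ν P Q (d 0) fun n => d (β n) := by
  have hβ := tendsto_zero_of_sqrt_mul_norm_le hB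
  have hB2 : ∀ n : ℕ, (n : ℝ) * ‖β n‖ ^ 2 ≤ B ^ 2 := fun n => by
    have := pow_le_pow_left₀ (by positivity) (hB n) 2
    rwa [mul_pow, Real.sq_sqrt (Nat.cast_nonneg n)] at this
  set r : ℕ → 𝓧 → ℝ := fun n x => √(d (β n) x) - √(d 0 x)
      - (1 / 2) * (∑ j, β n j * s j x) * √(d 0 x) with hr
  set S : 𝓧 → ℝ := fun x => ∑ j, |s j x| with hS
  have hSm : Measurable S := Finset.measurable_fun_sum _ fun j _ => (hsm j).abs
  have hS2 : MemLp S 2 P := memLp_finsetSum _ fun j _ => (hs j).abs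
  have hd0 : ∀ x, 0 ≤ d 0 x := (hpair 0).left_nonneg
  have hSi : Integrable (fun x => d 0 x * S x ^ 2) ν := (hpair 0).integrable_iff.1 hS2.integrable_sq
  have hlin : ∀ n x, ((1 / 2) * (∑ j, β n j * s j x) * √(d 0 x)) ^ 2
      ≤ (1 / 4) * ‖β n‖ ^ 2 * (d 0 x * S x ^ 2) := fun n x => by
    have h1 : |∑ j, β n j * s j x| ≤ ‖β n‖ * S x := by
      rw [hS, Finset.mul_sum]
      refine (Finset.abs_sum_le_sum_abs _ _).trans (Finset.sum_le_sum fun j _ => ?_)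
      rw [abs_mul]
      exact mul_le_mul_of_nonneg_right (norm_le_pi_norm (β n) j) (abs_nonneg _)
    have h2 := pow_le_pow_left₀ (abs_nonneg _) h1 2
    rw [sq_abs, mul_pow] at h2
    rw [mul_pow, mul_pow, Real.sq_sqrt (hd0 x)]
    calc _ ≤ (1 / 2) ^ 2 * (‖β n‖ ^ 2 * S x ^ 2) * d 0 x := by
          gcongr
          exact hd0 x
      _ = _ := by ring
  have hrm : ∀ n, Measurable (r n) := fun n => by
    have h1 : Measurable fun x => ∑ j, β n j * s j x :=
      Finset.measurable_fun_sum _ fun j _ => (hsm j).const_mul _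
    exact ((hpair n).measurable_right.sqrt.sub (hpair n).measurable_left.sqrt).sub
      ((h1.const_mul _).mul (hpair n).measurable_left.sqrt)
  have hri : ∀ n, Integrable (fun x => r n x ^ 2) ν := fun n => by
    refine (((hpair n).integrable_rootDiff_sq.const_mul 2).add
      ((hSi.const_mul ((1 / 4) * ‖β n‖ ^ 2)).const_mul 2)).mono'
      ((hrm n).pow_const 2).aestronglyMeasurable (ae_of_all _ fun x => ?_)
    rw [Real.norm_of_nonneg (sq_nonneg _)]
    change r n x ^ 2 ≤ 2 * rootDiff (d 0) (d (β n)) x ^ 2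
      + 2 * ((1 / 4) * ‖β n‖ ^ 2 * (d 0 x * S x ^ 2))
    have e : r n x = rootDiff (d 0) (d (β n)) x - (1 / 2) * (∑ j, β n j * s j x) * √(d 0 x) := rfl
    rw [e]
    nlinarith [hlin n x, sq_nonneg (rootDiff (d 0) (d (β n)) x
      + (1 / 2) * (∑ j, β n j * s j x) * √(d 0 x))]
  have hdle : ∀ n x, rootDiff (d 0) (d (β n)) x ^ 2
      ≤ 2 * r n x ^ 2 + (1 / 2) * ‖β n‖ ^ 2 * (d 0 x * S x ^ 2) := fun n x => by
    have e : rootDiff (d 0) (d (β n)) x = r n x + (1 / 2) * (∑ j, β n j * s j x) * √(d 0 x) := by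
      simp only [hr, rootDiff]
      ring
    rw [e]
    nlinarith [hlin n x, sq_nonneg (r n x - (1 / 2) * (∑ j, β n j * s j x) * √(d 0 x))]
  have hrt : Tendsto (fun n : ℕ => (n : ℝ) * ∫ x, r n x ^ 2 ∂ν) atTop (𝓝 0) := by
    have h1 : (fun n => ∫ x, r n x ^ 2 ∂ν) =o[atTop] fun n => ‖β n‖ ^ 2 := hq.comp_tendsto hβ
    have h2 := (isBigO_refl (fun n : ℕ => (n : ℝ)) atTop).mul_isLittleO h1
    have h3 : (fun n : ℕ => (n : ℝ) * ‖β n‖ ^ 2) =O[atTop] fun _ => (1 : ℝ) := by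
      refine IsBigO.of_bound (B ^ 2) (Eventually.of_forall fun n => ?_)
      rw [Real.norm_of_nonneg (by positivity), norm_one, mul_one]
      exact hB2 n
    exact (isLittleO_one_iff ℝ).1 (h2.trans_isBigO h3)
  -- The quadratic-mean remainder tends to zero uniformly in `E`, and the score part is a constant
  -- times `∫_E S² dP`. Taking `E` to be everything gives the Hellinger bound; vanishing `P(E)`
  -- gives negligibility by absolute continuity of the integral.
  have hset : ∀ (n : ℕ) {E : Set 𝓧}, MeasurableSet E →
      (n : ℝ) * ∫ x in E, rootDiff (d 0) (d (β n)) x ^ 2 ∂ν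
        ≤ 2 * ((n : ℝ) * ∫ x, r n x ^ 2 ∂ν) + (1 / 2) * B ^ 2 * ∫ x in E, S x ^ 2 ∂P :=
      fun n E hE => by
    have e1 : ∫ x in E, d 0 x * S x ^ 2 ∂ν = ∫ x in E, S x ^ 2 ∂P := by
      rw [← integral_indicator hE, ← integral_indicator hE, (hpair 0).integral_eq]
      congr 1
      ext x
      by_cases hx : x ∈ E <;> simp [hx]
    have h0 : 0 ≤ ∫ x in E, S x ^ 2 ∂P := integral_nonneg fun _ => sq_nonneg _
    calc _ ≤ (n : ℝ) * ∫ x in E, (2 * r n x ^ 2 + (1 / 2) * ‖β n‖ ^ 2 * (d 0 x * S x ^ 2)) ∂ν := by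
          gcongr
          · exact (hpair n).integrable_rootDiff_sq.integrableOn
          · exact (((hri n).const_mul 2).add (hSi.const_mul _)).integrableOn
          · exact hE.nullMeasurableSet
          · exact hdle n _
      _ = 2 * ((n : ℝ) * ∫ x in E, r n x ^ 2 ∂ν)
          + (1 / 2) * ((n : ℝ) * ‖β n‖ ^ 2) * ∫ x in E, S x ^ 2 ∂P := by
          rw [integral_add ((hri n).const_mul 2).integrableOn (hSi.const_mul _).integrableOn,
            integral_const_mul, integral_const_mul, e1]
          ring
      _ ≤ _ := by
          gcongr
          · exact ae_of_all _ fun x => sq_nonneg _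
          · exact hri n
          · exact Measure.restrict_le_self
          · exact hB2 n
  refine ⟨hpair, ?_, fun E hE hPE => ?_⟩
  · obtain ⟨C, hC⟩ := hrt.bddAbove_range
    refine ⟨2 * C + (1 / 2) * B ^ 2 * ∫ x, S x ^ 2 ∂P, fun n => ?_⟩
    have h1 := hset n MeasurableSet.univ
    simp only [setIntegral_univ] at h1
    have h2 := hC (Set.mem_range_self n)
    linarith
  · have h1 := (hrt.const_mul 2).add
      ((hS2.integrable_sq.tendsto_setIntegral_nhds_zero hPE).const_mul ((1 / 2) * B ^ 2))
    simp only [mul_zero, add_zero] at h1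
    exact squeeze_zero (fun n => by positivity) (fun n => hset n (hE n)) h1

end Path

/-- Nuisance values are ratios of means, and `A/B - A₀/B₀ = ((A - A₀) - (A₀/B₀)(B - B₀))/B`
transfers their rate. -/
theorem isBigO_div_sub_div {A B r : ℕ → ℝ} {A₀ B₀ : ℝ} (hr : Tendsto r atTop (𝓝 0))
    (hA : (fun n => A n - A₀) =O[atTop] r) (hB : (fun n => B n - B₀) =O[atTop] r) (h0 : B₀ ≠ 0) :
    (fun n => A n / B n - A₀ / B₀) =O[atTop] r := by
  have hBt : Tendsto B atTop (𝓝 B₀) := by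
    have := hB.trans_tendsto hr
    simpa using this.add_const B₀
  have h1 : (fun n => (A n - A₀) - (A₀ / B₀) * (B n - B₀)) =O[atTop] r :=
    hA.sub (hB.const_mul_left _)
  have h2 : (fun n => (B n)⁻¹) =O[atTop] fun _ => (1 : ℝ) := (hBt.inv₀ h0).isBigO_one ℝ
  have h3 := h1.mul h2
  simp only [mul_one] at h3
  refine h3.congr' ?_ EventuallyEq.rfl
  filter_upwards [hBt.eventually_ne h0] with n hn
  field_simp
  ring

/-! ### The bias of the influence function along a local path. -/

section Bias

variable {𝒞 𝒜 𝒵 : Type u} [MeasurableSpace 𝒞] [MeasurableSpace 𝒜] [MeasurableSpace 𝒵]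
  [MeasurableSingletonClass 𝒞] [MeasurableSingletonClass 𝒜] [MeasurableSingletonClass 𝒵]
  {ν P : Measure (Obs 𝒞 𝒜 𝒵)} {Q : ℕ → Measure (Obs 𝒞 𝒜 𝒵)} {p : Obs 𝒞 𝒜 𝒵 → ℝ}
  {q : ℕ → Obs 𝒞 𝒜 𝒵 → ℝ} {θ : 𝒜 → ℝ} {θn : ℕ → 𝒜 → ℝ}

namespace LocalPath

theorem isBigO_integral_sub (h : LocalPath ν P Q p q) {f : Obs 𝒞 𝒜 𝒵 → ℝ} (hf : Measurable f)
    (hP : MemLp f 2 P) (hQ : ∀ n, MemLp f 2 (Q n)) {K : ℝ} (hK : ∀ n, ∫ x, f x ^ 2 ∂(Q n) ≤ K) :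
    (fun n => ∫ x, f x ∂(Q n) - ∫ x, f x ∂P) =O[atTop] fun n : ℕ => (√(n : ℝ))⁻¹ := by
  obtain ⟨C, hC⟩ := h.integral_sub_isBigO hf hP hQ hK
  refine IsBigO.of_bound C ?_
  filter_upwards [eventually_gt_atTop 0] with n hn
  have : 0 < √(n : ℝ) := Real.sqrt_pos.2 (by positivity)
  rw [Real.norm_of_nonneg (by positivity : 0 ≤ (√(n : ℝ))⁻¹), ← div_eq_mul_inv, le_div_iff₀ this,
    mul_comm]
  exact hC n

theorem isBigO_measureReal_sub (h : LocalPath ν P Q p q) {E : Set (Obs 𝒞 𝒜 𝒵)}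
    (hE : MeasurableSet E) :
    (fun n => (Q n).real E - P.real E) =O[atTop] fun n : ℕ => (√(n : ℝ))⁻¹ := by
  have := (h.pair 0).prob_left
  have hprob : ∀ n, IsProbabilityMeasure (Q n) := fun n => (h.pair n).prob_right
  have h1 := h.isBigO_integral_sub (f := E.indicator fun _ => 1) (measurable_const.indicator hE)
    ((memLp_const 1).indicator hE) (fun n => (memLp_const 1).indicator hE) (K := 1) fun n => by
      calc _ = ∫ x, E.indicator (fun _ => (1 : ℝ)) x ∂(Q n) := by
            congr 1
            ext x
            by_cases hx : x ∈ E <;> simp [hx]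
        _ ≤ 1 := by
            rw [integral_indicator_const _ hE]
            simp
  simpa only [integral_indicator_const _ hE, smul_eq_mul, mul_one] using h1

theorem isBigO_setIntegral_sub (h : LocalPath ν P Q p q)
    (hP : MemLp (fun x : Obs 𝒞 𝒜 𝒵 => x.2.2.2) 2 P)
    (hQ : ∀ n, MemLp (fun x : Obs 𝒞 𝒜 𝒵 => x.2.2.2) 2 (Q n)) {K : ℝ}
    (hK : ∀ n, ∫ x, x.2.2.2 ^ 2 ∂(Q n) ≤ K) {E : Set (Obs 𝒞 𝒜 𝒵)} (hE : MeasurableSet E) :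
    (fun n => ∫ x in E, x.2.2.2 ∂(Q n) - ∫ x in E, x.2.2.2 ∂P)
      =O[atTop] fun n : ℕ => (√(n : ℝ))⁻¹ := by
  have hm : Measurable fun x : Obs 𝒞 𝒜 𝒵 => x.2.2.2 := by fun_prop
  have h1 := h.isBigO_integral_sub (f := E.indicator fun x => x.2.2.2) (hm.indicator hE)
    (hP.indicator hE) (fun n => (hQ n).indicator hE) (K := K) fun n => by
      refine le_trans (integral_mono ((hQ n).indicator hE).integrable_sq (hQ n).integrable_sq
        fun x => ?_) (hK n)
      by_cases hx : x ∈ E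
      · simp [hx]
      · simp only [hx, not_false_eq_true, Set.indicator_of_notMem]
        nlinarith [sq_nonneg x.2.2.2]
  simpa only [integral_indicator hE] using h1

variable [Fintype 𝒞] [Fintype 𝒜] [Fintype 𝒵]

/-- The roles are reversed here: the data law is `Qₙ` and the nuisance is frozen at that of `P`.
Each nuisance error is `O(n^{-1/2})`, so every product is `O(1/n)`. -/
theorem isBigO_driftBound (h : LocalPath ν P Q p q) (hM : ObsModel P θ)
    (hP : MemLp (fun x : Obs 𝒞 𝒜 𝒵 => x.2.2.2) 2 P)
    (hQ : ∀ n, MemLp (fun x : Obs 𝒞 𝒜 𝒵 => x.2.2.2) 2 (Q n)) {K : ℝ}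
    (hK : ∀ n, ∫ x, x.2.2.2 ^ 2 ∂(Q n) ≤ K) (b : 𝒜) :
    (fun n => driftBound (Q n) (trueNuisance P) b)
      =O[atTop] fun n : ℕ => (√(n : ℝ))⁻¹ * (√(n : ℝ))⁻¹ := by
  have sym : ∀ {F : ℕ → ℝ} {x : ℝ}, (fun n => F n - x) =O[atTop] (fun n : ℕ => (√(n : ℝ))⁻¹) →
      (fun n => |x - F n|) =O[atTop] (fun n : ℕ => (√(n : ℝ))⁻¹) := fun hF =>
    hF.abs_left.congr_left fun n => abs_sub_comm _ _
  have he : ∀ z c, (fun n => |(trueNuisance P).e z c - (trueNuisance (Q n)).e z c|)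
      =O[atTop] fun n : ℕ => (√(n : ℝ))⁻¹ := fun z c =>
    sym (isBigO_div_sub_div tendsto_inv_sqrt_natCast
      (h.isBigO_setIntegral_sub hP hQ hK ((measurableSet_obsZ z).inter (measurableSet_obsC c)))
      (h.isBigO_measureReal_sub ((measurableSet_obsZ z).inter (measurableSet_obsC c)))
      (hM.real_ZC_pos z c).ne')
  have hA : ∀ b, (fun n => |probA P b - probA (Q n) b|) =O[atTop] fun n : ℕ => (√(n : ℝ))⁻¹ :=
    fun b => sym (h.isBigO_measureReal_sub (measurableSet_obsA b))
  have hC : ∀ c, (fun n => |(trueNuisance P).pC c - (trueNuisance (Q n)).pC c|)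
      =O[atTop] fun n : ℕ => (√(n : ℝ))⁻¹ := fun c =>
    sym (h.isBigO_measureReal_sub (measurableSet_obsC c))
  have hpZ : ∀ b z, (fun n => |(trueNuisance P).pZ b z - (trueNuisance (Q n)).pZ b z|)
      =O[atTop] fun n : ℕ => (√(n : ℝ))⁻¹ := fun b z =>
    sym (isBigO_div_sub_div tendsto_inv_sqrt_natCast
      (h.isBigO_measureReal_sub ((measurableSet_obsZ z).inter (measurableSet_obsA b)))
      (h.isBigO_measureReal_sub (measurableSet_obsA b)) (hM.probA_pos b).ne')
  have hpA : ∀ c b, (fun n => |(trueNuisance P).pA c b - (trueNuisance (Q n)).pA c b|)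
      =O[atTop] fun n : ℕ => (√(n : ℝ))⁻¹ := fun c b =>
    sym (isBigO_div_sub_div tendsto_inv_sqrt_natCast
      (h.isBigO_measureReal_sub ((measurableSet_obsA b).inter (measurableSet_obsC c)))
      (h.isBigO_measureReal_sub (measurableSet_obsC c)) (hM.pC_pos c).ne')
  unfold driftBound
  simp only [hM.margA_eq]
  refine IsBigO.fun_sum fun zc _ => (IsBigO.fun_sum fun b' _ => ?_).add ?_
  · exact ((he _ _).mul (hpA _ _)).add ((he _ _).mul (hpZ _ _))
  · exact (((hpZ _ _).mul (hA _)).add ((hpZ _ _).mul (hC _))).add ((he _ _).mul (hpZ _ _))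

end LocalPath

theorem exists_forall_abs_le {ι : Type*} [Finite ι] (F : ι → ℝ) : ∃ K, ∀ i, |F i| ≤ K := by
  obtain ⟨K, hK⟩ := (Set.finite_range fun i => |F i|).bddAbove
  exact ⟨K, fun i => hK (Set.mem_range_self i)⟩

variable [Fintype 𝒞] [Fintype 𝒜] [Fintype 𝒵]

theorem ObsModel.exists_nuisanceBound_true (hM : ObsModel P θ) (astar a : 𝒜) :
    ∃ K, NuisanceBound astar a (trueNuisance P) K := by
  obtain ⟨K₁, h1⟩ := exists_forall_abs_le fun zc : 𝒵 × 𝒞 => (trueNuisance P).e zc.1 zc.2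
  obtain ⟨K₂, h2⟩ := exists_forall_abs_le fun bz : 𝒜 × 𝒵 => (trueNuisance P).pZ bz.1 bz.2
  obtain ⟨K₃, h3⟩ := exists_forall_abs_le fun cb : 𝒞 × 𝒜 => (trueNuisance P).pA cb.1 cb.2
  obtain ⟨K₄, h4⟩ := exists_forall_abs_le (trueNuisance P).pC
  obtain ⟨K₅, h5⟩ := exists_forall_abs_le fun zc : 𝒵 × 𝒞 =>
    (∑' b, (trueNuisance P).pA zc.2 b * (trueNuisance P).pZ b zc.1)⁻¹
  obtain ⟨K₆, h6⟩ := exists_forall_abs_le fun b => ((trueNuisance P).margA b)⁻¹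
  set K := 1 + |K₁| + |K₂| + |K₃| + |K₄| + |K₅| + |K₆| with hK
  have a1 := le_abs_self K₁
  have a2 := le_abs_self K₂
  have a3 := le_abs_self K₃
  have a4 := le_abs_self K₄
  have a5 := le_abs_self K₅
  have a6 := le_abs_self K₆
  have b1 := abs_nonneg K₁
  have b2 := abs_nonneg K₂
  have b3 := abs_nonneg K₃
  have b4 := abs_nonneg K₄
  have b5 := abs_nonneg K₅
  have b6 := abs_nonneg K₆
  refine ⟨K, by linarith, fun z c => (h1 (z, c)).trans (by linarith),
    fun b _ z => (h2 (b, z)).trans (by linarith), fun c b => (h3 (c, b)).trans (by linarith),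
    fun c => (h4 c).trans (by linarith), fun z c h0 => ?_,
    fun z c => (h5 (z, c)).trans (by linarith), fun b _ => ?_,
    fun b _ => (h6 b).trans (by linarith)⟩
  · have := hM.real_ZC_pos z c
    rw [hM.real_ZC, h0, mul_zero] at this
    exact lt_irrefl _ this
  · rw [hM.margA_eq]
    exact (hM.probA_pos b).ne'

/-- Along a local path within the model, the mean of `m` at the true nuisance of the centre
differs from the target by `o(n^{-1/2})`. -/
theorem LocalPath.tendsto_sqrt_mul_bias (h : LocalPath ν P Q p q) (hM : ObsModel P θ)
    (hMn : ∀ n, ObsModel (Q n) (θn n))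
    (hP : MemLp (fun x : Obs 𝒞 𝒜 𝒵 => x.2.2.2) 2 P)
    (hQ : ∀ n, MemLp (fun x : Obs 𝒞 𝒜 𝒵 => x.2.2.2) 2 (Q n)) {K : ℝ}
    (hK : ∀ n, ∫ x, x.2.2.2 ^ 2 ∂(Q n) ≤ K) (astar a : 𝒜) :
    Tendsto (fun n : ℕ => √(n : ℝ) * (∫ x, mFun astar a (trueNuisance P) x ∂(Q n)
      - (θn n astar - θn n a))) atTop (𝓝 0) := by
  obtain ⟨K₁, h1⟩ := hM.exists_nuisanceBound_true astar a
  have h2 : (fun n => ∫ x, mFun astar a (trueNuisance P) x ∂(Q n) - (θn n astar - θn n a))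
      =O[atTop] fun n : ℕ => (√(n : ℝ))⁻¹ * (√(n : ℝ))⁻¹ := by
    refine IsBigO.trans (isBigO_of_le _ fun n => ?_)
      (((h.isBigO_driftBound hM hP hQ hK astar).add
        (h.isBigO_driftBound hM hP hQ hK a)).const_mul_left (K₁ ^ 3))
    rw [Real.norm_eq_abs, Real.norm_eq_abs]
    exact ((hMn n).abs_integral_mFun_sub_le h1).trans (le_abs_self _)
  have h3 := (isBigO_refl (fun n : ℕ => √(n : ℝ)) atTop).mul h2
  have h4 : (fun n : ℕ => √(n : ℝ) * ((√(n : ℝ))⁻¹ * (√(n : ℝ))⁻¹)) = fun n : ℕ => (√(n : ℝ))⁻¹ := by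
    ext n
    rcases eq_or_ne (√(n : ℝ)) 0 with h0 | h0
    · simp [h0]
    · field_simp
  rw [h4] at h3
  exact h3.trans_tendsto tendsto_inv_sqrt_natCast

end Bias

end TripleDoor

/-! ### Regularity and the main theorem. -/

namespace TripleDoor

section Regularity

variable {𝒞 𝒜 𝒵 : Type u} [MeasurableSpace 𝒞] [MeasurableSpace 𝒜] [MeasurableSpace 𝒵]

/-- The submodel is well behaved only near `0`, which `βₙ` reaches eventually. Offending terms are
replaced by `0`, where all the properties hold and the rate bound persists. Limits do not notice the
change. -/
theorem RegularSubmodel.exists_modification {S : CausalSystem 𝒞 𝒜 𝒵} (R : RegularSubmodel S)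
    {β : ℕ → Fin R.k → ℝ} {B : ℝ} (hB : ∀ n : ℕ, √(n : ℝ) * ‖β n‖ ≤ B) :
    ∃ (β' : ℕ → Fin R.k → ℝ) (K : ℝ), (∀ᶠ n in atTop, β' n = β n) ∧
      (∀ n : ℕ, √(n : ℝ) * ‖β' n‖ ≤ B) ∧ ∀ n, (R.sys (β' n)).InModel ∧
      (R.sys (β' n)).law = R.ν.withDensity (fun x => ENNReal.ofReal (R.dens (β' n) x)) ∧
      MemLp (fun x : Obs 𝒞 𝒜 𝒵 => x.2.2.2) 2 (R.sys (β' n)).law ∧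
      ∫ x, x.2.2.2 ^ 2 ∂(R.sys (β' n)).law ≤ K := by
  classical
  obtain ⟨K, hK⟩ := R.second_moment
  have hg := R.inModel.and (R.law_eq.and hK)
  have hβ := tendsto_zero_of_sqrt_mul_norm_le hB
  refine ⟨fun n => if (R.sys (β n)).InModel ∧
      (R.sys (β n)).law = R.ν.withDensity (fun x => ENNReal.ofReal (R.dens (β n) x)) ∧
      MemLp (fun x : Obs 𝒞 𝒜 𝒵 => x.2.2.2) 2 (R.sys (β n)).law ∧
      ∫ x, x.2.2.2 ^ 2 ∂(R.sys (β n)).law ≤ K then β n else 0, K, ?_, fun n => ?_, fun n => ?_⟩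
  · filter_upwards [hβ.eventually hg] with n hn
    exact if_pos hn
  · beta_reduce
    split_ifs
    · exact hB n
    · rw [norm_zero, mul_zero]
      exact le_trans (by positivity) (hB n)
  · beta_reduce
    split_ifs with h
    · exact h
    · exact hg.self_of_nhds

variable [MeasurableSingletonClass 𝒞] [MeasurableSingletonClass 𝒜] [MeasurableSingletonClass 𝒵]
  [Fintype 𝒞] [Fintype 𝒜] [Fintype 𝒵]

theorem measurable_mFun (astar a : 𝒜) (η : Nuisance 𝒞 𝒜 𝒵) : Measurable (mFun astar a η) := by
  have hX : Measurable fun x : Obs 𝒞 𝒜 𝒵 => (x.1, x.2.1, x.2.2.1) := by fun_prop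
  have hY : Measurable fun x : Obs 𝒞 𝒜 𝒵 => x.2.2.2 := by fun_prop
  rw [show mFun astar a η = _ from funext (mFun_eq_slope_base astar a η)]
  exact (hY.mul ((measurable_of_countable (mSlope astar a η)).comp hX)).add
    ((measurable_of_countable (mBase astar a η)).comp hX)

/-- For each atom, slope and base are finite expressions in the estimated nuisance values;
discreteness of the atoms makes them jointly measurable. Measurability of the estimator follows from
its closed form. -/
theorem measurable_mFun_comp {Ω : Type*} [MeasurableSpace Ω] {η : Ω → Nuisance 𝒞 𝒜 𝒵}
    (hη : MeasurableNuisance η) {X : Ω → Obs 𝒞 𝒜 𝒵} (hX : Measurable X) (astar a : 𝒜) :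
    Measurable fun ω => mFun astar a (η ω) (X ω) := by
  have he := hη.e
  have hZ := hη.pZ
  have hA := hη.pA
  have hC := hη.pC
  have ht : Measurable fun ω => (ω, ((X ω).1, (X ω).2.1, (X ω).2.2.1)) := by fun_prop
  have hY : Measurable fun ω => (X ω).2.2.2 := by fun_prop
  have h1 : Measurable fun ωt : Ω × (𝒞 × 𝒜 × 𝒵) => mSlope astar a (η ωt.1) ωt.2 :=
    measurable_from_prod_countable_left fun t => by
      simp only [mSlope, tsum_fintype]
      fun_prop
  have h2 : Measurable fun ωt : Ω × (𝒞 × 𝒜 × 𝒵) => mBase astar a (η ωt.1) ωt.2 :=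
    measurable_from_prod_countable_left fun t => by
      simp only [mBase, mFun, Nuisance.margA, tsum_fintype]
      fun_prop
  simp_rw [mFun_eq_slope_base astar a (η _)]
  exact (hY.mul (h1.comp ht)).add (h2.comp ht)

theorem measurable_sqrt_mul_sub {astar a : 𝒜} {N : ℕ → ℕ}
    {ηhat : ∀ n, Data 𝒞 𝒜 𝒵 n (N n) → Nuisance 𝒞 𝒜 𝒵} (hη : ∀ n, MeasurableNuisance (ηhat n))
    {T : ∀ n, Data 𝒞 𝒜 𝒵 n (N n) → ℝ} (hT : SolvesEstimatingEquation astar a N ηhat T)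
    (n : ℕ) (c : ℝ) : Measurable fun D => √(n : ℝ) * (T n D - c) := by
  -- At `n = 0` the estimator is arbitrary, but the factor `√0` makes the statistic constant.
  rcases eq_or_ne n 0 with rfl | hn
  · simp
  · simp_rw [hT.eq_average hn]
    refine (((Finset.measurable_fun_sum _ fun i _ => ?_).const_mul _).sub_const _).const_mul _
    exact measurable_mFun_comp (hη n) ((measurable_pi_apply i).comp measurable_fst) astar a

theorem exists_sq_mFun_le (astar a : 𝒜) (η : Nuisance 𝒞 𝒜 𝒵) (c : ℝ) :
    ∃ K₁ K₂ : ℝ, 0 ≤ K₁ ∧ ∀ x : Obs 𝒞 𝒜 𝒵, (mFun astar a η x - c) ^ 2 ≤ K₁ * x.2.2.2 ^ 2 + K₂ := by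
  obtain ⟨K₁, h1⟩ := exists_forall_abs_le (mSlope astar a η)
  obtain ⟨K₂, h2⟩ := exists_forall_abs_le fun t => mBase astar a η t - c
  refine ⟨2 * K₁ ^ 2, 2 * K₂ ^ 2, by positivity, fun x => ?_⟩
  have e1 := pow_le_pow_left₀ (abs_nonneg _) (h1 (x.1, x.2.1, x.2.2.1)) 2
  have e2 := pow_le_pow_left₀ (abs_nonneg _) (h2 (x.1, x.2.1, x.2.2.1)) 2
  rw [sq_abs] at e1 e2
  rw [mFun_eq_slope_base, add_sub_assoc]
  calc _ ≤ 2 * (x.2.2.2 * mSlope astar a η (x.1, x.2.1, x.2.2.1)) ^ 2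
        + 2 * (mBase astar a η (x.1, x.2.1, x.2.2.1) - c) ^ 2 := add_sq_le.trans (by linarith)
    _ = 2 * (mSlope astar a η (x.1, x.2.1, x.2.2.1) ^ 2 * x.2.2.2 ^ 2)
        + 2 * (mBase astar a η (x.1, x.2.1, x.2.2.1) - c) ^ 2 := by ring
    _ ≤ 2 * (K₁ ^ 2 * x.2.2.2 ^ 2) + 2 * K₂ ^ 2 := by gcongr
    _ = _ := by ring

/-- An asymptotically linear solution of the estimating equation is regular. -/
theorem AsympLinear.isRegularEstimator {S : CausalSystem 𝒞 𝒜 𝒵} (hS : S.InModel) {astar a : 𝒜}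
    {N : ℕ → ℕ} {ηhat : ∀ n, Data 𝒞 𝒜 𝒵 n (N n) → Nuisance 𝒞 𝒜 𝒵}
    (hη : ∀ n, MeasurableNuisance (ηhat n)) {T : ∀ n, Data 𝒞 𝒜 𝒵 n (N n) → ℝ}
    (hT : SolvesEstimatingEquation astar a N ηhat T) {K₀ : ℕ} (hN : ∀ n, N n ≤ K₀ * (n + 1))
    (hY : MemLp (fun x : Obs 𝒞 𝒜 𝒵 => x.2.2.2) 2 S.law)
    (hlin : AsympLinear S.law (S.ace astar a) N T
      (phi astar a (trueNuisance S.law) (S.ace astar a))) :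
    IsRegularEstimator S astar a N T := by
  set f := phi astar a (trueNuisance S.law) (S.ace astar a) with hf
  refine ⟨gaussianReal 0 (∫ x, f x ^ 2 ∂S.law).toNNReal, inferInstance, fun R β ⟨B, hB⟩ g => ?_⟩
  obtain ⟨β', K, hβ', hB', hgood⟩ := R.exists_modification hB
  have hfm : Measurable f := (measurable_mFun _ _ _).sub_const _
  set Q : ℕ → Measure (Obs 𝒞 𝒜 𝒵) := fun n => (R.sys (β' n)).law with hQ
  have hlaw0 : S.law = R.ν.withDensity fun x => ENNReal.ofReal (R.dens 0 x) := by
    rw [← R.law_zero]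
    exact R.law_eq.self_of_nhds
  have hpath : LocalPath R.ν S.law Q (R.dens 0) fun n => R.dens (β' n) :=
    LocalPath.of_qmd (fun n => ⟨inferInstance, inferInstance, hlaw0, (hgood n).2.1,
      R.measurable_dens _, R.measurable_dens _, R.dens_nonneg _, R.dens_nonneg _⟩)
      R.measurable_score R.memLp_score R.qmd hB'
  have hQY : ∀ n, MemLp (fun x : Obs 𝒞 𝒜 𝒵 => x.2.2.2) 2 (Q n) := fun n => (hgood n).2.2.1
  have hQK : ∀ n, ∫ x, x.2.2.2 ^ 2 ∂(Q n) ≤ K := fun n => (hgood n).2.2.2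
  have hbias := hpath.tendsto_sqrt_mul_bias hS.obsModel (fun n => (hgood n).1.obsModel) hY hQY hQK
    astar a
  have hQf : ∀ n, MemLp f 2 (Q n) := fun n => (memLp_mFun (hQY n) _ _ _).sub (memLp_const _)
  obtain ⟨K₁, K₂, hK₁, hsq⟩ := exists_sq_mFun_le astar a (trueNuisance S.law) (S.ace astar a)
  have hfK : ∀ n, ∫ x, f x ^ 2 ∂(Q n) ≤ K₁ * K + K₂ := fun n => by
    have hi := ((hQY n).integrable_sq.const_mul K₁).add (integrable_const K₂)
    calc _ ≤ ∫ x, (K₁ * x.2.2.2 ^ 2 + K₂) ∂(Q n) := integral_mono (hQf n).integrable_sq hi hsq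
      _ = K₁ * ∫ x, x.2.2.2 ^ 2 ∂(Q n) + K₂ := by
          rw [integral_add ((hQY n).integrable_sq.const_mul K₁) (integrable_const K₂),
            integral_const_mul]
          simp
      _ ≤ _ := by
          gcongr
          exact hQK n
  have hmean : ∀ n, ∫ x, f x ∂(Q n)
      = ∫ x, mFun astar a (trueNuisance S.law) x ∂(Q n) - S.ace astar a := fun n => by
    simp only [hf, phi]
    rw [integral_sub ((memLp_mFun (hQY n) _ _ _).integrable one_le_two) (integrable_const _)]
    simp
  -- Contiguity carries the expansion at `P` over to `Qₙ`. Recentring each summand at its `Qₙ`-mean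
  -- shifts the target from `θ` to `θ(βₙ)`, up to the scaled bias `hbias`.
  have hexp : IsLittleOpOne (fun n => sampleLaw (Q n) n (N n)) fun n D =>
      √(n : ℝ) * (T n D - (R.sys (β' n)).ace astar a)
        - (√(n : ℝ))⁻¹ * ∑ i, (f (D.1 i) - ∫ x, f x ∂(Q n)) := by
    have h1 := (hpath.isLittleOpOne hN hlin.expansion).add
      (isLittleOpOne_of_tendsto (μ := fun n => sampleLaw (Q n) n (N n)) hbias)
    refine h1.of_ae_eq (Eventually.of_forall fun n => ae_of_all _ fun D => ?_)
    beta_reduce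
    rw [Finset.sum_sub_distrib, Finset.sum_const, Finset.card_univ, Fintype.card_fin, nsmul_eq_mul,
      hmean]
    have e : (√(n : ℝ))⁻¹ * n = √(n : ℝ) := by
      rw [mul_comm, ← div_eq_mul_inv, Real.div_sqrt]
    rw [mul_sub (√(n : ℝ))⁻¹, ← mul_assoc (√(n : ℝ))⁻¹ (n : ℝ), e]
    simp only [CausalSystem.ace]
    ring
  have hlim := hpath.tendsto_integral_of_expansion hfm hlin.memLp hQf hfK hlin.mean_zero
    (fun n => measurable_sqrt_mul_sub hη hT n _) hexp g
  refine hlim.congr' ?_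
  filter_upwards [hβ'] with n hn
  simp only [hQ, hn]

end Regularity

end TripleDoor

theorem mainTheorem9
    {𝒞 𝒜 𝒵 : Type u} [Countable 𝒞] [Countable 𝒜] [Countable 𝒵]
    [MeasurableSpace 𝒞] [MeasurableSpace 𝒜] [MeasurableSpace 𝒵]
    [MeasurableSingletonClass 𝒞] [MeasurableSingletonClass 𝒜] [MeasurableSingletonClass 𝒵]
    (S : CausalSystem 𝒞 𝒜 𝒵) (hS : S.InModel) (astar a : 𝒜)
    (N : ℕ → ℕ)
    (ηhat : ∀ n, Data 𝒞 𝒜 𝒵 n (N n) → Nuisance 𝒞 𝒜 𝒵)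
    (hηhat : ∀ n, MeasurableNuisance (ηhat n))
    (θhat : ∀ n, Data 𝒞 𝒜 𝒵 n (N n) → ℝ)
    (hθhat : SolvesEstimatingEquation astar a N ηhat θhat) :
    -- consistency
    (∀ {ι : Type*} [Fintype ι] [DecidableEq ι] {E : ι → Type*} [∀ j, NormedAddCommGroup (E j)]
        [∀ j, NormedSpace ℝ (E j)] (η : (∀ j, E j) → Nuisance 𝒞 𝒜 𝒵)
        (βhat : ∀ n, Data 𝒞 𝒜 𝒵 n (N n) → ∀ j, E j) (βbar : ∀ j, E j),
      (∀ n D, ηhat n D = η (βhat n D)) →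
      (∀ j, IsLittleOpOne (fun n => sampleLaw S.law n (N n))
        fun n D => ‖βhat n D j - βbar j‖) →
      WellDefinedMean S.law astar a (η βbar) →
      ConsistencyRegularity S.law astar a η βbar →
      CorrectlySpecified S.law (η βbar) →
      IsLittleOpOne (fun n => sampleLaw S.law n (N n))
        fun n D => θhat n D - S.ace astar a) ∧
    -- asymptotic linearity and regularity
    ((∃ K : ℕ, ∀ n, N n ≤ K * (n + 1)) →
      MemLp S.out 2 S.μ →
      Boundedness S.law astar a N ηhat →
      IsLittleOpOne (fun n => sampleLaw S.law n (N n))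
        (fun n D => l2norm S.law (fun x => mFun astar a (ηhat n D) x -
          mFun astar a (trueNuisance S.law) x) ^ 2) →
      ProductRates S.law astar a N ηhat →
      AsympLinear S.law (S.ace astar a) N θhat
          (phi astar a (trueNuisance S.law) (S.ace astar a)) ∧
        IsRegularEstimator S astar a N θhat) := by
  have hM := hS.obsModel
  refine ⟨fun {ι} _ _ {E} _ _ η βhat βbar hη hβ hw hr hc => ?_, ?_⟩
  · have h := isLittleOpOne_of_consistencyRegularity hθhat hη hβ hw.integrable hr
    rwa [hM.integral_mFun_of_correctlySpecified hw hc] at h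
  · rintro ⟨K, hN⟩ hY hb hl hp
    obtain ⟨hC, hA, hZ⟩ := hM.finite_of_boundedness hb
    have := Fintype.ofFinite 𝒞
    have := Fintype.ofFinite 𝒜
    have := Fintype.ofFinite 𝒵
    have hY' : MemLp (fun x : Obs 𝒞 𝒜 𝒵 => x.2.2.2) 2 S.law := by
      have hm : Measurable fun x : Obs 𝒞 𝒜 𝒵 => x.2.2.2 := by fun_prop
      exact (memLp_map_measure_iff hm.aestronglyMeasurable S.measurable_obs.aemeasurable).2 hY
    have hlin := hM.asympLinear hηhat hθhat hY' hb hl hp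
    exact ⟨hlin, AsympLinear.isRegularEstimator hS hηhat hθhat hN hY' hlin⟩
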